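/- Let $\Omega\subset\mathbb R^2$ be a domain (open and connected), let $u\in C^1(\Omega)$, let $\vec F=(F_1,F_2)\in C^1(\Omega)$ be a vector field and let $H\in C^0(\Omega)$. A point of $\Omega$ is called singular if $\nabla u+\vec F=0$ there; let $S$ be the set of singular points. Assume that $u$ is a weak solution of $\operatorname{div}\frac{\nabla u+\vec F}{|\nabla u+\vec F|}=H$, that is, for all $\varphi\in C_0^\infty(\Omega)$ $$\int_{S}|\nabla\varphi|+\int_{\Omega\setminus S}\frac{\nabla u+\vec F}{|\nabla u+\vec F|}\cdot\nabla\varphi+\int_\Omega H\varphi\ \ge 0 .$$ Put $D=|\nabla u+\vec F|$, $\operatorname{curl}\vec F=\partial_xF_2-\partial_yF_1$ and, on $\Omega\setminus S$, $N=(N_1,N_2)=\frac{\nabla u+\vec F}{|\nabla u+\vec F|}$ and $N^\perp=(N_2,-N_1)$. For a function $g$ and a continuous vector field $V$, $V(g)$ denotes the derivative of $g$ along the integral curves of $V$. Assume that $N^\perp(\operatorname{curl}\vec F)$ and $N(H)$ exist and are continuous on $\Omega\setminus S$ and extend continuously to $\Omega$. A characteristic curve is a $C^1$ regularly parametrized curve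 in $\Omega\setminus S$ whose velocity is everywhere parallel to $N^\perp$ (in either direction). Let $p\in S$ with $\operatorname{curl}\vec F(p)\neq0$, and let $\Gamma:[0,\bar\rho)\to\Omega$ be $C^1$ with $\Gamma(0)=p$ such that $\Gamma|_{(0,\bar\rho)}$ is a characteristic curve with unit-speed parameter $\rho$. Then: (a) $D':=N^\perp(D)$ exists on $\Omega\setminus S$, and either $\lim_{\rho\to0^+}D'(\Gamma(\rho))=\frac{\operatorname{curl}\vec F(p)}2$ or $\lim_{\rho\to0^+}D'(\Gamma(\rho))=\operatorname{curl}\vec F(p)$. (b) If $\operatorname{curl}\vec F(p)>0$, then $N^\perp(\Gamma(\rho))=\Gamma'(\rho)$ for all $\rho\in(0,\bar\rho)$; if $\operatorname{curl}\vec F(p)<0$, then $N^\perp(\Gamma(\rho))=-\Gamma'(\rho)$ for all $\rho\in(0,\bar\rho)$. Moreover, under the assumptions of the first paragraph alone: (c) If $\operatorname{curl}\vec F\ne0$ everywhere in $\Omega$ and $p\neq q$ are two singular points in $\Omega$, then there is no $C^1$ map $\Gamma:[0,\bar\rho]\to\Omega$ with $\Gamma(0)=p$ and $\Gamma(\bar\rho)=q$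 whose restriction to $(0,\bar\rho)$ is a characteristic curve. -/

import Mathlib

noncomputable section

/-- The Euclidean plane `ℝ²`. -/
abbrev Plane : Type := EuclideanSpace ℝ (Fin 2)

/-- The planar field `∇u + F`. -/
def shiftedGradient (u : Plane → ℝ) (F : Plane → Plane) (x : Plane) : Plane :=
  gradient u x + F x

/-- The singular set of `u` in `Ω`: the points of `Ω` where `∇u + F = 0`. -/
def singularSet (Ω : Set Plane) (u : Plane → ℝ) (F : Plane → Plane) : Set Plane :=
  {x | x ∈ Ω ∧ shiftedGradient u F x = 0}

/-- `D = |∇u + F|`. -/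
def gradLength (u : Plane → ℝ) (F : Plane → Plane) (x : Plane) : ℝ :=
  ‖shiftedGradient u F x‖

/-- `N = (∇u + F) / |∇u + F|`, to be used at nonsingular points only. -/
def unitNormal (u : Plane → ℝ) (F : Plane → Plane) (x : Plane) : Plane :=
  (gradLength u F x)⁻¹ • shiftedGradient u F x

/-- `(a, b)^⊥ = (b, -a)`, so that `(cos θ, sin θ)^⊥ = (sin θ, -cos θ)`. -/
def perp (v : Plane) : Plane := !₂[v 1, -(v 0)]

/-- `N^⊥`, to be used at nonsingular points only. -/
def unitNormalPerp (u : Plane → ℝ) (F : Plane → Plane) (x : Plane) : Plane :=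
  perp (unitNormal u F x)

/-- `curl F = ∂F₂/∂x - ∂F₁/∂y`. -/
def planarCurl (F : Plane → Plane) (x : Plane) : ℝ :=
  fderiv ℝ F x (EuclideanSpace.single 0 1) 1 - fderiv ℝ F x (EuclideanSpace.single 1 1) 0

/-- `u` is a weak solution in `Ω` of `div ((∇u + F) / |∇u + F|) = H`: for every test function
`φ ∈ C₀^∞(Ω)`, writing `S` for the singular set,
`∫_S |∇φ| + ∫_{Ω \ S} N · ∇φ + ∫_Ω H φ ≥ 0`. -/
def IsWeakSolution (Ω : Set Plane) (u : Plane → ℝ) (F : Plane → Plane) (H : Plane → ℝ) : Prop :=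
  ∀ φ : Plane → ℝ, ContDiff ℝ (⊤ : ℕ∞) φ → HasCompactSupport φ → tsupport φ ⊆ Ω →
    0 ≤ (∫ x in singularSet Ω u F, ‖gradient φ x‖)
      + (∫ x in Ω \ singularSet Ω u F, inner ℝ (unitNormal u F x) (gradient φ x))
      + ∫ x in Ω, H x * φ x

/-- The derivative `V(g)` of the function `g` along the vector field `V` exists at `q` and equals
`g'`: along every integral curve of `V` through `q` the function `g` has derivative `g'` at `q`.
(For `V` continuous near `q` there is such a curve, so `g'` is then unique.) -/
def HasDerivAlong (V : Plane → Plane) (g : Plane → ℝ) (g' : ℝ) (q : Plane) : Prop :=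
  ∀ γ : ℝ → Plane, γ 0 = q → IsIntegralCurveAt γ (fun _ => V) 0 →
    HasDerivAt (fun t => g (γ t)) g' 0

/-- The derivative `V(g)` exists at all nonsingular points of `Ω`, and it is continuous there with
a continuous extension over the singular points to all of `Ω`. -/
def DerivAlongExtendsContinuously (Ω : Set Plane) (u : Plane → ℝ) (F : Plane → Plane)
    (V : Plane → Plane) (g : Plane → ℝ) : Prop :=
  ∃ h : Plane → ℝ, ContinuousOn h Ω ∧
    ∀ q ∈ Ω \ singularSet Ω u F, HasDerivAlong V g (h q) q

/-- On the parameter set `I`, `Γ` is a regularly parametrized characteristic curve of `u` in `Ω`: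
it runs through nonsingular points of `Ω` and its velocity is a nonzero multiple of `N^⊥`
(of either sign: the orientation is not prescribed). -/
def IsCharacteristicOn (Ω : Set Plane) (u : Plane → ℝ) (F : Plane → Plane)
    (Γ : ℝ → Plane) (I : Set ℝ) : Prop :=
  ∀ t ∈ I, Γ t ∈ Ω \ singularSet Ω u F ∧
    ∃ c : ℝ, c ≠ 0 ∧ HasDerivAt Γ (c • unitNormalPerp u F (Γ t)) t

end

/-!
The difficulty of the theorem is regularity: `u` is only `C¹`, so `N` and `D` are merely continuous,
and neither the derivatives of `D` along characteristic curves nor the geodesic deviation of these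
curves are available pointwise. Everything rests on Stokes' formula for the two one-forms
`A = ∇u + F = D N` and `B = N^⊥`.

*Curls of continuous fields.* `HasCurlOn A a U` says that Stokes' formula holds on the strip swept
out by the segments joining two moving points. This notion survives uniform limits, so `A` has curl
`curl F` (`hasCurlOn_shiftedGradient`), and mollification of the weak equation away from the singular
set gives `B` the curl `-H` (`hasCurlOn_unitNormalPerp`). Gronwall's inequality for the integrals of
`A` and `B` along the joining segments yields existence, uniqueness and Lipschitz dependence of
integral curves of `N^⊥` and of `N / D` (`IsCurlFrame.stability`,
`IsCurlFrame.exists_integralCurve`); and `N` is differentiable along integral curves of `N^⊥`, with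
`(N^⊥)' = -H N` (`hasDerivAt_unit_along`).

*The Jacobi equation.* Let `Γ` be an integral curve of `N^⊥` and `W s t` the flow of `N / D` started
at `Γ s`. Stokes' formula computes `∂W/∂s` (`IsLocalSolution.hasDerivAt_transversal_flow`), and
shifting `t` by the solution of a scalar equation turns `W` into a family of integral curves of
`N^⊥` near `Γ`. Their separation `v` satisfies `(D v)' = (curl F) v`; as `N(H)` exists, it also
satisfies `v'' = -(N(H) + H²) v` (`exists_hasDerivAt_separation`,
`IsLocalSolution.exists_jacobi_field`). Writing `c = curl F` and eliminating `v`, one finds that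
`D' = N^⊥(D)` exists and that (`exists_deriv_gradLength`)
`D'' = (2 D' - c) (D' - c) / D + N^⊥(c) + D (N(H) + H²)`.

*The singular limit.* Along a characteristic curve that runs into a singular point, `D` tends to
`0`. The solution `p = D'` of the equation above crosses every level other than the two zeros `c/2`
and `c` of `(2 p - c) (p - c)` in one direction only, so it has a limit, and every limit other than
these zeros is incompatible with `D → 0` (`tendsto_of_singular_system`). Since `D` is positive, it
must grow away from the singular point; so the sign of `c` there determines the orientation of the
curve, and a curve joining two singular points would require `curl F` to change its sign.
-/

noncomputable section

open Set Filter Topology MeasureTheory Metric Asymptotics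

/-! ### Algebra of the plane -/

section

lemma plane_inner (v w : Plane) : inner ℝ v w = v 0 * w 0 + v 1 * w 1 := by
  simp [PiLp.inner_apply, Fin.sum_univ_two, mul_comm]

@[simp] lemma perp_zero_apply (v : Plane) : perp v 0 = v 1 := by simp [perp]
@[simp] lemma perp_one_apply (v : Plane) : perp v 1 = -(v 0) := by simp [perp]

lemma plane_ext {v w : Plane} (h0 : v 0 = w 0) (h1 : v 1 = w 1) : v = w := by
  ext i; fin_cases i <;> assumption

lemma perp_perp (v : Plane) : perp (perp v) = -v := by
  apply plane_ext <;> simp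

lemma perp_add (v w : Plane) : perp (v + w) = perp v + perp w := by
  apply plane_ext <;> simp; ring

lemma perp_smul (c : ℝ) (v : Plane) : perp (c • v) = c • perp v := by
  apply plane_ext <;> simp

/-- The map `perp` as a continuous linear map. -/
def perpCLM : Plane →L[ℝ] Plane :=
  LinearMap.toContinuousLinearMap ⟨⟨perp, perp_add⟩, perp_smul⟩

@[fun_prop]
lemma continuous_perp : Continuous perp := perpCLM.continuous

lemma perp_neg (v : Plane) : perp (-v) = -perp v := by
  apply plane_ext <;> simp

lemma perp_sub (v w : Plane) : perp (v - w) = perp v - perp w := by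
  rw [sub_eq_add_neg, perp_add, perp_neg, sub_eq_add_neg]

lemma HasDerivAt.perp {f : ℝ → Plane} {f' : Plane} {t : ℝ} (h : HasDerivAt f f' t) :
    HasDerivAt (fun s => _root_.perp (f s)) (_root_.perp f') t :=
  perpCLM.hasFDerivAt.comp_hasDerivAt t h

lemma inner_perp_perp (v w : Plane) : inner ℝ (perp v) (perp w) = inner ℝ v w := by
  simp [plane_inner]; ring

lemma norm_perp (v : Plane) : ‖perp v‖ = ‖v‖ := by
  rw [← sq_eq_sq₀ (norm_nonneg _) (norm_nonneg _), ← real_inner_self_eq_norm_sq,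
    ← real_inner_self_eq_norm_sq, inner_perp_perp]

lemma inner_perp_self (v : Plane) : inner ℝ (perp v) v = 0 := by
  simp [plane_inner]; ring

lemma inner_self_perp (v : Plane) : inner ℝ v (perp v) = 0 := by
  simp [plane_inner]; ring

lemma inner_perp_right (v w : Plane) : inner ℝ v (perp w) = -inner ℝ (perp v) w := by
  simp [plane_inner]

lemma abs_inner_perp_le (v w : Plane) : |inner ℝ v (perp w)| ≤ ‖v‖ * ‖w‖ := by
  simpa [norm_perp] using abs_real_inner_le_norm v (perp w)

/-- Expansion of a vector in the orthonormal frame `n`, `perp n`. -/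
lemma eq_inner_smul_add_inner_perp_smul {n : Plane} (hn : ‖n‖ = 1) (v : Plane) :
    v = (inner ℝ n v : ℝ) • n + (inner ℝ (perp n) v : ℝ) • perp n := by
  have h : n 0 * n 0 + n 1 * n 1 = 1 := by
    rw [← plane_inner, real_inner_self_eq_norm_sq, hn]; norm_num
  apply plane_ext
  · simp [plane_inner]; linear_combination (-v 0) * h
  · simp [plane_inner]; linear_combination (-v 1) * h

lemma norm_le_abs_inner_add_abs_inner_perp {n : Plane} (hn : ‖n‖ = 1) (v : Plane) :
    ‖v‖ ≤ |inner ℝ n v| + |inner ℝ (perp n) v| := by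
  conv_lhs => rw [eq_inner_smul_add_inner_perp_smul hn v]
  refine (norm_add_le _ _).trans ?_
  rw [norm_smul, norm_smul, norm_perp, hn]; simp

/-- The antisymmetric part of a planar linear map is a multiple of the area form. -/
lemma inner_clm_sub_inner_clm (L : Plane →L[ℝ] Plane) (v w : Plane) :
    inner ℝ (L v) w - inner ℝ (L w) v =
      (L (EuclideanSpace.single 0 1) 1 - L (EuclideanSpace.single 1 1) 0) *
        inner ℝ v (perp w) := by
  have hL : ∀ v : Plane, L v = v 0 • L (EuclideanSpace.single 0 1)
      + v 1 • L (EuclideanSpace.single 1 1) := by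
    intro v
    rw [← map_smul, ← map_smul, ← map_add]
    congr 1
    apply plane_ext <;> simp
  rw [hL v, hL w]
  simp [plane_inner]; ring

/-! ### Stokes' formula between two curves -/

/-- The integral of the one-form `A` along the segment from `x` to `y`. -/
def segInt (A : Plane → Plane) (x y : Plane) : ℝ :=
  ∫ r in (0 : ℝ)..1, inner ℝ (A (x + r • (y - x))) (y - x)

/-- The flux of the two-form `a` through the infinitesimal quadrilateral spanned by the segment
from `x` to `y` when its ends move with the velocities `v` and `w`; the area form is
`⟨v, perp w⟩ = v 0 * w 1 - v 1 * w 0`. -/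
def segFlux (a : Plane → ℝ) (x y v w : Plane) : ℝ :=
  ∫ r in (0 : ℝ)..1, a (x + r • (y - x)) * inner ℝ (v + r • (w - v)) (perp (y - x))

/-- The one-form `A` has curl `a` on `U`, in the sense that Stokes' formula holds on the surface
swept out by the segments that join two moving points of `U`. Only `C¹` curves are involved, so
this makes sense for fields `A` that are merely continuous. -/
def HasCurlOn (A : Plane → Plane) (a : Plane → ℝ) (U : Set Plane) : Prop :=
  ∀ (γ₁ γ₂ v₁ v₂ : ℝ → Plane) (α β : ℝ),
    (∀ t ∈ Ioo α β, HasDerivAt γ₁ (v₁ t) t) → (∀ t ∈ Ioo α β, HasDerivAt γ₂ (v₂ t) t) →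
    ContinuousOn v₁ (Ioo α β) → ContinuousOn v₂ (Ioo α β) →
    MapsTo γ₁ (Ioo α β) U → MapsTo γ₂ (Ioo α β) U →
    ∀ t ∈ Ioo α β, HasDerivAt (fun s => segInt A (γ₁ s) (γ₂ s))
      (inner ℝ (A (γ₂ t)) (v₂ t) - inner ℝ (A (γ₁ t)) (v₁ t)
        + segFlux a (γ₁ t) (γ₂ t) (v₁ t) (v₂ t)) t

lemma add_smul_sub_mem {U : Set Plane} (hU : Convex ℝ U) {x y : Plane} (hx : x ∈ U) (hy : y ∈ U)
    {r : ℝ} (hr : r ∈ Icc (0 : ℝ) 1) : x + r • (y - x) ∈ U :=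
  hU.add_smul_sub_mem hx hy hr

lemma continuous_segment (x y : Plane) : Continuous fun r : ℝ => x + r • (y - x) := by fun_prop

/-- Differentiation under the integral sign, with continuous partial derivative. -/
lemma hasDerivAt_integral_of_continuousOn_deriv {F F' : ℝ → ℝ → ℝ} {α β : ℝ}
    (hF : ∀ s ∈ Ioo α β, ∀ r ∈ Icc (0 : ℝ) 1, HasDerivAt (fun s => F s r) (F' s r) s)
    (hcF : ∀ s ∈ Ioo α β, ContinuousOn (F s) (Icc 0 1))
    (hcF' : ContinuousOn (fun p : ℝ × ℝ => F' p.1 p.2) (Ioo α β ×ˢ Icc 0 1))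
    {t : ℝ} (ht : t ∈ Ioo α β) :
    HasDerivAt (fun s => ∫ r in (0 : ℝ)..1, F s r) (∫ r in (0 : ℝ)..1, F' t r) t := by
  obtain ⟨δ, hδ, hsub⟩ := nhds_basis_closedBall.mem_iff.1 (isOpen_Ioo.mem_nhds ht)
  have hK : IsCompact (closedBall t δ ×ˢ Icc (0 : ℝ) 1) :=
    (isCompact_closedBall t δ).prod isCompact_Icc
  obtain ⟨C, hC⟩ := hK.exists_bound_of_continuousOn
    (hcF'.mono (prod_mono_left hsub))
  have hI : ∀ r ∈ uIoc (0 : ℝ) 1, r ∈ Icc (0 : ℝ) 1 := fun r hr => by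
    rw [uIoc_of_le zero_le_one] at hr; exact Ioc_subset_Icc_self hr
  have hint : ∀ s ∈ Ioo α β, IntervalIntegrable (F s) volume 0 1 := fun s hs =>
    ContinuousOn.intervalIntegrable (by rw [uIcc_of_le zero_le_one]; exact hcF s hs)
  have hc' : ContinuousOn (F' t) (Icc 0 1) :=
    hcF'.comp (by fun_prop : ContinuousOn (fun r : ℝ => (t, r)) (Icc 0 1)) fun r hr => ⟨ht, hr⟩
  refine (intervalIntegral.hasDerivAt_integral_of_dominated_loc_of_deriv_le
    (bound := fun _ => C) (closedBall_mem_nhds t hδ) ?_ (hint t ht) ?_ ?_ ?_ ?_).2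
  · filter_upwards [isOpen_Ioo.mem_nhds ht] with s hs
    exact (intervalIntegrable_iff.1 (hint s hs)).aestronglyMeasurable
  · exact (intervalIntegrable_iff.1 (ContinuousOn.intervalIntegrable
      (by rw [uIcc_of_le zero_le_one]; exact hc'))).aestronglyMeasurable
  · exact ae_of_all _ fun r hr s hs => hC (s, r) ⟨hs, hI r hr⟩
  · simp
  · exact ae_of_all _ fun r hr s hs => hF s (hsub hs) r (hI r hr)

/-- Classical fields of class `C¹` satisfy Stokes' formula. -/
lemma hasCurlOn_of_contDiffOn {A : Plane → Plane} {U : Set Plane} (hU : IsOpen U)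
    (hconv : Convex ℝ U) (hA : ContDiffOn ℝ 1 A U) : HasCurlOn A (planarCurl A) U := by
  intro γ₁ γ₂ v₁ v₂ α β h₁ h₂ hv₁ hv₂ hU₁ hU₂ t ht
  have hdA : ContinuousOn (fderiv ℝ A) U := hA.continuousOn_fderiv_of_isOpen hU le_rfl
  have hDA : ∀ x ∈ U, HasFDerivAt A (fderiv ℝ A x) x := fun x hx =>
    ((hA.differentiableOn one_ne_zero).differentiableAt (hU.mem_nhds hx)).hasFDerivAt
  have hγ₁ : ContinuousOn γ₁ (Ioo α β) := fun s hs => (h₁ s hs).continuousAt.continuousWithinAt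
  have hγ₂ : ContinuousOn γ₂ (Ioo α β) := fun s hs => (h₂ s hs).continuousAt.continuousWithinAt
  have hmem : ∀ s ∈ Ioo α β, ∀ r ∈ Icc (0 : ℝ) 1, γ₁ s + r • (γ₂ s - γ₁ s) ∈ U :=
    fun s hs r hr => add_smul_sub_mem hconv (hU₁ hs) (hU₂ hs) hr
  have hΨs : ∀ s ∈ Ioo α β, ∀ r : ℝ, HasDerivAt (fun s => γ₁ s + r • (γ₂ s - γ₁ s))
      (v₁ s + r • (v₂ s - v₁ s)) s := fun s hs r =>
    (h₁ s hs).add (((h₂ s hs).sub (h₁ s hs)).const_smul r)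
  have hmaps : MapsTo (fun p : ℝ × ℝ => γ₁ p.1 + p.2 • (γ₂ p.1 - γ₁ p.1)) (Ioo α β ×ˢ Icc 0 1) U :=
    fun p hp => hmem p.1 hp.1 p.2 hp.2
  have c1 : ContinuousOn (fun p : ℝ × ℝ => γ₁ p.1) (Ioo α β ×ˢ Icc (0 : ℝ) 1) :=
    hγ₁.comp continuousOn_fst fun p hp => hp.1
  have c2 : ContinuousOn (fun p : ℝ × ℝ => γ₂ p.1) (Ioo α β ×ˢ Icc (0 : ℝ) 1) :=
    hγ₂.comp continuousOn_fst fun p hp => hp.1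
  have c3 : ContinuousOn (fun p : ℝ × ℝ => v₁ p.1) (Ioo α β ×ˢ Icc (0 : ℝ) 1) :=
    hv₁.comp continuousOn_fst fun p hp => hp.1
  have c4 : ContinuousOn (fun p : ℝ × ℝ => v₂ p.1) (Ioo α β ×ˢ Icc (0 : ℝ) 1) :=
    hv₂.comp continuousOn_fst fun p hp => hp.1
  have cΨ : ContinuousOn (fun p : ℝ × ℝ => γ₁ p.1 + p.2 • (γ₂ p.1 - γ₁ p.1))
      (Ioo α β ×ˢ Icc (0 : ℝ) 1) :=
    c1.add (continuousOn_snd.smul (c2.sub c1))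
  have cA := hA.continuousOn.comp cΨ hmaps
  have cdA := hdA.comp cΨ hmaps
  have cF' : ContinuousOn (fun p : ℝ × ℝ =>
      (inner ℝ (A (γ₁ p.1 + p.2 • (γ₂ p.1 - γ₁ p.1))) (v₂ p.1 - v₁ p.1) : ℝ)
      + inner ℝ (fderiv ℝ A (γ₁ p.1 + p.2 • (γ₂ p.1 - γ₁ p.1))
        (v₁ p.1 + p.2 • (v₂ p.1 - v₁ p.1))) (γ₂ p.1 - γ₁ p.1)) (Ioo α β ×ˢ Icc 0 1) := by
    refine ContinuousOn.add (cA.inner (c4.sub c3)) (ContinuousOn.inner ?_ (c2.sub c1))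
    exact cdA.clm_apply (c3.add (continuousOn_snd.smul (c4.sub c3)))
  have key := hasDerivAt_integral_of_continuousOn_deriv (α := α) (β := β)
    (F := fun s r => inner ℝ (A (γ₁ s + r • (γ₂ s - γ₁ s))) (γ₂ s - γ₁ s))
    (F' := fun s r => (inner ℝ (A (γ₁ s + r • (γ₂ s - γ₁ s))) (v₂ s - v₁ s) : ℝ)
      + inner ℝ (fderiv ℝ A (γ₁ s + r • (γ₂ s - γ₁ s)) (v₁ s + r • (v₂ s - v₁ s)))
        (γ₂ s - γ₁ s)) ?_ ?_ cF' ht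
  rotate_left
  · intro s hs r hr
    exact ((hDA _ (hmem s hs r hr)).comp_hasDerivAt s (hΨs s hs r)).inner ℝ
      ((h₂ s hs).sub (h₁ s hs))
  · intro s hs
    refine ContinuousOn.inner ?_ continuousOn_const
    exact hA.continuousOn.comp (continuous_segment _ _).continuousOn fun r hr => hmem s hs r hr
  refine key.congr_deriv ?_
  -- The integrand differs from an exact `r`-derivative by the curl term.
  have hmem' := hmem t ht
  have hftc : ∫ r in (0 : ℝ)..1,
      ((inner ℝ (A (γ₁ t + r • (γ₂ t - γ₁ t))) (v₂ t - v₁ t) : ℝ)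
      + inner ℝ (fderiv ℝ A (γ₁ t + r • (γ₂ t - γ₁ t)) (γ₂ t - γ₁ t)) (v₁ t + r • (v₂ t - v₁ t)))
      = inner ℝ (A (γ₂ t)) (v₂ t) - inner ℝ (A (γ₁ t)) (v₁ t) := by
    have := intervalIntegral.integral_eq_sub_of_hasDerivAt (a := (0 : ℝ)) (b := 1)
      (f := fun r : ℝ => (inner ℝ (A (γ₁ t + r • (γ₂ t - γ₁ t))) (v₁ t + r • (v₂ t - v₁ t)) : ℝ))
      (f' := fun r : ℝ => (inner ℝ (A (γ₁ t + r • (γ₂ t - γ₁ t))) (v₂ t - v₁ t) : ℝ)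
        + inner ℝ (fderiv ℝ A (γ₁ t + r • (γ₂ t - γ₁ t)) (γ₂ t - γ₁ t))
          (v₁ t + r • (v₂ t - v₁ t))) ?_ ?_
    · rw [this]; simp
    · intro r hr
      rw [uIcc_of_le zero_le_one] at hr
      have e1 : HasDerivAt (fun r : ℝ => γ₁ t + r • (γ₂ t - γ₁ t)) (γ₂ t - γ₁ t) r := by
        simpa using ((hasDerivAt_id r).smul_const (γ₂ t - γ₁ t)).const_add (γ₁ t)
      have e2 : HasDerivAt (fun r : ℝ => v₁ t + r • (v₂ t - v₁ t)) (v₂ t - v₁ t) r := by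
        simpa using ((hasDerivAt_id r).smul_const (v₂ t - v₁ t)).const_add (v₁ t)
      exact ((hDA _ (hmem' r hr)).comp_hasDerivAt r e1).inner ℝ e2
    · refine ContinuousOn.intervalIntegrable ?_
      rw [uIcc_of_le zero_le_one]
      have hc : ContinuousOn (fun r : ℝ => γ₁ t + r • (γ₂ t - γ₁ t)) (Icc 0 1) := by fun_prop
      refine ContinuousOn.add ((hA.continuousOn.comp hc hmem').inner (by fun_prop))
        (ContinuousOn.inner ?_ (by fun_prop))
      exact (hdA.comp hc hmem').clm_apply (by fun_prop)
  have hc : ContinuousOn (fun r : ℝ => γ₁ t + r • (γ₂ t - γ₁ t)) (Icc 0 1) := by fun_prop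
  rw [← hftc, segFlux, ← intervalIntegral.integral_add]
  · refine intervalIntegral.integral_congr fun r hr => ?_
    have := inner_clm_sub_inner_clm (fderiv ℝ A (γ₁ t + r • (γ₂ t - γ₁ t)))
      (v₁ t + r • (v₂ t - v₁ t)) (γ₂ t - γ₁ t)
    simp only [planarCurl]
    linarith
  · refine ContinuousOn.intervalIntegrable ?_
    rw [uIcc_of_le zero_le_one]
    refine ContinuousOn.add ((hA.continuousOn.comp hc hmem').inner (by fun_prop))
      (ContinuousOn.inner ?_ (by fun_prop))
    exact (hdA.comp hc hmem').clm_apply (by fun_prop)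
  · refine ContinuousOn.intervalIntegrable ?_
    rw [uIcc_of_le zero_le_one]
    refine ContinuousOn.mul ?_ (by fun_prop)
    have hcurl : ContinuousOn (planarCurl A) U := by
      unfold planarCurl
      have e : ∀ (w : Plane) (i : Fin 2), ContinuousOn (fun x => fderiv ℝ A x w i) U := fun w i =>
        (EuclideanSpace.proj (𝕜 := ℝ) i).continuous.comp_continuousOn
          (hdA.clm_apply continuousOn_const)
      exact (e _ _).sub (e _ _)
    exact hcurl.comp hc hmem'

lemma intervalIntegrable_unit {f : ℝ → ℝ} (h : ContinuousOn f (Icc 0 1)) :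
    IntervalIntegrable f volume 0 1 :=
  ContinuousOn.intervalIntegrable (by rwa [uIcc_of_le zero_le_one])

lemma abs_integral_unit_le {f : ℝ → ℝ} {C : ℝ} (h : ∀ r ∈ Icc (0 : ℝ) 1, |f r| ≤ C) :
    |∫ r in (0 : ℝ)..1, f r| ≤ C := by
  have := intervalIntegral.norm_integral_le_of_norm_le_const (a := 0) (b := 1) (f := f) (C := C)
    fun r hr => h r (by rw [uIoc_of_le zero_le_one] at hr; exact Ioc_subset_Icc_self hr)
  simpa using this

section Seg

variable {A A' : Plane → Plane} {a a' : Plane → ℝ} {U : Set Plane} {x y v w : Plane}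

lemma continuousOn_segInt_integrand (hconv : Convex ℝ U) (hA : ContinuousOn A U)
    (hx : x ∈ U) (hy : y ∈ U) :
    ContinuousOn (fun r : ℝ => (inner ℝ (A (x + r • (y - x))) (y - x) : ℝ)) (Icc 0 1) :=
  (hA.comp (continuous_segment x y).continuousOn
    fun _ hr => add_smul_sub_mem hconv hx hy hr).inner continuousOn_const

lemma continuousOn_segFlux_integrand (hconv : Convex ℝ U) (ha : ContinuousOn a U)
    (hx : x ∈ U) (hy : y ∈ U) :
    ContinuousOn (fun r : ℝ => a (x + r • (y - x)) * inner ℝ (v + r • (w - v)) (perp (y - x)))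
      (Icc 0 1) :=
  (ha.comp (continuous_segment x y).continuousOn
    fun _ hr => add_smul_sub_mem hconv hx hy hr).mul (by fun_prop)

/-- On a short segment the integral of a one-form is close to its value at a point. -/
lemma abs_segInt_sub_inner_le (hconv : Convex ℝ U) (hA : ContinuousOn A U)
    (hx : x ∈ U) (hy : y ∈ U) {A₀ : Plane} {ε : ℝ}
    (h : ∀ r ∈ Icc (0 : ℝ) 1, ‖A (x + r • (y - x)) - A₀‖ ≤ ε) :
    |segInt A x y - inner ℝ A₀ (y - x)| ≤ ε * ‖y - x‖ := by
  have e : segInt A x y - inner ℝ A₀ (y - x)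
      = ∫ r in (0 : ℝ)..1, inner ℝ (A (x + r • (y - x)) - A₀) (y - x) := by
    have : (inner ℝ A₀ (y - x) : ℝ) = ∫ r in (0 : ℝ)..1, inner ℝ A₀ (y - x) := by simp
    rw [this, segInt, ← intervalIntegral.integral_sub
      (intervalIntegrable_unit (continuousOn_segInt_integrand hconv hA hx hy)) (by simp)]
    simp [inner_sub_left]
  rw [e]
  refine abs_integral_unit_le fun r hr => (abs_real_inner_le_norm _ _).trans ?_
  exact mul_le_mul_of_nonneg_right (h r hr) (norm_nonneg _)

lemma abs_segInt_sub_segInt_le (hconv : Convex ℝ U) (hA : ContinuousOn A U)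
    (hA' : ContinuousOn A' U) (hx : x ∈ U) (hy : y ∈ U) {ε : ℝ}
    (h : ∀ z ∈ U, ‖A z - A' z‖ ≤ ε) :
    |segInt A x y - segInt A' x y| ≤ ε * ‖y - x‖ := by
  rw [segInt, segInt, ← intervalIntegral.integral_sub
      (intervalIntegrable_unit (continuousOn_segInt_integrand hconv hA hx hy))
      (intervalIntegrable_unit (continuousOn_segInt_integrand hconv hA' hx hy))]
  refine abs_integral_unit_le fun r hr => ?_
  rw [← inner_sub_left]
  exact (abs_real_inner_le_norm _ _).trans
    (mul_le_mul_of_nonneg_right (h _ (add_smul_sub_mem hconv hx hy hr)) (norm_nonneg _))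

lemma norm_add_smul_sub_le {L r : ℝ} (hr : r ∈ Icc (0 : ℝ) 1) (hv : ‖v‖ ≤ L) (hw : ‖w‖ ≤ L) :
    ‖v + r • (w - v)‖ ≤ L := by
  have := add_smul_sub_mem (convex_closedBall (0 : Plane) L) (x := v) (y := w)
    (by simpa using hv) (by simpa using hw) hr
  simpa using this

lemma abs_segFlux_le (hconv : Convex ℝ U) (hx : x ∈ U) (hy : y ∈ U) {K L : ℝ}
    (ha : ∀ z ∈ U, |a z| ≤ K) (hv : ‖v‖ ≤ L) (hw : ‖w‖ ≤ L) :
    |segFlux a x y v w| ≤ K * L * ‖y - x‖ := by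
  refine abs_integral_unit_le fun r hr => ?_
  rw [abs_mul, mul_assoc]
  have hK : 0 ≤ K := (abs_nonneg _).trans (ha x hx)
  refine mul_le_mul (ha _ (add_smul_sub_mem hconv hx hy hr)) ?_ (abs_nonneg _) hK
  refine (abs_inner_perp_le _ _).trans ?_
  gcongr
  exact norm_add_smul_sub_le hr hv hw

lemma abs_segFlux_sub_segFlux_le (hconv : Convex ℝ U) (ha : ContinuousOn a U)
    (ha' : ContinuousOn a' U) (hx : x ∈ U) (hy : y ∈ U) {ε L : ℝ}
    (h : ∀ z ∈ U, |a z - a' z| ≤ ε) (hv : ‖v‖ ≤ L) (hw : ‖w‖ ≤ L) :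
    |segFlux a x y v w - segFlux a' x y v w| ≤ ε * L * ‖y - x‖ := by
  have : segFlux a x y v w - segFlux a' x y v w = segFlux (fun z => a z - a' z) x y v w := by
    rw [segFlux, segFlux, segFlux, ← intervalIntegral.integral_sub
      (intervalIntegrable_unit (continuousOn_segFlux_integrand hconv ha hx hy))
      (intervalIntegrable_unit (continuousOn_segFlux_integrand hconv ha' hx hy))]
    simp [sub_mul]
  rw [this]
  exact abs_segFlux_le hconv hx hy h hv hw

/-- The infinitesimal flux through a short segment, to first order. -/
lemma abs_segFlux_sub_le (hconv : Convex ℝ U) (ha : ContinuousOn a U)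
    (hx : x ∈ U) (hy : y ∈ U) {a₀ ε η L : ℝ} {v₀ : Plane} (hε : 0 ≤ ε) (hL : ‖v₀‖ ≤ L)
    (hK : ∀ z ∈ U, |a z| ≤ L)
    (h : ∀ r ∈ Icc (0 : ℝ) 1, |a (x + r • (y - x)) - a₀| ≤ ε)
    (hv : ‖v - v₀‖ ≤ η) (hw : ‖w - v₀‖ ≤ η) :
    |segFlux a x y v w - a₀ * inner ℝ v₀ (perp (y - x))| ≤ L * (ε + η) * ‖y - x‖ := by
  have e : segFlux a x y v w - a₀ * inner ℝ v₀ (perp (y - x))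
      = ∫ r in (0 : ℝ)..1, (a (x + r • (y - x)) * inner ℝ (v + r • (w - v)) (perp (y - x))
        - a₀ * inner ℝ v₀ (perp (y - x))) := by
    rw [intervalIntegral.integral_sub
      (intervalIntegrable_unit (continuousOn_segFlux_integrand hconv ha hx hy)) (by simp)]
    simp [segFlux]
  rw [e]
  refine abs_integral_unit_le fun r hr => ?_
  have e2 : a (x + r • (y - x)) * inner ℝ (v + r • (w - v)) (perp (y - x))
        - a₀ * inner ℝ v₀ (perp (y - x))
      = a (x + r • (y - x)) * inner ℝ (v - v₀ + r • ((w - v₀) - (v - v₀))) (perp (y - x))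
        + (a (x + r • (y - x)) - a₀) * inner ℝ v₀ (perp (y - x)) := by
    have : v - v₀ + r • ((w - v₀) - (v - v₀)) = (v + r • (w - v)) - v₀ := by
      rw [sub_sub_sub_cancel_right]; abel
    rw [this, inner_sub_left]; ring
  have hL0 : 0 ≤ L := (norm_nonneg _).trans hL
  have hχ := norm_nonneg (y - x)
  rw [e2]
  refine (abs_add_le _ _).trans ?_
  rw [abs_mul, abs_mul]
  have b1 : |a (x + r • (y - x))| *
      |inner ℝ (v - v₀ + r • ((w - v₀) - (v - v₀))) (perp (y - x))| ≤ L * (η * ‖y - x‖) := by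
    refine mul_le_mul (hK _ (add_smul_sub_mem hconv hx hy hr)) ?_ (abs_nonneg _) hL0
    exact (abs_inner_perp_le _ _).trans
      (mul_le_mul_of_nonneg_right (norm_add_smul_sub_le hr hv hw) hχ)
  have b2 : |a (x + r • (y - x)) - a₀| * |inner ℝ v₀ (perp (y - x))| ≤ ε * (L * ‖y - x‖) := by
    refine mul_le_mul (h r hr) ?_ (abs_nonneg _) hε
    exact (abs_inner_perp_le _ _).trans (mul_le_mul_of_nonneg_right hL hχ)
  nlinarith

end Seg

lemma hasCurlOn_gradient {u : Plane → ℝ} {U : Set Plane} (hU : IsOpen U) (hconv : Convex ℝ U)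
    (hu : ContDiffOn ℝ 1 u U) : HasCurlOn (gradient u) (fun _ => 0) U := by
  have hgrad : ∀ x ∈ U, HasGradientAt u (gradient u x) x := fun x hx =>
    ((hu.differentiableOn one_ne_zero).differentiableAt (hU.mem_nhds hx)).hasGradientAt
  have hcont : ContinuousOn (gradient u) U :=
    ((InnerProductSpace.toDual ℝ Plane).symm.continuous.comp_continuousOn
      (hu.continuousOn_fderiv_of_isOpen hU le_rfl))
  have hder : ∀ (γ : ℝ → Plane) (v : Plane) (t : ℝ), γ t ∈ U → HasDerivAt γ v t →
      HasDerivAt (fun s => u (γ s)) (inner ℝ (gradient u (γ t)) v) t := fun γ v t ht hγ => by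
    refine ((hgrad _ ht).hasFDerivAt.comp_hasDerivAt t hγ).congr_deriv ?_
    simp
  have hseg : ∀ x ∈ U, ∀ y ∈ U, segInt (gradient u) x y = u y - u x := by
    intro x hx y hy
    have := intervalIntegral.integral_eq_sub_of_hasDerivAt (a := (0 : ℝ)) (b := 1)
      (f := fun r : ℝ => u (x + r • (y - x)))
      (f' := fun r : ℝ => inner ℝ (gradient u (x + r • (y - x))) (y - x)) ?_ ?_
    · rw [segInt, this]; simp
    · intro r hr
      rw [uIcc_of_le zero_le_one] at hr
      refine hder _ _ _ (add_smul_sub_mem hconv hx hy hr) ?_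
      simpa using ((hasDerivAt_id r).smul_const (y - x)).const_add x
    · exact intervalIntegrable_unit (continuousOn_segInt_integrand hconv hcont hx hy)
  intro γ₁ γ₂ v₁ v₂ α β h₁ h₂ hv₁ hv₂ hU₁ hU₂ t ht
  have := (hder γ₂ _ t (hU₂ ht) (h₂ t ht)).sub (hder γ₁ _ t (hU₁ ht) (h₁ t ht))
  refine HasDerivAt.congr_of_eventuallyEq (f := fun s => u (γ₂ s) - u (γ₁ s)) ?_ ?_
  · refine this.congr_deriv ?_
    simp [segFlux]
  · filter_upwards [isOpen_Ioo.mem_nhds ht] with s hs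
    exact hseg _ (hU₁ hs) _ (hU₂ hs)

lemma HasCurlOn.add {A A' : Plane → Plane} {a a' : Plane → ℝ} {U : Set Plane}
    (hconv : Convex ℝ U) (hA : ContinuousOn A U) (hA' : ContinuousOn A' U)
    (ha : ContinuousOn a U) (ha' : ContinuousOn a' U)
    (h : HasCurlOn A a U) (h' : HasCurlOn A' a' U) :
    HasCurlOn (fun x => A x + A' x) (fun x => a x + a' x) U := by
  intro γ₁ γ₂ v₁ v₂ α β h₁ h₂ hv₁ hv₂ hU₁ hU₂ t ht
  refine HasDerivAt.congr_of_eventuallyEq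
    (f := fun s => segInt A (γ₁ s) (γ₂ s) + segInt A' (γ₁ s) (γ₂ s)) ?_ ?_
  · refine ((h γ₁ γ₂ v₁ v₂ α β h₁ h₂ hv₁ hv₂ hU₁ hU₂ t ht).add
      (h' γ₁ γ₂ v₁ v₂ α β h₁ h₂ hv₁ hv₂ hU₁ hU₂ t ht)).congr_deriv ?_
    have : segFlux (fun x => a x + a' x) (γ₁ t) (γ₂ t) (v₁ t) (v₂ t)
        = segFlux a (γ₁ t) (γ₂ t) (v₁ t) (v₂ t) + segFlux a' (γ₁ t) (γ₂ t) (v₁ t) (v₂ t) := by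
      rw [segFlux, segFlux, segFlux, ← intervalIntegral.integral_add
        (intervalIntegrable_unit (continuousOn_segFlux_integrand hconv ha (hU₁ ht) (hU₂ ht)))
        (intervalIntegrable_unit (continuousOn_segFlux_integrand hconv ha' (hU₁ ht) (hU₂ ht)))]
      simp [add_mul]
    rw [this, inner_add_left, inner_add_left]; ring
  · filter_upwards [isOpen_Ioo.mem_nhds ht] with s hs
    rw [segInt, segInt, segInt, ← intervalIntegral.integral_add
        (intervalIntegrable_unit (continuousOn_segInt_integrand hconv hA (hU₁ hs) (hU₂ hs)))
        (intervalIntegrable_unit (continuousOn_segInt_integrand hconv hA' (hU₁ hs) (hU₂ hs)))]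
    simp [inner_add_left]

/-- The property of having a given curl passes to uniform limits. -/
lemma hasCurlOn_of_tendstoUniformlyOn {A : Plane → Plane} {a : Plane → ℝ} {U : Set Plane}
    (hconv : Convex ℝ U) {An : ℕ → Plane → Plane} {an : ℕ → Plane → ℝ}
    (hAn : ∀ n, ContinuousOn (An n) U) (han : ∀ n, ContinuousOn (an n) U)
    (hlim : TendstoUniformlyOn An A atTop U) (hlim' : TendstoUniformlyOn an a atTop U)
    (h : ∀ n, HasCurlOn (An n) (an n) U) : HasCurlOn A a U := by
  have hA : ContinuousOn A U := hlim.continuousOn (Frequently.of_forall hAn)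
  have ha : ContinuousOn a U := hlim'.continuousOn (Frequently.of_forall han)
  intro γ₁ γ₂ v₁ v₂ α β h₁ h₂ hv₁ hv₂ hU₁ hU₂ t ht
  have hγ₁ : ContinuousOn γ₁ (Ioo α β) := fun s hs => (h₁ s hs).continuousAt.continuousWithinAt
  have hγ₂ : ContinuousOn γ₂ (Ioo α β) := fun s hs => (h₂ s hs).continuousAt.continuousWithinAt
  -- Near `t` the two curves and their velocities are bounded.
  obtain ⟨δ, hδ, hsub⟩ := nhds_basis_closedBall.mem_iff.1 (isOpen_Ioo.mem_nhds ht)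
  obtain ⟨L₁, hL₁⟩ := (isCompact_closedBall t δ).exists_bound_of_continuousOn (hv₁.mono hsub)
  obtain ⟨L₂, hL₂⟩ := (isCompact_closedBall t δ).exists_bound_of_continuousOn (hv₂.mono hsub)
  obtain ⟨L₃, hL₃⟩ := (isCompact_closedBall t δ).exists_bound_of_continuousOn
    ((hγ₂.sub hγ₁).mono hsub)
  obtain ⟨L, hL0, hLv₁, hLv₂, hLχ⟩ : ∃ L : ℝ, 0 < L ∧ (∀ s ∈ closedBall t δ, ‖v₁ s‖ ≤ L) ∧
      (∀ s ∈ closedBall t δ, ‖v₂ s‖ ≤ L) ∧ ∀ s ∈ closedBall t δ, ‖γ₂ s - γ₁ s‖ ≤ L := by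
    refine ⟨max (max L₁ L₂) (max L₃ 1), by positivity, fun s hs => (hL₁ s hs).trans (by simp),
      fun s hs => (hL₂ s hs).trans (by simp), fun s hs => (hL₃ s hs).trans (by simp)⟩
  refine hasDerivAt_of_tendstoUniformlyOn (l := atTop) (s := ball t δ) isOpen_ball
    (f := fun n s => segInt (An n) (γ₁ s) (γ₂ s))
    (f' := fun n s => inner ℝ (An n (γ₂ s)) (v₂ s) - inner ℝ (An n (γ₁ s)) (v₁ s)
        + segFlux (an n) (γ₁ s) (γ₂ s) (v₁ s) (v₂ s))
    (g' := fun s => inner ℝ (A (γ₂ s)) (v₂ s) - inner ℝ (A (γ₁ s)) (v₁ s)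
        + segFlux a (γ₁ s) (γ₂ s) (v₁ s) (v₂ s)) ?_ ?_ ?_ (mem_ball_self hδ)
  · rw [Metric.tendstoUniformlyOn_iff]
    intro ε hε
    obtain ⟨η, hη, hηε⟩ : ∃ η : ℝ, 0 < η ∧ η * L + η * L + η * L * L < ε := by
      refine ⟨ε / (2 * (2 * L + L * L)), by positivity, ?_⟩
      have : ε / (2 * (2 * L + L * L)) * L + ε / (2 * (2 * L + L * L)) * L
        + ε / (2 * (2 * L + L * L)) * L * L = ε / 2 := by field_simp; ring
      linarith
    filter_upwards [Metric.tendstoUniformlyOn_iff.1 hlim η hη,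
      Metric.tendstoUniformlyOn_iff.1 hlim' η hη] with n hn hn' s hs
    have hs' := ball_subset_closedBall hs
    have hs'' := hsub hs'
    rw [dist_eq_norm, Real.norm_eq_abs]
    have e : (inner ℝ (A (γ₂ s)) (v₂ s) - inner ℝ (A (γ₁ s)) (v₁ s)
        + segFlux a (γ₁ s) (γ₂ s) (v₁ s) (v₂ s))
        - (inner ℝ (An n (γ₂ s)) (v₂ s) - inner ℝ (An n (γ₁ s)) (v₁ s)
        + segFlux (an n) (γ₁ s) (γ₂ s) (v₁ s) (v₂ s))
        = inner ℝ (A (γ₂ s) - An n (γ₂ s)) (v₂ s) - inner ℝ (A (γ₁ s) - An n (γ₁ s)) (v₁ s)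
          + (segFlux a (γ₁ s) (γ₂ s) (v₁ s) (v₂ s)
            - segFlux (an n) (γ₁ s) (γ₂ s) (v₁ s) (v₂ s)) := by
      rw [inner_sub_left, inner_sub_left]; ring
    have b : ∀ x ∈ U, ∀ v : Plane, ‖v‖ ≤ L → |inner ℝ (A x - An n x) v| ≤ η * L := by
      intro x hx v hv
      refine (abs_real_inner_le_norm _ _).trans
        (mul_le_mul ?_ hv (norm_nonneg _) hη.le)
      rw [← dist_eq_norm]; exact (hn x hx).le
    have b3 := abs_segFlux_sub_segFlux_le hconv ha (han n) (hU₁ hs'') (hU₂ hs'') (ε := η)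
      (fun z hz => by rw [← Real.dist_eq]; exact (hn' z hz).le) (hLv₁ s hs') (hLv₂ s hs')
    have b4 : η * L * ‖γ₂ s - γ₁ s‖ ≤ η * L * L := by
      gcongr; exact hLχ s hs'
    rw [e]
    refine ((abs_add_le _ _).trans (add_le_add ((abs_sub _ _).trans (add_le_add
      (b _ (hU₂ hs'') _ (hLv₂ s hs')) (b _ (hU₁ hs'') _ (hLv₁ s hs')))) (b3.trans b4))).trans_lt ?_
    exact hηε
  · filter_upwards with n s hs
    exact h n γ₁ γ₂ v₁ v₂ α β h₁ h₂ hv₁ hv₂ hU₁ hU₂ s (hsub (ball_subset_closedBall hs))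
  · intro s hs
    have hs' := ball_subset_closedBall hs
    rw [Metric.tendsto_nhds]
    intro ε hε
    filter_upwards [Metric.tendstoUniformlyOn_iff.1 hlim (ε / (2 * L)) (by positivity)] with n hn
    have := abs_segInt_sub_segInt_le hconv (hAn n) hA (hU₁ (hsub hs')) (hU₂ (hsub hs'))
      (ε := ε / (2 * L)) (fun z hz => by rw [← dist_eq_norm, dist_comm]; exact (hn z hz).le)
    rw [Real.dist_eq]
    refine this.trans_lt ?_
    calc _ ≤ ε / (2 * L) * L := by gcongr; exact hLχ s hs'
      _ = ε / 2 := by field_simp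
      _ < ε := by linarith

end

/-! ### Frames of one-forms with continuous curls -/

section

/-- On the convex set `U`, the one-forms `A` and `B` have the curls `a` and `b`, all bounded by `K`,
and two points of `U` are separated, with constant `m`, by the integrals of `A` and `B` along the
segment that joins them. -/
structure IsCurlFrame (U : Set Plane) (A B : Plane → Plane) (a b : Plane → ℝ) (m K : ℝ) :
    Prop where
  convex : Convex ℝ U
  curlA : HasCurlOn A a U
  curlB : HasCurlOn B b U
  m_pos : 0 < m
  K_pos : 0 < K
  boundA : ∀ x ∈ U, ‖A x‖ ≤ K
  boundB : ∀ x ∈ U, ‖B x‖ ≤ K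
  bounda : ∀ x ∈ U, |a x| ≤ K
  boundb : ∀ x ∈ U, |b x| ≤ K
  coercive : ∀ x ∈ U, ∀ y ∈ U, m * ‖y - x‖ ≤ |segInt A x y| + |segInt B x y|

lemma abs_segInt_le {A : Plane → Plane} {U : Set Plane} (hconv : Convex ℝ U)
    {x y : Plane} (hx : x ∈ U) (hy : y ∈ U) {K : ℝ} (hK : ∀ z ∈ U, ‖A z‖ ≤ K) :
    |segInt A x y| ≤ K * ‖y - x‖ :=
  abs_integral_unit_le fun _ hr => (abs_real_inner_le_norm _ _).trans
    (mul_le_mul_of_nonneg_right (hK _ (add_smul_sub_mem hconv hx hy hr)) (norm_nonneg _))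

namespace IsCurlFrame

variable {U : Set Plane} {A B : Plane → Plane} {a b : Plane → ℝ} {m K : ℝ}

lemma segInt_bound (hF : IsCurlFrame U A B a b m K) {x y : Plane} (hx : x ∈ U) (hy : y ∈ U) :
    ‖(segInt A x y, segInt B x y)‖ ≤ K * ‖y - x‖ :=
  norm_prod_le_iff.2 ⟨abs_segInt_le hF.convex hx hy hF.boundA,
    abs_segInt_le hF.convex hx hy hF.boundB⟩

lemma norm_sub_le (hF : IsCurlFrame U A B a b m K) {x y : Plane} (hx : x ∈ U) (hy : y ∈ U) :
    ‖y - x‖ ≤ 2 / m * ‖(segInt A x y, segInt B x y)‖ := by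
  have h := hF.coercive x hx y hy
  have h1 := norm_fst_le (segInt A x y, segInt B x y)
  have h2 := norm_snd_le (segInt A x y, segInt B x y)
  simp only [Real.norm_eq_abs] at h1 h2
  rw [div_mul_eq_mul_div, le_div_iff₀ hF.m_pos]
  linarith

/-- Forward stability of curves on which both one-forms of a frame take nearly equal values on the
velocities: this follows from Stokes' formula and Grönwall's inequality, and needs no regularity
of the frame beyond its curls. -/
lemma stability_forward (hF : IsCurlFrame U A B a b m K) {L : ℝ} (hL : 0 < L) (T : ℝ) :
    ∃ C, 0 < C ∧ ∀ (γ₁ γ₂ v₁ v₂ : ℝ → Plane) (S ε : ℝ), S ≤ T →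
      (∀ t ∈ Ioo (-S) S, HasDerivAt γ₁ (v₁ t) t) → (∀ t ∈ Ioo (-S) S, HasDerivAt γ₂ (v₂ t) t) →
      ContinuousOn v₁ (Ioo (-S) S) → ContinuousOn v₂ (Ioo (-S) S) →
      MapsTo γ₁ (Ioo (-S) S) U → MapsTo γ₂ (Ioo (-S) S) U →
      (∀ t ∈ Ioo (-S) S, ‖v₁ t‖ ≤ L) → (∀ t ∈ Ioo (-S) S, ‖v₂ t‖ ≤ L) →
      (∀ t ∈ Ioo (-S) S, |(inner ℝ (A (γ₂ t)) (v₂ t) : ℝ) - inner ℝ (A (γ₁ t)) (v₁ t)| ≤ ε) →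
      (∀ t ∈ Ioo (-S) S, |(inner ℝ (B (γ₂ t)) (v₂ t) : ℝ) - inner ℝ (B (γ₁ t)) (v₁ t)| ≤ ε) →
      ∀ t ∈ Ico 0 S, ‖γ₂ t - γ₁ t‖ ≤ C * (‖γ₂ 0 - γ₁ 0‖ + ε) := by
  have hm := hF.m_pos
  have hK := hF.K_pos
  set κ := K * L * (2 / m) with hκ
  have hκ0 : 0 < κ := by positivity
  refine ⟨2 / m * (Real.exp (κ * T) * (K + 1 / κ)), by positivity, ?_⟩
  intro γ₁ γ₂ v₁ v₂ S ε hST h₁ h₂ hv₁ hv₂ hU₁ hU₂ hL₁ hL₂ hA hB t ht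
  have hS : 0 < S := ht.1.trans_lt ht.2
  have hsub : ∀ s ∈ Icc 0 t, s ∈ Ioo (-S) S := fun s hs =>
    ⟨by linarith [hs.1], hs.2.trans_lt ht.2⟩
  have hε : 0 ≤ ε := (abs_nonneg _).trans (hA 0 (hsub 0 ⟨le_rfl, ht.1⟩))
  have hder : ∀ s ∈ Ioo (-S) S, HasDerivAt
      (fun s => (segInt A (γ₁ s) (γ₂ s), segInt B (γ₁ s) (γ₂ s)))
      (inner ℝ (A (γ₂ s)) (v₂ s) - inner ℝ (A (γ₁ s)) (v₁ s)
        + segFlux a (γ₁ s) (γ₂ s) (v₁ s) (v₂ s),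
       inner ℝ (B (γ₂ s)) (v₂ s) - inner ℝ (B (γ₁ s)) (v₁ s)
        + segFlux b (γ₁ s) (γ₂ s) (v₁ s) (v₂ s)) s := fun s hs =>
    (hF.curlA γ₁ γ₂ v₁ v₂ _ _ h₁ h₂ hv₁ hv₂ hU₁ hU₂ s hs).prodMk
      (hF.curlB γ₁ γ₂ v₁ v₂ _ _ h₁ h₂ hv₁ hv₂ hU₁ hU₂ s hs)
  have hbound := norm_le_gronwallBound_of_norm_deriv_right_le (a := 0) (b := t)
    (f := fun s => (segInt A (γ₁ s) (γ₂ s), segInt B (γ₁ s) (γ₂ s))) (K := κ) (ε := ε)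
    (δ := K * ‖γ₂ 0 - γ₁ 0‖)
    (fun s hs => (hder s (hsub s hs)).continuousAt.continuousWithinAt)
    (fun s hs => (hder s (hsub s (Ico_subset_Icc_self hs))).hasDerivWithinAt)
    (hF.segInt_bound (hU₁ (hsub 0 ⟨le_rfl, ht.1⟩)) (hU₂ (hsub 0 ⟨le_rfl, ht.1⟩))) ?_
    t ⟨ht.1, le_rfl⟩
  · rw [sub_zero, gronwallBound_of_K_ne_0 hκ0.ne'] at hbound
    have ht' := hsub t ⟨ht.1, le_rfl⟩
    have hexp : Real.exp (κ * t) ≤ Real.exp (κ * T) := by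
      gcongr; exact ht.2.le.trans hST
    calc ‖γ₂ t - γ₁ t‖ ≤ _ := hF.norm_sub_le (hU₁ ht') (hU₂ ht')
      _ ≤ 2 / m * (K * ‖γ₂ 0 - γ₁ 0‖ * Real.exp (κ * t) + ε / κ * (Real.exp (κ * t) - 1)) := by
        gcongr
      _ ≤ 2 / m * (K * ‖γ₂ 0 - γ₁ 0‖ * Real.exp (κ * T) + ε / κ * Real.exp (κ * T)) := by
        gcongr
        linarith
      _ ≤ 2 / m * (Real.exp (κ * T) * (K + 1 / κ)) * (‖γ₂ 0 - γ₁ 0‖ + ε) := by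
        have : 2 / m * (Real.exp (κ * T) * (K + 1 / κ)) * (‖γ₂ 0 - γ₁ 0‖ + ε)
          - 2 / m * (K * ‖γ₂ 0 - γ₁ 0‖ * Real.exp (κ * T) + ε / κ * Real.exp (κ * T))
          = 2 / m * Real.exp (κ * T) * (K * ε + 1 / κ * ‖γ₂ 0 - γ₁ 0‖) := by ring
        have h0 : 0 ≤ 2 / m * Real.exp (κ * T) * (K * ε + 1 / κ * ‖γ₂ 0 - γ₁ 0‖) := by positivity
        linarith
  · intro s hs
    have hs' := hsub s (Ico_subset_Icc_self hs)
    have e : κ * ‖(segInt A (γ₁ s) (γ₂ s), segInt B (γ₁ s) (γ₂ s))‖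
        = K * L * (2 / m * ‖(segInt A (γ₁ s) (γ₂ s), segInt B (γ₁ s) (γ₂ s))‖) := by
      rw [hκ]; ring
    have hχ := hF.norm_sub_le (hU₁ hs') (hU₂ hs')
    have hflux : ∀ f : Plane → ℝ, (∀ x ∈ U, |f x| ≤ K) →
        |segFlux f (γ₁ s) (γ₂ s) (v₁ s) (v₂ s)| ≤
          κ * ‖(segInt A (γ₁ s) (γ₂ s), segInt B (γ₁ s) (γ₂ s))‖ := fun f hf => by
      rw [e]
      exact (abs_segFlux_le hF.convex (hU₁ hs') (hU₂ hs') hf (hL₁ s hs') (hL₂ s hs')).trans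
        (mul_le_mul_of_nonneg_left hχ (by positivity))
    refine norm_prod_le_iff.2 ⟨?_, ?_⟩
    · refine (abs_add_le _ _).trans ?_
      linarith [hA s hs', hflux a hF.bounda]
    · refine (abs_add_le _ _).trans ?_
      linarith [hB s hs', hflux b hF.boundb]

lemma stability (hF : IsCurlFrame U A B a b m K) {L : ℝ} (hL : 0 < L) (T : ℝ) :
    ∃ C, 0 < C ∧ ∀ (γ₁ γ₂ v₁ v₂ : ℝ → Plane) (S ε : ℝ), S ≤ T →
      (∀ t ∈ Ioo (-S) S, HasDerivAt γ₁ (v₁ t) t) → (∀ t ∈ Ioo (-S) S, HasDerivAt γ₂ (v₂ t) t) →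
      ContinuousOn v₁ (Ioo (-S) S) → ContinuousOn v₂ (Ioo (-S) S) →
      MapsTo γ₁ (Ioo (-S) S) U → MapsTo γ₂ (Ioo (-S) S) U →
      (∀ t ∈ Ioo (-S) S, ‖v₁ t‖ ≤ L) → (∀ t ∈ Ioo (-S) S, ‖v₂ t‖ ≤ L) →
      (∀ t ∈ Ioo (-S) S, |(inner ℝ (A (γ₂ t)) (v₂ t) : ℝ) - inner ℝ (A (γ₁ t)) (v₁ t)| ≤ ε) →
      (∀ t ∈ Ioo (-S) S, |(inner ℝ (B (γ₂ t)) (v₂ t) : ℝ) - inner ℝ (B (γ₁ t)) (v₁ t)| ≤ ε) →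
      ∀ t ∈ Ioo (-S) S, ‖γ₂ t - γ₁ t‖ ≤ C * (‖γ₂ 0 - γ₁ 0‖ + ε) := by
  obtain ⟨C, hC, h⟩ := hF.stability_forward hL T
  refine ⟨C, hC, ?_⟩
  intro γ₁ γ₂ v₁ v₂ S ε hST h₁ h₂ hv₁ hv₂ hU₁ hU₂ hL₁ hL₂ hA hB t ht
  rcases le_or_gt 0 t with h0 | h0
  · exact h γ₁ γ₂ v₁ v₂ S ε hST h₁ h₂ hv₁ hv₂ hU₁ hU₂ hL₁ hL₂ hA hB t ⟨h0, ht.2⟩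
  · have hneg : MapsTo (fun s : ℝ => -s) (Ioo (-S) S) (Ioo (-S) S) := fun s hs =>
      ⟨by linarith [hs.2], by linarith [hs.1]⟩
    have hd : ∀ (γ v : ℝ → Plane), (∀ t ∈ Ioo (-S) S, HasDerivAt γ (v t) t) →
        ∀ t ∈ Ioo (-S) S, HasDerivAt (fun s => γ (-s)) (-v (-t)) t := fun γ v hγ t ht => by
      exact ((hγ (-t) (hneg ht)).scomp t (hasDerivAt_neg t)).congr_deriv (by simp)
    have := h (fun s => γ₁ (-s)) (fun s => γ₂ (-s)) (fun s => -v₁ (-s)) (fun s => -v₂ (-s)) S ε hST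
      (hd _ _ h₁) (hd _ _ h₂) (hv₁.comp continuousOn_neg hneg).neg
      (hv₂.comp continuousOn_neg hneg).neg (hU₁.comp hneg) (hU₂.comp hneg)
      (fun t ht => by simpa using hL₁ _ (hneg ht)) (fun t ht => by simpa using hL₂ _ (hneg ht))
      (fun t ht => by
        have := hA _ (hneg ht)
        rw [abs_sub_comm] at this
        simpa [inner_neg_right, neg_add_eq_sub] using this)
      (fun t ht => by
        have := hB _ (hneg ht)
        rw [abs_sub_comm] at this
        simpa [inner_neg_right, neg_add_eq_sub] using this) (-t) ⟨by linarith, by linarith [ht.1]⟩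
    simpa using this

end IsCurlFrame

/-- The Picard–Lindelöf theorem, with the information that the solution stays in the ball on which
the field is controlled. -/
lemma IsPicardLindelof.exists_hasDerivWithinAt_mem_closedBall {E : Type*} [NormedAddCommGroup E]
    [NormedSpace ℝ E] [CompleteSpace E] {f : ℝ → E → E} {tmin tmax : ℝ} {t₀ : Icc tmin tmax}
    {x₀ x : E} {a r L K : NNReal} (hf : IsPicardLindelof f t₀ x₀ a r L K)
    (hx : x ∈ closedBall x₀ r) :
    ∃ α : ℝ → E, α t₀ = x ∧
      (∀ t ∈ Icc tmin tmax, HasDerivWithinAt α (f t (α t)) (Icc tmin tmax) t) ∧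
      ∀ t, α t ∈ closedBall x₀ a := by
  obtain ⟨α, hα⟩ := ODE.FunSpace.exists_isFixedPt_next hf hx
  refine ⟨α.compProj, by rw [ODE.FunSpace.compProj_val, ← hα, ODE.FunSpace.next_apply₀],
    fun t ht ↦ ?_, fun t => α.compProj_mem_closedBall hf.mul_max_le⟩
  apply ODE.hasDerivWithinAt_picard_Icc t₀.2 hf.continuousOn_uncurry
    α.continuous_compProj.continuousOn (fun _ ht' ↦ α.compProj_mem_closedBall hf.mul_max_le)
    x ht |>.congr_of_mem _ ht
  intro t' ht'
  nth_rw 1 [← hα]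
  rw [ODE.FunSpace.compProj_of_mem ht', ODE.FunSpace.next_apply]

/-- Picard–Lindelöf for an autonomous field, on a symmetric time interval. -/
lemma exists_integralCurve_mem_closedBall {E : Type*} [NormedAddCommGroup E] [NormedSpace ℝ E]
    [CompleteSpace E] {X : E → E} {x : E} {R L T : ℝ} (hT : 0 ≤ T) (hL : 0 ≤ L)
    (hLT : L * T ≤ R) (hX : ∀ y ∈ closedBall x R, ‖X y‖ ≤ L) {K : NNReal}
    (hK : LipschitzOnWith K X (closedBall x R)) :
    ∃ γ : ℝ → E, γ 0 = x ∧ (∀ t ∈ Ioo (-T) T, HasDerivAt γ (X (γ t)) t) ∧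
      ∀ t, γ t ∈ closedBall x R := by
  lift R to NNReal using (mul_nonneg hL hT).trans hLT
  lift L to NNReal using hL
  have h0 : (0 : ℝ) ∈ Icc (-T) T := ⟨by linarith, hT⟩
  have hpl : IsPicardLindelof (fun _ => X) (tmin := -T) (tmax := T) ⟨0, h0⟩ x R 0 L K :=
    IsPicardLindelof.of_time_independent hX hK (by simpa using hLT)
  obtain ⟨γ, hγ0, hγ, hmem⟩ :=
    hpl.exists_hasDerivWithinAt_mem_closedBall (mem_closedBall_self le_rfl)
  exact ⟨γ, hγ0, fun t ht => (hγ t (Ioo_subset_Icc_self ht)).hasDerivAt (Icc_mem_nhds ht.1 ht.2),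
    hmem⟩

namespace IsCurlFrame

variable {A B : Plane → Plane} {a b : Plane → ℝ} {m K : ℝ}

/-- Integral curves of a field dual to a frame exist: those of smooth approximations of the field
form a Cauchy sequence, by stability. -/
lemma exists_integralCurve {q : Plane} {R : ℝ} (hR : 0 < R)
    (hF : IsCurlFrame (ball q R) A B a b m K)
    {X : Plane → Plane} {α β L : ℝ} (hL : 0 < L)
    (hXA : ∀ x ∈ ball q R, inner ℝ (A x) (X x) = α) (hXB : ∀ x ∈ ball q R, inner ℝ (B x) (X x) = β)
    {Xn : ℕ → Plane → Plane} (hXn : ∀ n, ContDiff ℝ 1 (Xn n))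
    (hXnL : ∀ n, ∀ x ∈ ball q R, ‖Xn n x‖ ≤ L) (hlim : TendstoUniformlyOn Xn X atTop (ball q R))
    {x : Plane} (hx : x ∈ ball q (R / 2)) :
    ∃ γ : ℝ → Plane, γ 0 = x ∧
      ∀ t ∈ Ioo (-(R / (4 * L))) (R / (4 * L)), γ t ∈ ball q R ∧ HasDerivAt γ (X (γ t)) t := by
  set T := R / (4 * L) with hT
  have hT0 : 0 < T := by positivity
  have hsub : closedBall x (R / 4) ⊆ ball q R := by
    refine (closedBall_subset_ball (by linarith : R / 4 < R / 2)).trans (ball_subset_ball' ?_)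
    rw [mem_ball] at hx; linarith
  have hcurves : ∀ n, ∃ γ : ℝ → Plane, γ 0 = x ∧
      (∀ t ∈ Ioo (-T) T, HasDerivAt γ (Xn n (γ t)) t) ∧ ∀ t, γ t ∈ closedBall x (R / 4) := by
    intro n
    obtain ⟨κ, hκ⟩ := LocallyLipschitzOn.exists_lipschitzOnWith_of_compact
      (isCompact_closedBall x (R / 4)) ((hXn n).locallyLipschitz.locallyLipschitzOn)
    refine exists_integralCurve_mem_closedBall hT0.le hL.le ?_
      (fun y hy => hXnL n y (hsub hy)) hκ
    rw [hT]; field_simp; rfl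
  choose γ hγ0 hγ hγmem using hcurves
  have hγU : ∀ n t, γ n t ∈ ball q R := fun n t => hsub (hγmem n t)
  have hγc : ∀ n, ContinuousOn (γ n) (Ioo (-T) T) := fun n t ht =>
    (hγ n t ht).continuousAt.continuousWithinAt
  obtain ⟨C, hC, hstab⟩ := hF.stability hL T
  have hK := hF.K_pos
  have hunif : ∀ ε > 0, ∃ N, ∀ n ≥ N, ∀ y ∈ ball q R, ‖Xn n y - X y‖ ≤ ε := by
    intro ε hε
    obtain ⟨N, hN⟩ := eventually_atTop.1 (Metric.tendstoUniformlyOn_iff.1 hlim ε hε)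
    exact ⟨N, fun n hn y hy => by rw [← dist_eq_norm, dist_comm]; exact (hN n hn y hy).le⟩
  have hcauchy : ∀ ε > 0, ∃ N, ∀ n ≥ N, ∀ k ≥ N, ∀ t ∈ Ioo (-T) T, ‖γ k t - γ n t‖ < ε := by
    intro ε hε
    obtain ⟨N, hN⟩ := hunif (ε / (4 * C * K)) (by positivity)
    refine ⟨N, fun n hn k hk t ht => ?_⟩
    have hin : ∀ (P : Plane → Plane) (ξ : ℝ), (∀ x ∈ ball q R, ‖P x‖ ≤ K) →
        (∀ x ∈ ball q R, inner ℝ (P x) (X x) = ξ) → ∀ t ∈ Ioo (-T) T,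
        |(inner ℝ (P (γ k t)) (Xn k (γ k t)) : ℝ) - inner ℝ (P (γ n t)) (Xn n (γ n t))|
          ≤ ε / (2 * C) := by
      intro P ξ hP hPξ t _
      have e : (inner ℝ (P (γ k t)) (Xn k (γ k t)) : ℝ) - inner ℝ (P (γ n t)) (Xn n (γ n t))
          = inner ℝ (P (γ k t)) (Xn k (γ k t) - X (γ k t))
            - inner ℝ (P (γ n t)) (Xn n (γ n t) - X (γ n t)) := by
        rw [inner_sub_right, inner_sub_right, hPξ _ (hγU k t), hPξ _ (hγU n t)]; ring
      have hb : ∀ j ≥ N, |inner ℝ (P (γ j t)) (Xn j (γ j t) - X (γ j t))|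
          ≤ K * (ε / (4 * C * K)) := fun j hj =>
        (abs_real_inner_le_norm _ _).trans
          (mul_le_mul (hP _ (hγU j t)) (hN j hj _ (hγU j t)) (norm_nonneg _) hK.le)
      rw [e]
      refine (abs_sub _ _).trans ((add_le_add (hb k hk) (hb n hn)).trans (le_of_eq ?_))
      field_simp; ring
    have := hstab (γ n) (γ k) (fun t => Xn n (γ n t)) (fun t => Xn k (γ k t)) T (ε / (2 * C))
      le_rfl (hγ n) (hγ k) ((hXn n).continuous.comp_continuousOn (hγc n))
      ((hXn k).continuous.comp_continuousOn (hγc k)) (fun t _ => hγU n t) (fun t _ => hγU k t)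
      (fun t _ => hXnL n _ (hγU n t)) (fun t _ => hXnL k _ (hγU k t))
      (hin A α hF.boundA hXA) (hin B β hF.boundB hXB) t ht
    rw [hγ0, hγ0, sub_self, norm_zero, zero_add] at this
    refine this.trans_lt ?_
    have : C * (ε / (2 * C)) = ε / 2 := by field_simp
    linarith
  have hpc : ∀ t ∈ Ioo (-T) T, ∃ y, Tendsto (fun n => γ n t) atTop (𝓝 y) := fun t ht => by
    refine cauchySeq_tendsto_of_complete (Metric.cauchySeq_iff.2 fun ε hε => ?_)
    obtain ⟨N, hN⟩ := hcauchy ε hε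
    exact ⟨N, fun k hk n hn => by rw [dist_eq_norm]; exact hN n hn k hk t ht⟩
  choose! γ' hγ' using hpc
  have hγ'mem : ∀ t ∈ Ioo (-T) T, γ' t ∈ closedBall x (R / 4) := fun t ht =>
    isClosed_closedBall.mem_of_tendsto (hγ' t ht) (Eventually.of_forall fun n => hγmem n t)
  have hγ'u : TendstoUniformlyOn γ γ' atTop (Ioo (-T) T) := by
    rw [Metric.tendstoUniformlyOn_iff]
    intro ε hε
    obtain ⟨N, hN⟩ := hcauchy (ε / 2) (by positivity)
    filter_upwards [eventually_ge_atTop N] with n hn t ht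
    have h1 : Tendsto (fun k => ‖γ k t - γ n t‖) atTop (𝓝 ‖γ' t - γ n t‖) :=
      ((hγ' t ht).sub_const _).norm
    have := le_of_tendsto h1 (eventually_atTop.2 ⟨N, fun k hk => (hN n hn k hk t ht).le⟩)
    rw [dist_eq_norm]; linarith
  have hXc : ContinuousOn X (ball q R) :=
    hlim.continuousOn (Frequently.of_forall fun n => (hXn n).continuous.continuousOn)
  have hXu : UniformContinuousOn X (closedBall x (R / 4)) :=
    (isCompact_closedBall x (R / 4)).uniformContinuousOn_of_continuous (hXc.mono hsub)
  refine ⟨γ', ?_, fun t ht => ⟨hsub (hγ'mem t ht), ?_⟩⟩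
  · have h0 := hγ' 0 ⟨by linarith, hT0⟩
    simp only [hγ0] at h0
    exact tendsto_nhds_unique h0 tendsto_const_nhds
  · refine hasDerivAt_of_tendstoUniformlyOn (l := atTop) (s := Ioo (-T) T) isOpen_Ioo
      (f := γ) (f' := fun n t => Xn n (γ n t)) (g' := fun t => X (γ' t)) ?_
      (Eventually.of_forall fun n t ht => hγ n t ht) hγ' ht
    rw [Metric.tendstoUniformlyOn_iff]
    intro ε hε
    obtain ⟨δ, hδ, hδ'⟩ := Metric.uniformContinuousOn_iff.1 hXu (ε / 2) (by positivity)
    obtain ⟨N, hN⟩ := hunif (ε / 4) (by positivity)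
    filter_upwards [Metric.tendstoUniformlyOn_iff.1 hγ'u δ hδ, eventually_ge_atTop N]
      with n hn hnN t ht
    have h1 := hδ' _ (hγ'mem t ht) _ (hγmem n t) (hn t ht)
    have h2 := hN n hnN _ (hγU n t)
    rw [← dist_eq_norm, dist_comm] at h2
    linarith [dist_triangle (X (γ' t)) (X (γ n t)) (Xn n (γ n t))]

end IsCurlFrame

end

/-! ### The frame is differentiable along characteristic curves -/

section

lemma le_add_mul_of_hasDerivAt_le {f f' G g : ℝ → ℝ} {s₁ s₂ C : ℝ} (h12 : s₁ ≤ s₂)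
    (hf : ∀ s ∈ Icc s₁ s₂, HasDerivAt f (f' s) s) (hG : ∀ s ∈ Icc s₁ s₂, HasDerivAt G (g s) s)
    (hle : ∀ s ∈ Icc s₁ s₂, f' s ≤ g s + C) : f s₂ - f s₁ ≤ G s₂ - G s₁ + C * (s₂ - s₁) := by
  have hφ : ∀ s ∈ Icc s₁ s₂, HasDerivAt (fun s => f s - G s - C * s) (f' s - g s - C) s :=
    fun s hs =>
      (((hf s hs).sub (hG s hs)).sub ((hasDerivAt_id s).const_mul C)).congr_deriv (by ring)
  have hanti : AntitoneOn (fun s => f s - G s - C * s) (Icc s₁ s₂) := by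
    refine antitoneOn_of_deriv_nonpos (convex_Icc _ _)
      (fun s hs => (hφ s hs).continuousAt.continuousWithinAt)
      (fun s hs => (hφ s (interior_subset hs)).differentiableAt.differentiableWithinAt)
      fun s hs => ?_
    rw [(hφ s (interior_subset hs)).deriv]
    linarith [hle s (interior_subset hs)]
  have := hanti (left_mem_Icc.2 h12) (right_mem_Icc.2 h12) h12
  simp only at this
  linarith

lemma exists_primitive_Ioo {E : Type*} [NormedAddCommGroup E] [NormedSpace ℝ E] [CompleteSpace E]
    {g : ℝ → E} {α β : ℝ} (hg : ContinuousOn g (Ioo α β)) {t₀ : ℝ} (ht₀ : t₀ ∈ Ioo α β) :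
    ∃ G : ℝ → E, G t₀ = 0 ∧ ∀ t ∈ Ioo α β, HasDerivAt G (g t) t := by
  refine ⟨fun t => ∫ s in t₀..t, g s, by simp, fun t ht => ?_⟩
  refine intervalIntegral.integral_hasDerivAt_right ?_ ?_ (hg.continuousAt (isOpen_Ioo.mem_nhds ht))
  · exact (hg.mono (ordConnected_Ioo.uIcc_subset ht₀ ht)).intervalIntegrable
  · exact hg.stronglyMeasurableAtFilter isOpen_Ioo t ht

lemma hasDerivAt_plane {f : ℝ → Plane} {f' : Plane} {t : ℝ}
    (h : ∀ i, HasDerivAt (fun s => f s i) (f' i) t) : HasDerivAt f f' t := by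
  have e : ∀ v : Plane, v 0 • EuclideanSpace.single 0 (1 : ℝ)
      + v 1 • EuclideanSpace.single 1 (1 : ℝ) = v := fun v => by apply plane_ext <;> simp
  have := ((h 0).smul_const (EuclideanSpace.single (0 : Fin 2) (1 : ℝ))).add
    ((h 1).smul_const (EuclideanSpace.single (1 : Fin 2) (1 : ℝ)))
  rw [e] at this
  exact this.congr_of_eventuallyEq (Eventually.of_forall fun s => (e (f s)).symm)

lemma inner_single_right (v : Plane) (i : Fin 2) :
    inner ℝ v (EuclideanSpace.single i (1 : ℝ)) = v i := by
  rw [plane_inner]; fin_cases i <;> simp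

/-- One half of the differentiability of a unit field `B` along its own integral curves: since
`⟨B (Γ + σ e), B Γ⟩ ≤ 1` with equality at `σ = 0`, the first variation of the circulation of `B`
along translates of `Γ` has a sign. -/
lemma inner_sub_inner_le_of_unit {q : Plane} {R : ℝ} {B : Plane → Plane} {b : Plane → ℝ}
    (hB : HasCurlOn B b (ball q R)) (hBc : ContinuousOn B (closedBall q R))
    (hbc : ContinuousOn b (closedBall q R)) (hunit : ∀ x ∈ ball q R, ‖B x‖ = 1)
    {Γ : ℝ → Plane} {l : ℝ → ℝ} {α β : ℝ} (hΓ : ∀ s ∈ Ioo α β, HasDerivAt Γ (l s • B (Γ s)) s)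
    (hl : ContinuousOn l (Ioo α β)) (hl0 : ∀ s ∈ Ioo α β, 0 ≤ l s)
    (hΓU : MapsTo Γ (Ioo α β) (ball q (R / 2))) {e : Plane} {G : ℝ → ℝ}
    (hG : ∀ s ∈ Ioo α β, HasDerivAt G (b (Γ s) * inner ℝ (l s • B (Γ s)) (perp e)) s)
    {s₁ s₂ : ℝ} (hs₁ : s₁ ∈ Ioo α β) (hs₂ : s₂ ∈ Ioo α β) (h12 : s₁ ≤ s₂) :
    inner ℝ (B (Γ s₂)) e - inner ℝ (B (Γ s₁)) e ≤ G s₂ - G s₁ := by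
  have hIcc : Icc s₁ s₂ ⊆ Ioo α β := ordConnected_Ioo.out hs₁ hs₂
  have hR : 0 < R := by
    have := dist_nonneg.trans_lt (mem_ball.1 (hΓU hs₁)); linarith
  have hsub : ball q (R / 2) ⊆ ball q R := ball_subset_ball (by linarith)
  have hΓc : ContinuousOn Γ (Ioo α β) := fun s hs => (hΓ s hs).continuousAt.continuousWithinAt
  have hBc' := hBc.mono ball_subset_closedBall
  have hbc' := hbc.mono ball_subset_closedBall
  obtain ⟨Cl, hCl⟩ := (isCompact_Icc (a := s₁) (b := s₂)).exists_bound_of_continuousOn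
    (hl.mono hIcc)
  obtain ⟨Cb, hCb⟩ := (isCompact_closedBall q R).exists_bound_of_continuousOn hbc
  obtain ⟨L, hL0, hLl, hLb⟩ : ∃ L : ℝ, 0 < L ∧ (∀ s ∈ Icc s₁ s₂, |l s| ≤ L) ∧
      ∀ x ∈ closedBall q R, |b x| ≤ L :=
    ⟨max 1 (max Cl Cb), by positivity, fun s hs => (hCl s hs).trans (by simp),
      fun x hx => (hCb x hx).trans (by simp)⟩
  have hv : ∀ s ∈ Icc s₁ s₂, ‖l s • B (Γ s)‖ ≤ L := fun s hs => by
    rw [norm_smul, hunit _ (hsub (hΓU (hIcc hs))), mul_one]; exact hLl s hs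
  have hlim : ∀ ε > 0, inner ℝ (B (Γ s₂)) e - inner ℝ (B (Γ s₁)) e ≤
      G s₂ - G s₁ + (L * ε * ‖e‖ * (s₂ - s₁) + 2 * ε * ‖e‖) := by
    intro ε hε
    obtain ⟨δ₁, hδ₁, hB'⟩ := Metric.uniformContinuousOn_iff.1
      ((isCompact_closedBall q R).uniformContinuousOn_of_continuous hBc) ε hε
    obtain ⟨δ₂, hδ₂, hb'⟩ := Metric.uniformContinuousOn_iff.1
      ((isCompact_closedBall q R).uniformContinuousOn_of_continuous hbc) ε hε
    obtain ⟨σ, hσ, hσR, hσ₁, hσ₂⟩ : ∃ σ : ℝ, 0 < σ ∧ σ * ‖e‖ < R / 2 ∧ σ * ‖e‖ < δ₁ ∧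
        σ * ‖e‖ < δ₂ := by
      have : Tendsto (fun σ : ℝ => σ * ‖e‖) (𝓝[>] 0) (𝓝 0) := by
        have : Tendsto (fun σ : ℝ => σ * ‖e‖) (𝓝 0) (𝓝 (0 * ‖e‖)) := by
          exact (continuous_id.mul continuous_const).tendsto 0
        rw [zero_mul] at this
        exact this.mono_left nhdsWithin_le_nhds
      obtain ⟨σ, h⟩ := (((eventually_mem_nhdsWithin (a := (0 : ℝ)) (s := Ioi 0)).and
        ((this.eventually_lt_const (by linarith : 0 < R / 2)).and
        ((this.eventually_lt_const hδ₁).and (this.eventually_lt_const hδ₂))))).exists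
      exact ⟨σ, h.1, h.2.1, h.2.2.1, h.2.2.2⟩
    have hmem : ∀ s ∈ Ioo α β, Γ s + σ • e ∈ ball q R := fun s hs => by
      have h1 := mem_ball.1 (hΓU hs)
      rw [mem_ball]
      have h2 : dist (Γ s + σ • e) (Γ s) = σ * ‖e‖ := by
        rw [dist_eq_norm]; simp [norm_smul, abs_of_pos hσ]
      linarith [dist_triangle (Γ s + σ • e) (Γ s) q]
    have hdist : ∀ s, ∀ r ∈ Icc (0 : ℝ) 1,
        dist (Γ s + r • (Γ s + σ • e - Γ s)) (Γ s) ≤ σ * ‖e‖ := by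
      intro s r hr
      have : 0 ≤ σ * ‖e‖ := by positivity
      rw [dist_eq_norm]
      simp only [add_sub_cancel_left, norm_smul, Real.norm_eq_abs, abs_of_pos hσ,
        abs_of_nonneg hr.1]
      nlinarith [hr.2]
    have hseg : ∀ s ∈ Ioo α β, ∀ r ∈ Icc (0 : ℝ) 1,
        Γ s + r • (Γ s + σ • e - Γ s) ∈ closedBall q R := fun s hs r hr =>
      ball_subset_closedBall
        (add_smul_sub_mem (convex_ball q R) (hsub (hΓU hs)) (hmem s hs) hr)
    have hvc : ContinuousOn (fun s => l s • B (Γ s)) (Ioo α β) :=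
      hl.smul (hBc'.comp hΓc fun s hs => hsub (hΓU hs))
    have hder := hB Γ (fun s => Γ s + σ • e) (fun s => l s • B (Γ s)) (fun s => l s • B (Γ s)) α β
      hΓ (fun s hs => (hΓ s hs).add_const _) hvc hvc (fun s hs => hsub (hΓU hs)) hmem
    have hvar := le_add_mul_of_hasDerivAt_le (C := L * ε * ‖e‖) h12
      (fun s hs => (hder s (hIcc hs)).const_mul σ⁻¹) (fun s hs => hG s (hIcc hs)) fun s hs => by
        have h1 := abs_segFlux_sub_le (convex_ball q R) hbc' (hsub (hΓU (hIcc hs)))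
          (hmem s (hIcc hs)) (a₀ := b (Γ s)) (v₀ := l s • B (Γ s)) (v := l s • B (Γ s))
          (w := l s • B (Γ s)) (η := 0) hε.le (hv s hs)
          (fun z hz => hLb z (ball_subset_closedBall hz)) (fun r hr => by
            rw [← Real.dist_eq]
            exact (hb' _ (hseg s (hIcc hs) r hr) _ (ball_subset_closedBall (hsub (hΓU (hIcc hs))))
              ((hdist s r hr).trans_lt hσ₂)).le) (by simp) (by simp)
        have hinner : (inner ℝ (B (Γ s + σ • e)) (l s • B (Γ s)) : ℝ)
            - inner ℝ (B (Γ s)) (l s • B (Γ s)) ≤ 0 := by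
          rw [inner_smul_right, inner_smul_right, ← mul_sub]
          refine mul_nonpos_of_nonneg_of_nonpos (hl0 s (hIcc hs)) ?_
          have h2 := real_inner_le_norm (B (Γ s + σ • e)) (B (Γ s))
          rw [real_inner_self_eq_norm_sq]
          rw [hunit _ (hmem s (hIcc hs)), hunit _ (hsub (hΓU (hIcc hs)))] at *
          linarith
        have h3 := le_of_abs_le h1
        rw [add_sub_cancel_left, perp_smul, inner_smul_right, norm_smul, Real.norm_eq_abs,
          abs_of_pos hσ] at h3
        rw [inv_mul_le_iff₀ hσ]
        linarith
    have hend : ∀ s ∈ Ioo α β, |σ⁻¹ * segInt B (Γ s) (Γ s + σ • e) - inner ℝ (B (Γ s)) e|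
        ≤ ε * ‖e‖ := by
      intro s hs
      have h1 := abs_segInt_sub_inner_le (convex_ball q R) hBc' (hsub (hΓU hs)) (hmem s hs)
        (A₀ := B (Γ s)) (ε := ε) fun r hr => by
          rw [← dist_eq_norm]
          exact (hB' _ (hseg s hs r hr) _ (ball_subset_closedBall (hsub (hΓU hs)))
              ((hdist s r hr).trans_lt hσ₁)).le
      rw [add_sub_cancel_left, inner_smul_right, norm_smul, Real.norm_eq_abs, abs_of_pos hσ] at h1
      have h2 : σ⁻¹ * segInt B (Γ s) (Γ s + σ • e) - inner ℝ (B (Γ s)) e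
          = σ⁻¹ * (segInt B (Γ s) (Γ s + σ • e) - σ * inner ℝ (B (Γ s)) e) := by
        field_simp
      rw [h2, abs_mul, abs_of_pos (inv_pos.2 hσ), inv_mul_le_iff₀ hσ]
      linarith
    have h1 := abs_le.1 (hend s₁ hs₁)
    have h2 := abs_le.1 (hend s₂ hs₂)
    linarith [h1.1, h1.2, h2.1, h2.2]
  have ht : Tendsto (fun ε : ℝ => G s₂ - G s₁ + (L * ε * ‖e‖ * (s₂ - s₁) + 2 * ε * ‖e‖)) (𝓝[>] 0)
      (𝓝 (G s₂ - G s₁ + (L * 0 * ‖e‖ * (s₂ - s₁) + 2 * 0 * ‖e‖))) := by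
    refine Tendsto.mono_left (Continuous.tendsto ?_ 0) nhdsWithin_le_nhds
    fun_prop
  have := ge_of_tendsto ht (eventually_mem_nhdsWithin.mono fun ε hε => hlim ε hε)
  simpa using this

/-- A continuous unit field whose curl is continuous is differentiable along its integral curves
(in any positive parametrization). -/
lemma hasDerivAt_unit_along {q : Plane} {R : ℝ} {B : Plane → Plane} {b : Plane → ℝ}
    (hB : HasCurlOn B b (ball q R)) (hBc : ContinuousOn B (closedBall q R))
    (hbc : ContinuousOn b (closedBall q R)) (hunit : ∀ x ∈ ball q R, ‖B x‖ = 1)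
    {Γ : ℝ → Plane} {l : ℝ → ℝ} {α β : ℝ} (hΓ : ∀ s ∈ Ioo α β, HasDerivAt Γ (l s • B (Γ s)) s)
    (hl : ContinuousOn l (Ioo α β)) (hl0 : ∀ s ∈ Ioo α β, 0 ≤ l s)
    (hΓU : MapsTo Γ (Ioo α β) (ball q (R / 2))) {t : ℝ} (ht : t ∈ Ioo α β) :
    HasDerivAt (fun s => B (Γ s)) (-(b (Γ t) * l t) • perp (B (Γ t))) t := by
  have hR : 0 < R := by
    have := dist_nonneg.trans_lt (mem_ball.1 (hΓU ht)); linarith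
  have hsub : ball q (R / 2) ⊆ closedBall q R :=
    (ball_subset_ball (by linarith)).trans ball_subset_closedBall
  have hΓc : ContinuousOn Γ (Ioo α β) := fun s hs => (hΓ s hs).continuousAt.continuousWithinAt
  have hBΓ : ContinuousOn (fun s => B (Γ s)) (Ioo α β) := hBc.comp hΓc fun s hs => hsub (hΓU hs)
  have hbΓ : ContinuousOn (fun s => b (Γ s)) (Ioo α β) := hbc.comp hΓc fun s hs => hsub (hΓU hs)
  have hinner : ∀ e : Plane, HasDerivAt (fun s => (inner ℝ (B (Γ s)) e : ℝ))
      (b (Γ t) * inner ℝ (l t • B (Γ t)) (perp e)) t := by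
    intro e
    obtain ⟨G, -, hG⟩ := exists_primitive_Ioo
      (g := fun s => b (Γ s) * inner ℝ (l s • B (Γ s)) (perp e))
      (hbΓ.mul ((hl.smul hBΓ).inner continuousOn_const)) ht
    have hconst : ∀ s ∈ Ioo α β, inner ℝ (B (Γ s)) e = G s - G t + inner ℝ (B (Γ t)) e := by
      have key : ∀ s₁ ∈ Ioo α β, ∀ s₂ ∈ Ioo α β, s₁ ≤ s₂ →
          inner ℝ (B (Γ s₂)) e - inner ℝ (B (Γ s₁)) e = G s₂ - G s₁ := by
        intro s₁ hs₁ s₂ hs₂ h12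
        have h1 := inner_sub_inner_le_of_unit hB hBc hbc hunit hΓ hl hl0 hΓU hG hs₁ hs₂ h12
        have h2 := inner_sub_inner_le_of_unit hB hBc hbc hunit hΓ hl hl0 hΓU (e := -e)
          (G := fun s => -G s) (fun s hs => by
            have := (hG s hs).neg
            rwa [← mul_neg, ← inner_neg_right, ← perp_neg] at this) hs₁ hs₂ h12
        rw [inner_neg_right, inner_neg_right] at h2
        linarith
      intro s hs
      rcases le_total s t with h | h
      · linarith [key s hs t ht h]
      · linarith [key t ht s hs h]
    refine (((hG t ht).sub_const (G t)).add_const (inner ℝ (B (Γ t)) e)).congr_of_eventuallyEq ?_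
    filter_upwards [isOpen_Ioo.mem_nhds ht] with s hs
    exact hconst s hs
  refine hasDerivAt_plane fun i => ?_
  have := hinner (EuclideanSpace.single i 1)
  simp only [inner_single_right] at this
  convert this using 1
  rw [inner_smul_left, inner_perp_right, inner_single_right]
  simp
  ring

end

/-! ### Short segments, and remainders that are uniform on a compact interval -/

section

section Short

variable {ι : Type*} {l : Filter ι} {q : Plane} {R : ℝ} {x y : ι → Plane}

/-- Uniform continuity along segments that shrink. -/
lemma eventually_dist_segment_lt {E : Type*} [PseudoMetricSpace E] {f : Plane → E}
    (hf : ContinuousOn f (closedBall q R)) (hx : ∀ᶠ p in l, x p ∈ ball q R)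
    (hy : ∀ᶠ p in l, y p ∈ ball q R) (hxy : Tendsto (fun p => y p - x p) l (𝓝 0)) {ε : ℝ}
    (hε : 0 < ε) : ∀ᶠ p in l, ∀ r ∈ Icc (0 : ℝ) 1,
      dist (f (x p + r • (y p - x p))) (f (x p)) < ε := by
  obtain ⟨δ, hδ, h⟩ := Metric.uniformContinuousOn_iff.1
    ((isCompact_closedBall q R).uniformContinuousOn_of_continuous hf) ε hε
  have hxy' : ∀ᶠ p in l, ‖y p - x p‖ < δ := by
    have := hxy.norm
    rw [norm_zero] at this
    exact this.eventually_lt_const hδ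
  filter_upwards [hx, hy, hxy'] with p hxp hyp hp r hr
  refine h _ (ball_subset_closedBall (add_smul_sub_mem (convex_ball q R) hxp hyp hr)) _
    (ball_subset_closedBall hxp) ?_
  rw [dist_eq_norm, add_sub_cancel_left, norm_smul, Real.norm_eq_abs, abs_of_nonneg hr.1]
  nlinarith [norm_nonneg (y p - x p), hr.2]

lemma isLittleO_segInt {A : Plane → Plane} (hA : ContinuousOn A (closedBall q R))
    (hx : ∀ᶠ p in l, x p ∈ ball q R) (hy : ∀ᶠ p in l, y p ∈ ball q R)
    (hxy : Tendsto (fun p => y p - x p) l (𝓝 0)) :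
    (fun p => segInt A (x p) (y p) - inner ℝ (A (x p)) (y p - x p)) =o[l]
      fun p => y p - x p := by
  rw [isLittleO_iff]
  intro ε hε
  filter_upwards [hx, hy, eventually_dist_segment_lt hA hx hy hxy hε] with p hxp hyp hp
  exact abs_segInt_sub_inner_le (convex_ball q R) (hA.mono ball_subset_closedBall) hxp hyp
    fun r hr => by rw [← dist_eq_norm]; exact (hp r hr).le

lemma isLittleO_segFlux {a : Plane → ℝ} {M : Plane → Plane} (ha : ContinuousOn a (closedBall q R))
    (hM : ContinuousOn M (closedBall q R))
    (hx : ∀ᶠ p in l, x p ∈ ball q R) (hy : ∀ᶠ p in l, y p ∈ ball q R)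
    (hxy : Tendsto (fun p => y p - x p) l (𝓝 0)) :
    (fun p => segFlux a (x p) (y p) (M (x p)) (M (y p))
      - a (x p) * inner ℝ (M (x p)) (perp (y p - x p))) =o[l] fun p => y p - x p := by
  obtain ⟨C₁, hC₁⟩ := (isCompact_closedBall q R).exists_bound_of_continuousOn ha
  obtain ⟨C₂, hC₂⟩ := (isCompact_closedBall q R).exists_bound_of_continuousOn hM
  obtain ⟨L, hL, h₁, h₂⟩ : ∃ L : ℝ, 0 < L ∧ (∀ x ∈ closedBall q R, |a x| ≤ L) ∧
      ∀ x ∈ closedBall q R, ‖M x‖ ≤ L :=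
    ⟨max 1 (max C₁ C₂), by positivity, fun s hs => (hC₁ s hs).trans (by simp),
      fun x hx => (hC₂ x hx).trans (by simp)⟩
  rw [isLittleO_iff]
  intro ε hε
  have hε' : 0 < ε / (2 * L) := by positivity
  filter_upwards [hx, hy, eventually_dist_segment_lt ha hx hy hxy hε',
    eventually_dist_segment_lt hM hx hy hxy hε'] with p hxp hyp hp hp'
  have := abs_segFlux_sub_le (convex_ball q R) (ha.mono ball_subset_closedBall) hxp hyp
    (a₀ := a (x p)) (v₀ := M (x p)) (v := M (x p)) (w := M (y p)) hε'.le
    (h₂ _ (ball_subset_closedBall hxp)) (fun z hz => h₁ z (ball_subset_closedBall hz))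
    (fun r hr => (hp r hr).le) (η := ε / (2 * L)) (by simpa using hε'.le) (by
      have := (hp' 1 ⟨zero_le_one, le_rfl⟩).le
      rwa [one_smul, add_sub_cancel, dist_eq_norm] at this)
  refine this.trans (le_of_eq ?_)
  field_simp
  ring

end Short

/-- A remainder whose derivative is small uniformly on an interval is itself small there. -/
lemma isLittleO_of_hasDerivAt {ι E F : Type*} [NormedAddCommGroup E] [NormedSpace ℝ E]
    [NormedAddCommGroup F] {l : Filter ι} {S : ℝ} (hS : 0 ≤ S)
    {f f' : ι → ℝ → E} {g : ι → F}
    (hf : ∀ᶠ i in l, ∀ s ∈ Icc (-S) S, HasDerivAt (f i) (f' i s) s)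
    (hf' : (fun p : ι × ℝ => f' p.1 p.2) =o[l ×ˢ 𝓟 (Icc (-S) S)] fun p => g p.1)
    (h0 : (fun i => f i 0) =o[l] g) :
    (fun p : ι × ℝ => f p.1 p.2) =o[l ×ˢ 𝓟 (Icc (-S) S)] fun p => g p.1 := by
  rw [isLittleO_iff] at *
  intro ε hε
  have hS' : 0 < 1 + S := by linarith
  have h1 := hf' (c := ε / (1 + S)) (by positivity)
  rw [eventually_prod_principal_iff] at h1 ⊢
  filter_upwards [hf, h1, h0 (c := ε / (1 + S)) (by positivity)] with i hi h1i h0i s hs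
  have hmem0 : (0 : ℝ) ∈ Icc (-S) S := ⟨by linarith, hS⟩
  have hmv := (convex_Icc (-S) S).norm_image_sub_le_of_norm_hasDerivWithin_le
    (fun s hs => (hi s hs).hasDerivWithinAt) (fun s hs => h1i s hs) hmem0 hs
  have hs' : ‖s - 0‖ ≤ S := by rw [sub_zero]; exact abs_le.2 hs
  have h2 : ε / (1 + S) * ‖g i‖ * ‖s - 0‖ ≤ ε / (1 + S) * ‖g i‖ * S := by gcongr
  calc ‖f i s‖ = ‖(f i s - f i 0) + f i 0‖ := by rw [sub_add_cancel]
    _ ≤ ‖f i s - f i 0‖ + ‖f i 0‖ := norm_add_le _ _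
    _ ≤ ε / (1 + S) * ‖g i‖ * S + ε / (1 + S) * ‖g i‖ := add_le_add (hmv.trans h2) h0i
    _ = ε * ‖g i‖ := by field_simp; ring

lemma isBigO_one_snd {ι E : Type*} [NormedAddCommGroup E] {l : Filter ι} {J : Set ℝ}
    (hJ : IsCompact J) {f : ℝ → E} (hf : ContinuousOn f J) :
    (fun p : ι × ℝ => f p.2) =O[l ×ˢ 𝓟 J] fun _ => (1 : ℝ) := by
  obtain ⟨C, hC⟩ := hJ.exists_bound_of_continuousOn hf
  refine IsBigO.of_bound C ?_
  rw [eventually_prod_principal_iff]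
  exact Eventually.of_forall fun i s hs => by simpa using hC s hs

/-! ### The transversal flow -/

/-- Local data around a nonsingular point: a unit field `N` and a positive function `D` such that
the one-forms `D N` and `N^⊥` have the continuous curls `c` and `-H`. The constants `m` and `K` are
those of the frame that these one-forms make up. -/
structure IsLocalSolution (q : Plane) (R : ℝ) (N : Plane → Plane) (D c H : Plane → ℝ)
    (m K : ℝ) : Prop where
  R_pos : 0 < R
  contN : ContinuousOn N (closedBall q R)
  contD : ContinuousOn D (closedBall q R)
  contc : ContinuousOn c (closedBall q R)
  contH : ContinuousOn H (closedBall q R)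
  unit : ∀ x ∈ closedBall q R, ‖N x‖ = 1
  D_pos : ∀ x ∈ closedBall q R, 0 < D x
  frame : IsCurlFrame (ball q R) (fun x => D x • N x) (fun x => perp (N x)) c (fun x => -H x) m K

namespace IsLocalSolution

variable {q : Plane} {R : ℝ} {N : Plane → Plane} {D c H : Plane → ℝ} {m K : ℝ}

lemma contM (h : IsLocalSolution q R N D c H m K) :
    ContinuousOn (fun x => (D x)⁻¹ • N x) (closedBall q R) :=
  (h.contD.inv₀ fun x hx => (h.D_pos x hx).ne').smul h.contN

lemma contB (h : IsLocalSolution q R N D c H m K) :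
    ContinuousOn (fun x => perp (N x)) (closedBall q R) :=
  continuous_perp.comp_continuousOn h.contN

lemma contA (h : IsLocalSolution q R N D c H m K) :
    ContinuousOn (fun x => D x • N x) (closedBall q R) :=
  h.contD.smul h.contN

lemma exists_bound_M (h : IsLocalSolution q R N D c H m K) :
    ∃ L, 1 ≤ L ∧ ∀ x ∈ closedBall q R, ‖(D x)⁻¹ • N x‖ ≤ L := by
  obtain ⟨C, hC⟩ := (isCompact_closedBall q R).exists_bound_of_continuousOn h.contM
  exact ⟨max 1 C, le_max_left _ _, fun x hx => (hC x hx).trans (le_max_right _ _)⟩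

lemma inner_A_M (h : IsLocalSolution q R N D c H m K) {x : Plane} (hx : x ∈ closedBall q R) :
    (inner ℝ (D x • N x) ((D x)⁻¹ • N x) : ℝ) = 1 := by
  rw [inner_smul_left, inner_smul_right, real_inner_self_eq_norm_sq, h.unit x hx]
  have := (h.D_pos x hx).ne'
  simp
  field_simp

lemma inner_B_M (x : Plane) : (inner ℝ (perp (N x)) ((D x)⁻¹ • N x) : ℝ) = 0 := by
  rw [inner_smul_right, inner_perp_self, mul_zero]

/-- The derivative with respect to the initial point of the flow of `N / D`, started on an integral
curve of `N^⊥`. Stokes' formula gives equations for the components of the derivative in the frame,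
although the field that generates the flow is only continuous. -/
lemma hasDerivAt_transversal_flow (h : IsLocalSolution q R N D c H m K) {T S : ℝ}
    {W : ℝ → ℝ → Plane} {s₀ : ℝ} (hs₀ : s₀ ∈ Ioo (-S) S)
    (hW : ∀ s ∈ Ioo (-S) S, ∀ t ∈ Ioo (-T) T,
      W s t ∈ ball q R ∧ HasDerivAt (W s) ((D (W s t))⁻¹ • N (W s t)) t)
    (hΓ : HasDerivAt (fun s => W s 0) (perp (N (W s₀ 0))) s₀)
    {P ρ : ℝ → ℝ} (hP0 : P 0 = 1) (hPpos : ∀ t ∈ Ioo (-T) T, 0 < P t)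
    (hP : ∀ t ∈ Ioo (-T) T, HasDerivAt P (H (W s₀ t) * (D (W s₀ t))⁻¹ * P t) t)
    (hρ0 : ρ 0 = 0)
    (hρ : ∀ t ∈ Ioo (-T) T, HasDerivAt ρ (-(c (W s₀ t) * (D (W s₀ t))⁻¹ * P t)) t)
    {t : ℝ} (ht : t ∈ Ioo (-T) T) :
    HasDerivAt (fun s => W s t)
      (P t • perp (N (W s₀ t)) + (ρ t * (D (W s₀ t))⁻¹) • N (W s₀ t)) s₀ := by
  obtain ⟨T', hT', htT', hT'T⟩ : ∃ T', 0 ≤ T' ∧ t ∈ Icc (-T') T' ∧ Icc (-T') T' ⊆ Ioo (-T) T := by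
    refine ⟨|t|, abs_nonneg t, ⟨neg_abs_le t, le_abs_self t⟩, fun s hs => ?_⟩
    have : |t| < T := abs_lt.2 ht
    exact ⟨by linarith [hs.1], by linarith [hs.2]⟩
  have h0J : (0 : ℝ) ∈ Icc (-T') T' := ⟨by linarith, hT'⟩
  set J := Icc (-T') T' with hJ
  set l : Filter (ℝ × ℝ) := 𝓝 s₀ ×ˢ 𝓟 J with hl
  have hS : ∀ᶠ s in 𝓝 s₀, s ∈ Ioo (-S) S := isOpen_Ioo.mem_nhds hs₀
  have hWc : ∀ s ∈ Ioo (-S) S, ContinuousOn (W s) (Ioo (-T) T) := fun s hs t ht =>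
    (hW s hs t ht).2.continuousAt.continuousWithinAt
  obtain ⟨L, hL1, hL⟩ := h.exists_bound_M
  obtain ⟨C, hC, hstab⟩ := h.frame.stability (by linarith : 0 < L) T
  have hMc := h.contM
  have hMc' := h.contM.mono ball_subset_closedBall
  -- The separation of the curves is of the order of the separation of their initial points.
  have hχ : ∀ s ∈ Ioo (-S) S, ∀ t ∈ Ioo (-T) T, ‖W s t - W s₀ t‖ ≤ C * ‖W s 0 - W s₀ 0‖ := by
    intro s hs t ht
    have := hstab (W s₀) (W s) (fun t => (D (W s₀ t))⁻¹ • N (W s₀ t))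
      (fun t => (D (W s t))⁻¹ • N (W s t)) T 0 le_rfl (fun t ht => (hW s₀ hs₀ t ht).2)
      (fun t ht => (hW s hs t ht).2)
      (hMc'.comp (hWc s₀ hs₀) fun t ht => (hW s₀ hs₀ t ht).1)
      (hMc'.comp (hWc s hs) fun t ht => (hW s hs t ht).1)
      (fun t ht => (hW s₀ hs₀ t ht).1) (fun t ht => (hW s hs t ht).1)
      (fun t ht => hL _ (ball_subset_closedBall (hW s₀ hs₀ t ht).1))
      (fun t ht => hL _ (ball_subset_closedBall (hW s hs t ht).1))
      (fun t ht => by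
        rw [h.inner_A_M (ball_subset_closedBall (hW s₀ hs₀ t ht).1),
          h.inner_A_M (ball_subset_closedBall (hW s hs t ht).1)]; simp)
      (fun t ht => by rw [inner_B_M, inner_B_M]; simp) t ht
    simpa using this
  have hO : (fun p : ℝ × ℝ => W p.1 p.2 - W s₀ p.2) =O[l] fun p => p.1 - s₀ := by
    have h1 : (fun p : ℝ × ℝ => W p.1 p.2 - W s₀ p.2) =O[l] fun p => W p.1 0 - W s₀ 0 := by
      refine IsBigO.of_bound C ?_
      rw [hl, eventually_prod_principal_iff]
      filter_upwards [hS] with s hs t ht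
      exact hχ s hs t (hT'T ht)
    exact h1.trans (hΓ.isBigO_sub.comp_tendsto tendsto_fst)
  have hsub0 : Tendsto (fun p : ℝ × ℝ => p.1 - s₀) l (𝓝 0) := by
    have : Tendsto (fun p : ℝ × ℝ => p.1) l (𝓝 s₀) := tendsto_fst
    simpa using this.sub_const s₀
  have hχ0 : Tendsto (fun p : ℝ × ℝ => W p.1 p.2 - W s₀ p.2) l (𝓝 0) := hO.trans_tendsto hsub0
  have hmem : ∀ᶠ p in l, W p.1 p.2 ∈ ball q R := by
    rw [hl, eventually_prod_principal_iff]
    filter_upwards [hS] with s hs t ht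
    exact (hW s hs t (hT'T ht)).1
  have hmem₀ : ∀ᶠ p in l, W s₀ p.2 ∈ ball q R := by
    rw [hl, eventually_prod_principal_iff]
    exact Eventually.of_forall fun s t ht => (hW s₀ hs₀ t (hT'T ht)).1
  have hcl : ∀ t ∈ J, W s₀ t ∈ closedBall q R := fun t ht =>
    ball_subset_closedBall (hW s₀ hs₀ t (hT'T ht)).1
  have hcW : ContinuousOn (W s₀) J := (hWc s₀ hs₀).mono hT'T
  have hJc : IsCompact J := isCompact_Icc
  -- bounded coefficients
  have bigO : ∀ f : ℝ → ℝ, ContinuousOn f J →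
      (fun p : ℝ × ℝ => f p.2) =O[l] fun _ => (1 : ℝ) := fun f hf => isBigO_one_snd hJc hf
  have contD' : ContinuousOn (fun t => (D (W s₀ t))⁻¹) J :=
    (h.contD.comp hcW hcl).inv₀ fun t ht => (h.D_pos _ (hcl t ht)).ne'
  have contP : ContinuousOn P J := fun t ht => (hP t (hT'T ht)).continuousAt.continuousWithinAt
  have hsegB := (isLittleO_segInt h.contB hmem₀ hmem hχ0).trans_isBigO hO
  have hsegA := (isLittleO_segInt h.contA hmem₀ hmem hχ0).trans_isBigO hO
  have hfluxB := (isLittleO_segFlux (show ContinuousOn (fun x => -H x) _ from h.contH.neg) h.contM hmem₀ hmem hχ0).trans_isBigO hO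
  have hfluxA := (isLittleO_segFlux h.contc h.contM hmem₀ hmem hχ0).trans_isBigO hO
  have hder : ∀ (A : Plane → Plane) (a : Plane → ℝ) (ξ : ℝ), HasCurlOn A a (ball q R) →
      (∀ x ∈ ball q R, (inner ℝ (A x) ((D x)⁻¹ • N x) : ℝ) = ξ) →
      ∀ s ∈ Ioo (-S) S, ∀ t ∈ Ioo (-T) T, HasDerivAt (fun t => segInt A (W s₀ t) (W s t))
        (segFlux a (W s₀ t) (W s t) ((D (W s₀ t))⁻¹ • N (W s₀ t)) ((D (W s t))⁻¹ • N (W s t)))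
        t := by
    intro A a ξ hA hξ s hs t ht
    have := hA (W s₀) (W s) (fun t => (D (W s₀ t))⁻¹ • N (W s₀ t))
      (fun t => (D (W s t))⁻¹ • N (W s t)) (-T) T (fun t ht => (hW s₀ hs₀ t ht).2)
      (fun t ht => (hW s hs t ht).2)
      (hMc'.comp (hWc s₀ hs₀) fun t ht => (hW s₀ hs₀ t ht).1)
      (hMc'.comp (hWc s hs) fun t ht => (hW s hs t ht).1)
      (fun t ht => (hW s₀ hs₀ t ht).1) (fun t ht => (hW s hs t ht).1) t ht
    rwa [hξ _ (hW s₀ hs₀ t ht).1, hξ _ (hW s hs t ht).1, sub_self, zero_add] at this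
  have hderB := hder _ _ 0 h.frame.curlB fun x _ => inner_B_M x
  have hderA := hder _ _ 1 h.frame.curlA fun x hx => h.inner_A_M (ball_subset_closedBall hx)
  have hinit : (fun s => W s 0 - W s₀ 0 - (s - s₀) • perp (N (W s₀ 0))) =o[𝓝 s₀]
      fun s => s - s₀ := hasDerivAt_iff_isLittleO.1 hΓ
  have hat0 : Tendsto (fun s : ℝ => (s, (0 : ℝ))) (𝓝 s₀) l :=
    tendsto_id.prodMk (tendsto_principal.2 (Eventually.of_forall fun _ => h0J))
  -- The component along `N^⊥`.
  have hB1 : (fun p : ℝ × ℝ => segInt (fun x => perp (N x)) (W s₀ p.2) (W p.1 p.2) * (P p.2)⁻¹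
      - (p.1 - s₀)) =o[l] fun p => p.1 - s₀ := by
    refine isLittleO_of_hasDerivAt hT'
      (f := fun s t => segInt (fun x => perp (N x)) (W s₀ t) (W s t) * (P t)⁻¹ - (s - s₀))
      (f' := fun s t => (segFlux (fun x => -H x) (W s₀ t) (W s t)
          ((D (W s₀ t))⁻¹ • N (W s₀ t)) ((D (W s t))⁻¹ • N (W s t))
          - H (W s₀ t) * (D (W s₀ t))⁻¹ * segInt (fun x => perp (N x)) (W s₀ t) (W s t))
          * (P t)⁻¹) (g := fun s => s - s₀) ?_ ?_ ?_
    · filter_upwards [hS] with s hs t ht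
      have hPt := (hPpos t (hT'T ht)).ne'
      refine (((hderB s hs t (hT'T ht)).mul ((hP t (hT'T ht)).inv hPt)).sub_const _).congr_deriv ?_
      simp only [Pi.inv_apply]
      generalize segFlux _ _ _ _ _ = z
      field_simp
      ring
    · have e1 := hfluxB.sub (((bigO _ ((h.contH.comp hcW hcl).mul contD')).mul_isLittleO hsegB).congr_right
        (fun p => one_mul (p.1 - s₀)))
      have hPc : ContinuousOn (fun t => (P t)⁻¹) J :=
        contP.inv₀ fun t ht => (hPpos t (hT'T ht)).ne'
      refine (e1.mul_isBigO (bigO _ hPc)).congr (fun p => ?_) (fun p => mul_one _)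
      simp only [inner_smul_left, inner_perp_right, Function.comp, RCLike.conj_to_real, Pi.mul_apply]
      ring
    · have e1 := (hsegB.comp_tendsto hat0)
      have e2 : (fun s => (inner ℝ (perp (N (W s₀ 0)))
          (W s 0 - W s₀ 0 - (s - s₀) • perp (N (W s₀ 0))) : ℝ)) =o[𝓝 s₀] fun s => s - s₀ :=
        (isBigO_iff.2 ⟨‖perp (N (W s₀ 0))‖, Eventually.of_forall fun s =>
          abs_real_inner_le_norm _ _⟩ : _ =O[𝓝 s₀] _).trans_isLittleO hinit
      refine (e1.add e2).congr (fun s => ?_) (fun s => rfl)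
      simp only [Function.comp, inner_sub_right, inner_smul_right, real_inner_self_eq_norm_sq,
        norm_perp, h.unit _ (hcl 0 h0J), hP0]
      ring
  have hB2 : (fun p : ℝ × ℝ => inner ℝ (perp (N (W s₀ p.2))) (W p.1 p.2 - W s₀ p.2)
      - P p.2 * (p.1 - s₀)) =o[l] fun p => p.1 - s₀ := by
    have e1 := ((bigO _ contP).mul_isLittleO hB1).congr_right fun p => one_mul (p.1 - s₀)
    have e2 := e1.sub hsegB
    refine e2.congr' ?_ (Eventually.of_forall fun p => rfl)
    rw [hl]
    refine eventually_prod_principal_iff.2 (Eventually.of_forall fun s t ht => ?_)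
    have hPt := (hPpos t (hT'T ht)).ne'
    simp only
    field_simp
    ring
  -- The component along `N`.
  have hA1 : (fun p : ℝ × ℝ => segInt (fun x => D x • N x) (W s₀ p.2) (W p.1 p.2)
      - ρ p.2 * (p.1 - s₀)) =o[l] fun p => p.1 - s₀ := by
    refine isLittleO_of_hasDerivAt hT'
      (f := fun s t => segInt (fun x => D x • N x) (W s₀ t) (W s t) - ρ t * (s - s₀))
      (f' := fun s t => segFlux c (W s₀ t) (W s t)
          ((D (W s₀ t))⁻¹ • N (W s₀ t)) ((D (W s t))⁻¹ • N (W s t))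
          - -(c (W s₀ t) * (D (W s₀ t))⁻¹ * P t) * (s - s₀)) (g := fun s => s - s₀) ?_ ?_ ?_
    · filter_upwards [hS] with s hs t ht
      exact (hderA s hs t (hT'T ht)).sub ((hρ t (hT'T ht)).mul_const _)
    · have e1 := hfluxA.sub (((bigO _ ((h.contc.comp hcW hcl).mul contD')).mul_isLittleO hB2).congr_right
        (fun p => one_mul (p.1 - s₀)))
      refine e1.congr (fun p => ?_) (fun p => rfl)
      simp only [inner_smul_left, inner_perp_right, Function.comp, RCLike.conj_to_real, Pi.mul_apply]
      ring
    · have e1 := (hsegA.comp_tendsto hat0)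
      have e2 : (fun s => (inner ℝ (D (W s₀ 0) • N (W s₀ 0))
          (W s 0 - W s₀ 0 - (s - s₀) • perp (N (W s₀ 0))) : ℝ)) =o[𝓝 s₀] fun s => s - s₀ :=
        (isBigO_iff.2 ⟨‖D (W s₀ 0) • N (W s₀ 0)‖, Eventually.of_forall fun s =>
          abs_real_inner_le_norm _ _⟩ : _ =O[𝓝 s₀] _).trans_isLittleO hinit
      refine (e1.add e2).congr (fun s => ?_) (fun s => rfl)
      simp only [Function.comp, inner_sub_right, inner_smul_right, inner_smul_left,
        inner_self_perp, hρ0]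
      ring
  have hA2 : (fun p : ℝ × ℝ => inner ℝ (N (W s₀ p.2)) (W p.1 p.2 - W s₀ p.2)
      - ρ p.2 * (D (W s₀ p.2))⁻¹ * (p.1 - s₀)) =o[l] fun p => p.1 - s₀ := by
    have e2 := ((bigO _ contD').mul_isLittleO (hA1.sub hsegA)).congr_right
      fun p => one_mul (p.1 - s₀)
    refine e2.congr' ?_ (Eventually.of_forall fun p => rfl)
    rw [hl]
    refine eventually_prod_principal_iff.2 (Eventually.of_forall fun s t ht => ?_)
    have hDt := (h.D_pos _ (hcl t ht)).ne'
    simp only [inner_smul_left, RCLike.conj_to_real]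
    field_simp
    ring
  -- Both components together, at time `t`.
  have hatt : Tendsto (fun s : ℝ => (s, t)) (𝓝 s₀) l :=
    tendsto_id.prodMk (tendsto_principal.2 (Eventually.of_forall fun _ => htT'))
  have f1 := (hA2.comp_tendsto hatt).smul_isBigO
    (isBigO_refl (fun _ : ℝ => N (W s₀ t)) (𝓝 s₀))
  have f2 := (hB2.comp_tendsto hatt).smul_isBigO
    (isBigO_refl (fun _ : ℝ => perp (N (W s₀ t))) (𝓝 s₀))
  have hbd : ∀ v : Plane, (fun s : ℝ => (s - s₀) • v) =O[𝓝 s₀] fun s => s - s₀ := fun v =>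
    IsBigO.of_bound ‖v‖ (Eventually.of_forall fun s => by rw [norm_smul, mul_comm])
  rw [hasDerivAt_iff_isLittleO]
  refine ((f1.trans_isBigO (hbd _)).add (f2.trans_isBigO (hbd _))).congr (fun s => ?_) fun s => rfl
  conv_rhs => rw [eq_inner_smul_add_inner_perp_smul (h.unit _ (hcl t htT')) (W s t - W s₀ t)]
  simp only [Function.comp]
  module

end IsLocalSolution

end

/-! ### Scalar equations depending on a parameter -/

section

lemma abs_le_mul_exp_of_abs_deriv_le {f f' : ℝ → ℝ} {S K : ℝ}
    (hf : ∀ s ∈ Ioo (-S) S, HasDerivAt f (f' s) s) (hf' : ∀ s ∈ Ioo (-S) S, |f' s| ≤ K * |f s|)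
    {s : ℝ} (hs : s ∈ Ioo (-S) S) : |f s| ≤ |f 0| * Real.exp (K * |s|) := by
  have fwd : ∀ g g' : ℝ → ℝ, (∀ s ∈ Ioo (-S) S, HasDerivAt g (g' s) s) →
      (∀ s ∈ Ioo (-S) S, |g' s| ≤ K * |g s|) → ∀ s, 0 ≤ s → s < S →
      |g s| ≤ |g 0| * Real.exp (K * s) := by
    intro g g' hg hg' s h0 hsS
    have hsub : ∀ r ∈ Icc 0 s, r ∈ Ioo (-S) S := fun r hr =>
      ⟨by linarith [hr.1], by linarith [hr.2]⟩
    have := norm_le_gronwallBound_of_norm_deriv_right_le (a := 0) (b := s) (f := g) (f' := g')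
      (K := K) (ε := 0) (δ := |g 0|)
      (fun r hr => (hg r (hsub r hr)).continuousAt.continuousWithinAt)
      (fun r hr => (hg r (hsub r (Ico_subset_Icc_self hr))).hasDerivWithinAt) le_rfl
      (fun r hr => by simpa using hg' r (hsub r (Ico_subset_Icc_self hr))) s ⟨h0, le_rfl⟩
    simpa [gronwallBound_ε0] using this
  rcases le_total 0 s with h | h
  · rw [abs_of_nonneg h]; exact fwd f f' hf hf' s h hs.2
  · have hneg : ∀ r ∈ Ioo (-S) S, -r ∈ Ioo (-S) S := fun r hr =>
      ⟨by linarith [hr.2], by linarith [hr.1]⟩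
    have := fwd (fun r => f (-r)) (fun r => -f' (-r))
      (fun r hr => ((hf _ (hneg r hr)).scomp r (hasDerivAt_neg r)).congr_deriv (by simp))
      (fun r hr => by simpa using hf' _ (hneg r hr)) (-s) (by linarith) (by linarith [hs.1])
    rw [abs_of_nonpos h]
    simpa using this

/-- The flow of the scalar equation `T' = ∫ r in 0..T, k s r`, for small initial values. -/
lemma exists_scalar_flow {k : ℝ → ℝ → ℝ} (hk : Continuous fun p : ℝ × ℝ => k p.1 p.2) {S₁ T₁ : ℝ}
    (hS₁ : 0 < S₁) (hT₁ : 0 < T₁) :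
    ∃ S₂, 0 < S₂ ∧ S₂ ≤ S₁ ∧ ∃ T : ℝ → ℝ → ℝ, ∃ C, ∀ τ ∈ Icc (-(T₁ / 4)) (T₁ / 4), T τ 0 = τ ∧
      ∀ s ∈ Ioo (-S₂) S₂, HasDerivAt (T τ) (∫ r in (0 : ℝ)..T τ s, k s r) s ∧ |T τ s| < T₁ ∧
        |T τ s| ≤ C * |τ| := by
  obtain ⟨K', hK'⟩ := ((isCompact_Icc (a := -S₁) (b := S₁)).prod
    (isCompact_Icc (a := -T₁) (b := T₁))).exists_bound_of_continuousOn hk.continuousOn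
  obtain ⟨K, hK1, hK⟩ : ∃ K : ℝ, 1 ≤ K ∧ ∀ s ∈ Icc (-S₁) S₁, ∀ t ∈ Icc (-T₁) T₁, |k s t| ≤ K :=
    ⟨max 1 K', le_max_left _ _, fun s hs t ht => (hK' (s, t) ⟨hs, ht⟩).trans (le_max_right _ _)⟩
  set S₂ := min S₁ (1 / (2 * K)) with hS₂
  have hS₂0 : 0 < S₂ := by positivity
  have hS₂1 : S₂ ≤ S₁ := min_le_left _ _
  have hS₂K : K * S₂ ≤ 1 / 2 := by
    calc K * S₂ ≤ K * (1 / (2 * K)) := by gcongr; exact min_le_right _ _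
      _ = 1 / 2 := by field_simp
  have hint : ∀ s a b : ℝ, IntervalIntegrable (k s) volume a b := fun s a b =>
    (hk.comp (by fun_prop : Continuous fun r : ℝ => (s, r))).intervalIntegrable _ _
  have hlip : ∀ s ∈ Icc (-S₁) S₁, ∀ x ∈ Icc (-T₁) T₁, ∀ y ∈ Icc (-T₁) T₁,
      |(∫ r in (0 : ℝ)..x, k s r) - ∫ r in (0 : ℝ)..y, k s r| ≤ K * |x - y| := by
    intro s hs x hx y hy
    rw [intervalIntegral.integral_interval_sub_left (hint _ _ _) (hint _ _ _)]
    refine intervalIntegral.norm_integral_le_of_norm_le_const (f := k s) fun r hr => hK s hs r ?_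
    exact ordConnected_Icc.uIcc_subset hy hx (uIoc_subset_uIcc hr)
  have hIcc : ∀ t : ℝ, t ∈ closedBall (0 : ℝ) (T₁ / 2) → t ∈ Icc (-T₁) T₁ := by
    intro t ht
    rw [Real.closedBall_eq_Icc] at ht
    exact ⟨by linarith [ht.1], by linarith [ht.2]⟩
  have h00 : (0 : ℝ) ∈ Icc (-T₁) T₁ := ⟨by linarith, hT₁.le⟩
  have hself : ∀ s ∈ Icc (-S₁) S₁, ∀ x ∈ Icc (-T₁) T₁, |∫ r in (0 : ℝ)..x, k s r| ≤ K * |x| := by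
    intro s hs x hx
    simpa using hlip s hs x hx 0 h00
  have hsub : ∀ s ∈ Icc (-S₂) S₂, s ∈ Icc (-S₁) S₁ := fun s hs =>
    ⟨by linarith [hs.1], by linarith [hs.2]⟩
  obtain ⟨a, ha⟩ : ∃ a : NNReal, (a : ℝ) = T₁ / 2 := ⟨⟨_, by positivity⟩, rfl⟩
  obtain ⟨r₀, hr₀⟩ : ∃ a : NNReal, (a : ℝ) = T₁ / 4 := ⟨⟨_, by positivity⟩, rfl⟩
  obtain ⟨L, hL⟩ : ∃ a : NNReal, (a : ℝ) = K * (T₁ / 2) := ⟨⟨_, by positivity⟩, rfl⟩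
  have hpl : IsPicardLindelof (fun s t => ∫ r in (0 : ℝ)..t, k s r) (tmin := -S₂) (tmax := S₂)
      ⟨0, by linarith, hS₂0.le⟩ 0 a r₀ L ⟨K, by positivity⟩ := by
    constructor <;> simp only [ha, hr₀, hL]
    · intro s hs
      refine LipschitzOnWith.of_dist_le_mul fun x hx y hy => ?_
      exact hlip s (hsub s hs) x (hIcc x hx) y (hIcc y hy)
    · intro x _
      refine Continuous.continuousOn ?_
      exact intervalIntegral.continuous_parametric_intervalIntegral_of_continuous
        (f := fun s r => k s r) (s := fun _ => x) hk continuous_const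
    · intro s hs x hx
      refine (hself s (hsub s hs) x (hIcc x hx)).trans ?_
      have : |x| ≤ T₁ / 2 := by simpa using mem_closedBall_zero_iff.1 hx
      exact mul_le_mul_of_nonneg_left this (by positivity)
    · simp only [sub_zero, zero_sub, neg_neg, max_self]
      nlinarith
  have hex : ∀ τ ∈ Icc (-(T₁ / 4)) (T₁ / 4), ∃ α : ℝ → ℝ, α 0 = τ ∧
      (∀ s ∈ Icc (-S₂) S₂, HasDerivWithinAt α (∫ r in (0 : ℝ)..α s, k s r) (Icc (-S₂) S₂) s) ∧
      ∀ s, α s ∈ closedBall (0 : ℝ) (T₁ / 2) := fun τ hτ => by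
    rw [← ha]
    exact hpl.exists_hasDerivWithinAt_mem_closedBall (x := τ)
      (by rw [Real.closedBall_eq_Icc, hr₀]; simpa using hτ)
  choose! T hT0 hT hTmem using hex
  refine ⟨S₂, hS₂0, hS₂1, T, Real.exp (K * S₂), fun τ hτ => ⟨hT0 τ hτ, fun s hs => ?_⟩⟩
  have hder : ∀ s ∈ Ioo (-S₂) S₂, HasDerivAt (T τ) (∫ r in (0 : ℝ)..T τ s, k s r) s :=
    fun s hs => (hT τ hτ s (Ioo_subset_Icc_self hs)).hasDerivAt (Icc_mem_nhds hs.1 hs.2)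
  refine ⟨hder s hs, ?_, ?_⟩
  · have := mem_closedBall_zero_iff.1 (hTmem τ hτ s)
    rw [Real.norm_eq_abs] at this
    linarith
  · have := abs_le_mul_exp_of_abs_deriv_le hder (K := K)
      (fun r hr => hself r (hsub r (Ioo_subset_Icc_self hr)) _ (hIcc _ (hTmem τ hτ r))) hs
    rw [hT0 τ hτ, mul_comm] at this
    refine this.trans ?_
    have h1 : |s| ≤ S₂ := (abs_lt.2 hs).le
    gcongr

/-- First-order expansion in the second variable, uniform in the first one. -/
lemma isLittleO_expansion {G G' : ℝ → ℝ → ℝ} {S T₁ : ℝ} (hT₁ : 0 < T₁)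
    (hG : ∀ s ∈ Icc (-S) S, ∀ t ∈ Ioo (-T₁) T₁, HasDerivAt (G s) (G' s t) t)
    (hG' : Continuous fun p : ℝ × ℝ => G' p.1 p.2) {T : ℝ → ℝ → ℝ}
    (hT : (fun p : ℝ × ℝ => T p.1 p.2) =O[𝓝 0 ×ˢ 𝓟 (Icc (-S) S)] fun p => p.1) :
    (fun p : ℝ × ℝ => G p.2 (T p.1 p.2) - G p.2 0 - G' p.2 0 * T p.1 p.2)
      =o[𝓝 0 ×ˢ 𝓟 (Icc (-S) S)] fun p => p.1 := by
  refine IsLittleO.trans_isBigO ?_ hT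
  have hT0 : Tendsto (fun p : ℝ × ℝ => T p.1 p.2) (𝓝 0 ×ˢ 𝓟 (Icc (-S) S)) (𝓝 0) :=
    hT.trans_tendsto tendsto_fst
  rw [isLittleO_iff]
  intro ε hε
  have huc := ((isCompact_Icc (a := -S) (b := S)).prod
    (isCompact_Icc (a := -T₁) (b := T₁))).uniformContinuousOn_of_continuous hG'.continuousOn
  obtain ⟨δ, hδ, h⟩ := Metric.uniformContinuousOn_iff.1 huc ε hε
  have hev : ∀ᶠ p in 𝓝 (0 : ℝ) ×ˢ 𝓟 (Icc (-S) S), |T p.1 p.2| < min δ T₁ := by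
    have := hT0.norm
    rw [norm_zero] at this
    exact this.eventually_lt_const (lt_min hδ hT₁)
  rw [eventually_prod_principal_iff] at hev ⊢
  filter_upwards [hev] with τ hτ s hs
  have h1 := hτ s hs
  have hmem : ∀ r ∈ Icc (-|T τ s|) |T τ s|, r ∈ Ioo (-T₁) T₁ := fun r hr =>
    ⟨by linarith [hr.1, h1.trans_le (min_le_right _ _)],
      by linarith [hr.2, h1.trans_le (min_le_right _ _)]⟩
  have hmv := (convex_Icc (-|T τ s|) |T τ s|).norm_image_sub_le_of_norm_hasDerivWithin_le
    (f := fun r => G s r - G' s 0 * r) (f' := fun r => G' s r - G' s 0) (C := ε)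
    (fun r hr => ((hG s hs r (hmem r hr)).sub
      (((hasDerivAt_id r).const_mul (G' s 0)).congr_deriv (mul_one _))).hasDerivWithinAt)
    (fun r hr => by
      have hr' : |r| ≤ |T τ s| := abs_le.2 hr
      have := h (s, r) ⟨hs, Ioo_subset_Icc_self (hmem r hr)⟩ (s, 0) ⟨hs, by linarith, hT₁.le⟩ (by
        rw [Prod.dist_eq]; simp [hr'.trans_lt (h1.trans_le (min_le_left _ _))])
      exact this.le)
    (x := 0) (y := T τ s) (by simp) ⟨neg_abs_le _, le_abs_self _⟩
  simp only [mul_zero, sub_zero] at hmv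
  rw [sub_right_comm]
  exact hmv

/-- The derivative of `s ↦ W s (T s)`, when `W` is differentiable in its second variable, with a
continuous derivative, and in its first variable at the point considered. -/
lemma hasDerivAt_comp_diagonal {W M : ℝ → ℝ → Plane} {T : ℝ → ℝ} {s₀ T' : ℝ} {w : Plane}
    (hW₁ : HasDerivAt (fun s => W s (T s₀)) w s₀)
    (hW₂ : ∀ᶠ p in 𝓝 (s₀, T s₀), HasDerivAt (W p.1) (M p.1 p.2) p.2)
    (hM : ContinuousAt (fun p : ℝ × ℝ => M p.1 p.2) (s₀, T s₀)) (hT : HasDerivAt T T' s₀) :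
    HasDerivAt (fun s => W s (T s)) (w + T' • M s₀ (T s₀)) s₀ := by
  have key : (fun s => W s (T s) - W s (T s₀) - (T s - T s₀) • M s₀ (T s₀)) =o[𝓝 s₀]
      fun s => T s - T s₀ := by
    rw [isLittleO_iff]
    intro ε hε
    have hev := hW₂.and (Metric.continuousAt_iff'.1 hM ε hε)
    obtain ⟨δ, hδ, h⟩ := Metric.eventually_nhds_iff_ball.1 hev
    have hTc : ∀ᶠ s in 𝓝 s₀, dist (T s) (T s₀) < δ :=
      Metric.continuousAt_iff'.1 hT.continuousAt δ hδ
    filter_upwards [hTc, ball_mem_nhds s₀ hδ] with s hs hs'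
    have hmem : ∀ r ∈ ball (T s₀) δ, (s, r) ∈ ball (s₀, T s₀) δ := fun r hr => by
      rw [← ball_prod_same]; exact ⟨hs', hr⟩
    have hmv := (convex_ball (T s₀) δ).norm_image_sub_le_of_norm_hasDerivWithin_le
      (f := fun r => W s r - r • M s₀ (T s₀)) (f' := fun r => M s r - M s₀ (T s₀)) (C := ε)
      (fun r hr => ((h _ (hmem r hr)).1.sub
        (((hasDerivAt_id r).smul_const _).congr_deriv (one_smul _ _))).hasDerivWithinAt)
      (fun r hr => by rw [← dist_eq_norm]; exact (h _ (hmem r hr)).2.le)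
      (mem_ball_self hδ) (mem_ball.2 hs)
    have e : W s (T s) - W s (T s₀) - (T s - T s₀) • M s₀ (T s₀)
        = W s (T s) - T s • M s₀ (T s₀) - (W s (T s₀) - T s₀ • M s₀ (T s₀)) := by module
    rw [e]
    exact hmv
  have h1 := key.trans_isBigO hT.isBigO_sub
  have h2 := hasDerivAt_iff_isLittleO.1 hW₁
  have h3 := (hasDerivAt_iff_isLittleO.1 hT).smul_isBigO
    (isBigO_refl (fun _ : ℝ => M s₀ (T s₀)) (𝓝 s₀))
  have hbd : (fun s : ℝ => (s - s₀) • M s₀ (T s₀)) =O[𝓝 s₀] fun s => s - s₀ :=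
    IsBigO.of_bound ‖M s₀ (T s₀)‖ (Eventually.of_forall fun s => by rw [norm_smul, mul_comm])
  rw [hasDerivAt_iff_isLittleO]
  refine ((h1.add h2).add (h3.trans_isBigO hbd)).congr (fun s => ?_) fun s => rfl
  simp only [smul_eq_mul]
  module

lemma eq_zero_value_of_hasDerivAt_zero {E : Type*} [NormedAddCommGroup E] [NormedSpace ℝ E]
    {f : ℝ → E} {S : ℝ} (hf : ∀ s ∈ Ioo (-S) S, HasDerivAt f 0 s) {s : ℝ} (hs : s ∈ Ioo (-S) S) :
    f s = f 0 := by
  have h0 : (0 : ℝ) ∈ Ioo (-S) S := ⟨by linarith [hs.1, hs.2], by linarith [hs.1, hs.2]⟩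
  have := (convex_Ioo (-S) S).norm_image_sub_le_of_norm_hasDerivWithin_le (f' := fun _ => 0)
    (C := 0) (fun r hr => (hf r hr).hasDerivWithinAt) (fun r hr => by simp) h0 hs
  rw [zero_mul, norm_le_zero_iff, sub_eq_zero] at this
  exact this

end

/-! ### The separation of neighbouring characteristic curves -/

section

lemma hasDerivAt_integral_Ioo {E : Type*} [NormedAddCommGroup E] [NormedSpace ℝ E]
    [CompleteSpace E] {g : ℝ → E} {α β : ℝ} (hg : ContinuousOn g (Ioo α β)) {t₀ : ℝ}
    (ht₀ : t₀ ∈ Ioo α β) {t : ℝ} (ht : t ∈ Ioo α β) :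
    HasDerivAt (fun t => ∫ s in t₀..t, g s) (g t) t :=
  intervalIntegral.integral_hasDerivAt_right
    (hg.mono (ordConnected_Ioo.uIcc_subset ht₀ ht)).intervalIntegrable
    (hg.stronglyMeasurableAtFilter isOpen_Ioo t ht) (hg.continuousAt (isOpen_Ioo.mem_nhds ht))

/-- Second-order Taylor estimate for a function whose derivative is `1`-Lipschitz. -/
lemma abs_taylor_le {F F' : ℝ → ℝ} (hF : ∀ x, HasDerivAt F (F' x) x)
    (hF' : ∀ x y, |F' x - F' y| ≤ |x - y|) (x δ : ℝ) :
    |F (x + δ) - F x - F' x * δ| ≤ |δ| * |δ| := by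
  have hmv := (convex_Icc (-|δ|) |δ|).norm_image_sub_le_of_norm_hasDerivWithin_le
    (f := fun r => F (x + r) - F' x * r) (f' := fun r => F' (x + r) - F' x) (C := |δ|)
    (fun r _ => (((hF (x + r)).comp_const_add x r).sub
      (((hasDerivAt_id r).const_mul (F' x)).congr_deriv (mul_one _))).hasDerivWithinAt)
    (fun r hr => (hF' _ _).trans (by simpa using abs_le.2 hr))
    (x := 0) (y := δ) (by simp) ⟨neg_abs_le _, le_abs_self _⟩
  simp only [mul_zero, sub_zero, add_zero, Real.norm_eq_abs] at hmv
  rwa [sub_right_comm]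

/-- First-order expansion, uniform on an interval, of `∫ p F(E)` with respect to a parameter. -/
lemma isLittleO_integral_mul_comp {S S' : ℝ} (hS : 0 < S) (hSS' : S < S')
    {P E : ℝ → ℝ → ℝ} {p₁ e E₀ : ℝ → ℝ} {F F' : ℝ → ℝ}
    (hF : ∀ x, HasDerivAt F (F' x) x) (hF' : ∀ x y, |F' x - F' y| ≤ |x - y|)
    (hF1 : ∀ x, |F x| ≤ 1)
    (hPc : ∀ᶠ τ in 𝓝 (0 : ℝ), ContinuousOn (P τ) (Ioo (-S') S'))
    (hEc : ∀ᶠ τ in 𝓝 (0 : ℝ), ContinuousOn (E τ) (Ioo (-S') S'))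
    (hE₀c : ContinuousOn E₀ (Ioo (-S') S')) (hp₁ : ContinuousOn p₁ (Ioo (-S') S'))
    (he : ContinuousOn e (Ioo (-S') S'))
    (hP : (fun q : ℝ × ℝ => P q.1 q.2 - 1 - q.1 * p₁ q.2) =o[𝓝 0 ×ˢ 𝓟 (Icc (-S) S)] fun q => q.1)
    (hE : (fun q : ℝ × ℝ => E q.1 q.2 - E₀ q.2 - q.1 * e q.2)
      =o[𝓝 0 ×ˢ 𝓟 (Icc (-S) S)] fun q => q.1) :
    (fun q : ℝ × ℝ => (∫ s in (0 : ℝ)..q.2, P q.1 s * F (E q.1 s)) - (∫ s in (0 : ℝ)..q.2, F (E₀ s))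
      - q.1 * ∫ s in (0 : ℝ)..q.2, (p₁ s * F (E₀ s) + F' (E₀ s) * e s))
      =o[𝓝 0 ×ˢ 𝓟 (Icc (-S) S)] fun q => q.1 := by
  set l : Filter (ℝ × ℝ) := 𝓝 0 ×ˢ 𝓟 (Icc (-S) S) with hl
  have hsub : Icc (-S) S ⊆ Ioo (-S') S' := fun s hs =>
    ⟨by linarith [hs.1], by linarith [hs.2]⟩
  have h0 : (0 : ℝ) ∈ Ioo (-S') S' := ⟨by linarith, by linarith⟩
  have hFc : Continuous F := continuous_iff_continuousAt.2 fun x => (hF x).continuousAt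
  have hF'c : Continuous F' := by
    have : LipschitzWith 1 F' := LipschitzWith.of_dist_le_mul fun x y => by
      simpa [Real.dist_eq] using hF' x y
    exact this.continuous
  have bigO : ∀ f : ℝ → ℝ, ContinuousOn f (Ioo (-S') S') →
      (fun q : ℝ × ℝ => f q.2) =O[l] fun _ => (1 : ℝ) := fun f hf =>
    isBigO_one_snd isCompact_Icc (hf.mono hsub)
  have hid : (fun q : ℝ × ℝ => q.1) =O[l] fun q => q.1 := isBigO_refl _ _
  have hfst : Tendsto (fun q : ℝ × ℝ => q.1) l (𝓝 0) := tendsto_fst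
  have hte : (fun q : ℝ × ℝ => q.1 * e q.2) =O[l] fun q => q.1 :=
    (hid.mul (bigO e he)).congr_right fun q => mul_one q.1
  have hδ : (fun q : ℝ × ℝ => E q.1 q.2 - E₀ q.2) =O[l] fun q => q.1 :=
    (hE.isBigO.add hte).congr_left fun q => by ring
  have hδ0 : Tendsto (fun q : ℝ × ℝ => E q.1 q.2 - E₀ q.2) l (𝓝 0) := hδ.trans_tendsto hfst
  -- expansion of `F (E)`
  have hFE : (fun q : ℝ × ℝ => F (E q.1 q.2) - F (E₀ q.2) - F' (E₀ q.2) * (q.1 * e q.2))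
      =o[l] fun q => q.1 := by
    have h1 : (fun q : ℝ × ℝ => F (E q.1 q.2) - F (E₀ q.2) - F' (E₀ q.2) * (E q.1 q.2 - E₀ q.2))
        =o[l] fun q => q.1 := by
      have h2 : (fun q : ℝ × ℝ => (E q.1 q.2 - E₀ q.2) * (E q.1 q.2 - E₀ q.2)) =o[l]
          fun q => 1 * q.1 := ((isLittleO_one_iff ℝ).2 hδ0).mul_isBigO hδ
      refine IsBigO.trans_isLittleO (IsBigO.of_bound 1 (Eventually.of_forall fun q => ?_))
        (h2.congr_right fun q => one_mul _)
      have := abs_taylor_le hF hF' (E₀ q.2) (E q.1 q.2 - E₀ q.2)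
      rw [add_sub_cancel] at this
      simpa using this
    have h3 := ((bigO (fun s => F' (E₀ s)) (hF'c.comp_continuousOn hE₀c)).mul_isLittleO
      hE).congr_right fun q => one_mul q.1
    exact (h1.add h3).congr_left fun q => by ring
  have hFE0 : Tendsto (fun q : ℝ × ℝ => F (E q.1 q.2) - F (E₀ q.2)) l (𝓝 0) := by
    have h4 : (fun q : ℝ × ℝ => F' (E₀ q.2) * (q.1 * e q.2)) =O[l] fun q => q.1 :=
      ((bigO (fun s => F' (E₀ s)) (hF'c.comp_continuousOn hE₀c)).mul hte).congr_right
        fun q => one_mul q.1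
    exact ((hFE.isBigO.add h4).congr_left fun q => by ring).trans_tendsto hfst
  -- expansion of the integrand
  have hint : (fun q : ℝ × ℝ => P q.1 q.2 * F (E q.1 q.2) - F (E₀ q.2)
      - q.1 * (p₁ q.2 * F (E₀ q.2) + F' (E₀ q.2) * e q.2)) =o[l] fun q => q.1 := by
    have h1 := (hP.mul_isBigO (IsBigO.of_bound 1 (Eventually.of_forall fun q : ℝ × ℝ => by
      simpa using hF1 (E q.1 q.2)) : (fun q : ℝ × ℝ => F (E q.1 q.2)) =O[l]
        fun _ => (1 : ℝ))).congr_right fun q => mul_one q.1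
    have h2 := ((hid.mul (bigO p₁ hp₁)).mul_isLittleO ((isLittleO_one_iff ℝ).2 hFE0)).congr_right
      (g₂ := fun q => q.1) fun q => by ring
    exact ((h1.add h2).add hFE).congr_left fun q => by ring
  refine isLittleO_of_hasDerivAt hS.le
    (f := fun τ s => (∫ s in (0 : ℝ)..s, P τ s * F (E τ s)) - (∫ s in (0 : ℝ)..s, F (E₀ s))
      - τ * ∫ s in (0 : ℝ)..s, (p₁ s * F (E₀ s) + F' (E₀ s) * e s))
    (f' := fun τ s => P τ s * F (E τ s) - F (E₀ s) - τ * (p₁ s * F (E₀ s) + F' (E₀ s) * e s))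
    (g := fun τ => τ) ?_ hint ?_
  · filter_upwards [hPc, hEc] with τ hPτ hEτ s hs
    exact ((hasDerivAt_integral_Ioo (hPτ.mul (hFc.comp_continuousOn hEτ)) h0 (hsub hs)).sub
      (hasDerivAt_integral_Ioo (hFc.comp_continuousOn hE₀c) h0 (hsub hs))).sub
      ((hasDerivAt_integral_Ioo ((hp₁.mul (hFc.comp_continuousOn hE₀c)).add
        ((hF'c.comp_continuousOn hE₀c).mul he)) h0 (hsub hs)).const_mul τ)
  · simp only [intervalIntegral.integral_same, mul_zero, sub_zero]
    exact isLittleO_zero _ _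

/-- A uniform first-order expansion gives derivatives with respect to the parameter. -/
lemma hasDerivAt_of_isLittleO_expansion {S : ℝ} {G : ℝ → ℝ → ℝ} {G₀ G₁ : ℝ → ℝ}
    (h : (fun q : ℝ × ℝ => G q.1 q.2 - G₀ q.2 - q.1 * G₁ q.2) =o[𝓝 0 ×ˢ 𝓟 (Icc (-S) S)]
      fun q => q.1) {s : ℝ} (hs : s ∈ Icc (-S) S) (h0 : G 0 s = G₀ s) :
    HasDerivAt (fun τ => G τ s) (G₁ s) 0 := by
  have hat : Tendsto (fun τ : ℝ => (τ, s)) (𝓝 0) (𝓝 0 ×ˢ 𝓟 (Icc (-S) S)) :=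
    tendsto_id.prodMk (tendsto_principal.2 (Eventually.of_forall fun _ => hs))
  rw [hasDerivAt_iff_isLittleO]
  refine (h.comp_tendsto hat).congr (fun τ => ?_) fun τ => ?_
  · simp only [Function.comp, h0, sub_zero, smul_eq_mul]
  · simp

/-- A curve of unit vectors `n` that rotates with angular speed `Q`. -/
lemma eq_rotation_of_hasDerivAt {n : ℝ → Plane} {Q : ℝ → ℝ} {S : ℝ}
    (hn : ∀ s ∈ Ioo (-S) S, HasDerivAt n (Q s • perp (n s)) s) {E : ℝ → ℝ} (hE0 : E 0 = 0)
    (hE : ∀ s ∈ Ioo (-S) S, HasDerivAt E (Q s) s) {s : ℝ} (hs : s ∈ Ioo (-S) S) :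
    n s = Real.cos (E s) • n 0 + Real.sin (E s) • perp (n 0) := by
  have hZ : ∀ s ∈ Ioo (-S) S,
      HasDerivAt (fun s => Real.cos (E s) • n s - Real.sin (E s) • perp (n s)) 0 s := by
    intro s hs
    refine (((hE s hs).cos.smul (hn s hs)).sub ((hE s hs).sin.smul (hn s hs).perp)).congr_deriv ?_
    rw [perp_smul, perp_perp]
    module
  have h := eq_zero_value_of_hasDerivAt_zero hZ hs
  simp only [hE0, Real.cos_zero, Real.sin_zero, one_smul, zero_smul, sub_zero] at h
  rw [← h, perp_sub, perp_smul, perp_smul, perp_perp]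
  have := Real.sin_sq_add_cos_sq (E s)
  have e : Real.cos (E s) • (Real.cos (E s) • n s - Real.sin (E s) • perp (n s)) +
      Real.sin (E s) • (Real.cos (E s) • perp (n s) - Real.sin (E s) • -n s)
      = (Real.sin (E s) ^ 2 + Real.cos (E s) ^ 2) • n s := by module
  rw [e, this, one_smul]

/-- The Jacobi equation. Let `x τ` be curves with normals `n τ` such that, in a parameter in which
the separation of `x τ` from `x 0` is normal to `x 0`, the speed and the rate of rotation of the
normal depend differentiably on `τ` at `τ = 0`. Then the separation `v` is twice differentiable.
It is not assumed that the initial normals `n τ 0` are differentiable in `τ`: this follows by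
solving the first-order expansion of `x τ s - x τ 0`, for one small `s`, for the initial normal. -/
lemma exists_hasDerivAt_separation {S S' : ℝ} (hS : 0 < S) (hSS' : S < S')
    {x n : ℝ → ℝ → Plane} {P Q : ℝ → ℝ → ℝ} {v η k : ℝ → ℝ}
    (hx : ∀ᶠ τ in 𝓝 (0 : ℝ), ∀ s ∈ Ioo (-S') S', HasDerivAt (x τ) (P τ s • perp (n τ s)) s)
    (hn : ∀ᶠ τ in 𝓝 (0 : ℝ), ∀ s ∈ Ioo (-S') S', HasDerivAt (n τ) (Q τ s • perp (n τ s)) s)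
    (hPc : ∀ᶠ τ in 𝓝 (0 : ℝ), ContinuousOn (P τ) (Ioo (-S') S'))
    (hQc : ∀ᶠ τ in 𝓝 (0 : ℝ), ContinuousOn (Q τ) (Ioo (-S') S'))
    (hunit : ∀ᶠ τ in 𝓝 (0 : ℝ), ‖n τ 0‖ = 1)
    (hP0 : ∀ s ∈ Ioo (-S') S', P 0 s = 1) (hQ0 : ∀ s ∈ Ioo (-S') S', Q 0 s = η s)
    (hv : ContinuousOn v (Ioo (-S') S')) (hη : ContinuousOn η (Ioo (-S') S'))
    (hk : ContinuousOn k (Ioo (-S') S'))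
    (hP : (fun q : ℝ × ℝ => P q.1 q.2 - 1 - q.1 * (η q.2 * v q.2))
      =o[𝓝 0 ×ˢ 𝓟 (Icc (-S) S)] fun q => q.1)
    (hQ : (fun q : ℝ × ℝ => Q q.1 q.2 - η q.2 - q.1 * (k q.2 * v q.2))
      =o[𝓝 0 ×ˢ 𝓟 (Icc (-S) S)] fun q => q.1)
    (hxτ : ∀ s ∈ Icc (-S) S, HasDerivAt (fun τ => x τ s) (v s • n 0 s) 0) :
    ∃ w : ℝ → ℝ, ∀ s ∈ Ioo (-S) S,
      HasDerivAt v (w s) s ∧ HasDerivAt w (-(k s * v s)) s := by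
  have hsub : Icc (-S) S ⊆ Ioo (-S') S' := fun s hs =>
    ⟨by linarith [hs.1], by linarith [hs.2]⟩
  have h0' : (0 : ℝ) ∈ Ioo (-S') S' := ⟨by linarith, by linarith⟩
  have h0 : (0 : ℝ) ∈ Icc (-S) S := ⟨by linarith, hS.le⟩
  set E : ℝ → ℝ → ℝ := fun τ s => ∫ r in (0 : ℝ)..s, Q τ r with hEdef
  set e : ℝ → ℝ := fun s => ∫ r in (0 : ℝ)..s, k r * v r with hedef
  have hE00 : ∀ τ, E τ 0 = 0 := fun τ => by simp [hEdef]
  have hEder : ∀ᶠ τ in 𝓝 (0 : ℝ), ∀ s ∈ Ioo (-S') S', HasDerivAt (E τ) (Q τ s) s := by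
    filter_upwards [hQc] with τ hτ s hs
    exact hasDerivAt_integral_Ioo hτ h0' hs
  have heder : ∀ s ∈ Ioo (-S') S', HasDerivAt e (k s * v s) s := fun s hs =>
    hasDerivAt_integral_Ioo (hk.mul hv) h0' hs
  have hEc : ∀ᶠ τ in 𝓝 (0 : ℝ), ContinuousOn (E τ) (Ioo (-S') S') := by
    filter_upwards [hEder] with τ hτ s hs
    exact (hτ s hs).continuousAt.continuousWithinAt
  have hec : ContinuousOn e (Ioo (-S') S') := fun s hs =>
    (heder s hs).continuousAt.continuousWithinAt
  have hE0c : ContinuousOn (E 0) (Ioo (-S') S') := hEc.self_of_nhds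
  have hE0der : ∀ s ∈ Ioo (-S') S', HasDerivAt (E 0) (η s) s := fun s hs => by
    rw [← hQ0 s hs]; exact hEder.self_of_nhds s hs
  have hEexp : (fun q : ℝ × ℝ => E q.1 q.2 - E 0 q.2 - q.1 * e q.2)
      =o[𝓝 0 ×ˢ 𝓟 (Icc (-S) S)] fun q => q.1 := by
    refine isLittleO_of_hasDerivAt hS.le (f := fun τ s => E τ s - E 0 s - τ * e s)
      (f' := fun τ s => Q τ s - η s - τ * (k s * v s)) (g := fun τ => τ) ?_ hQ ?_
    · filter_upwards [hEder] with τ hτ s hs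
      exact ((hτ s (hsub hs)).sub (hE0der s (hsub hs))).sub ((heder s (hsub hs)).const_mul τ)
    · simp only [hE00, hedef, intervalIntegral.integral_same, mul_zero, sub_zero]
      exact isLittleO_zero _ _
  have hlipc : ∀ x y : ℝ, |Real.cos x - Real.cos y| ≤ |x - y| := fun x y =>
    Real.abs_cos_sub_cos_le x y
  have hlips : ∀ x y : ℝ, |-Real.sin x - -Real.sin y| ≤ |x - y| := fun x y => by
    have := Real.abs_sin_sub_sin_le x y
    rwa [neg_sub_neg, abs_sub_comm]
  have hp₁ : ContinuousOn (fun s => η s * v s) (Ioo (-S') S') := hη.mul hv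
  have hCexp := isLittleO_integral_mul_comp hS hSS' (F := Real.cos) (F' := fun x => -Real.sin x)
    Real.hasDerivAt_cos hlips Real.abs_cos_le_one
    hPc hEc hE0c hp₁ hec hP hEexp
  have hSexp := isLittleO_integral_mul_comp hS hSS' (F := Real.sin) (F' := fun x => Real.cos x)
    Real.hasDerivAt_sin hlipc Real.abs_sin_le_one
    hPc hEc hE0c hp₁ hec hP hEexp
  set C : ℝ → ℝ → ℝ := fun τ s => ∫ r in (0 : ℝ)..s, P τ r * Real.cos (E τ r) with hC
  set Z : ℝ → ℝ → ℝ := fun τ s => ∫ r in (0 : ℝ)..s, P τ r * Real.sin (E τ r) with hZ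
  set C₁ : ℝ → ℝ := fun s => ∫ r in (0 : ℝ)..s,
    (η r * v r * Real.cos (E 0 r) + -Real.sin (E 0 r) * e r) with hC₁
  set Z₁ : ℝ → ℝ := fun s => ∫ r in (0 : ℝ)..s,
    (η r * v r * Real.sin (E 0 r) + Real.cos (E 0 r) * e r) with hZ₁
  have hcos0 : ContinuousOn (fun s => Real.cos (E 0 s)) (Ioo (-S') S') :=
    Real.continuous_cos.comp_continuousOn hE0c
  have hsin0 : ContinuousOn (fun s => Real.sin (E 0 s)) (Ioo (-S') S') :=
    Real.continuous_sin.comp_continuousOn hE0c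
  have hP0int : ∀ (f : ℝ → ℝ), ∀ s ∈ Ioo (-S') S',
      ∫ r in (0 : ℝ)..s, P 0 r * f r = ∫ r in (0 : ℝ)..s, f r := fun f s hs =>
    intervalIntegral.integral_congr fun r hr => by
      rw [hP0 r (ordConnected_Ioo.uIcc_subset h0' hs hr), one_mul]
  have hCτ : ∀ s ∈ Icc (-S) S, HasDerivAt (fun τ => C τ s) (C₁ s) 0 := fun s hs =>
    hasDerivAt_of_isLittleO_expansion (G := C)
      (G₀ := fun s => ∫ r in (0 : ℝ)..s, Real.cos (E 0 r)) hCexp hs (hP0int _ s (hsub hs))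
  have hZτ : ∀ s ∈ Icc (-S) S, HasDerivAt (fun τ => Z τ s) (Z₁ s) 0 := fun s hs =>
    hasDerivAt_of_isLittleO_expansion (G := Z)
      (G₀ := fun s => ∫ r in (0 : ℝ)..s, Real.sin (E 0 r)) hSexp hs (hP0int _ s (hsub hs))
  have hC0s : ∀ s ∈ Ioo (-S') S', HasDerivAt (C 0) (Real.cos (E 0 s)) s := fun s hs => by
    have := hasDerivAt_integral_Ioo (hPc.self_of_nhds.mul hcos0) h0' hs
    exact this.congr_deriv (by simp [hP0 s hs])
  have hZ0s : ∀ s ∈ Ioo (-S') S', HasDerivAt (Z 0) (Real.sin (E 0 s)) s := fun s hs => by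
    have := hasDerivAt_integral_Ioo (hPc.self_of_nhds.mul hsin0) h0' hs
    exact this.congr_deriv (by simp [hP0 s hs])
  have hC₁s : ∀ s ∈ Ioo (-S') S', HasDerivAt C₁
      (η s * v s * Real.cos (E 0 s) + -Real.sin (E 0 s) * e s) s := fun s hs =>
    hasDerivAt_integral_Ioo ((hp₁.mul hcos0).add (hsin0.neg.mul hec)) h0' hs
  have hZ₁s : ∀ s ∈ Ioo (-S') S', HasDerivAt Z₁
      (η s * v s * Real.sin (E 0 s) + Real.cos (E 0 s) * e s) s := fun s hs =>
    hasDerivAt_integral_Ioo ((hp₁.mul hsin0).add (hcos0.mul hec)) h0' hs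
  -- The displacement along `x τ` in terms of the initial normal.
  have hform : ∀ᶠ τ in 𝓝 (0 : ℝ), ∀ s ∈ Ioo (-S') S',
      x τ s - x τ 0 = C τ s • perp (n τ 0) - Z τ s • n τ 0 := by
    filter_upwards [hx, hn, hPc, hEder, hEc] with τ hxτ hnτ hPτ hEτ hEcτ s hs
    have hrot : ∀ s ∈ Ioo (-S') S', perp (n τ s)
        = Real.cos (E τ s) • perp (n τ 0) - Real.sin (E τ s) • n τ 0 := fun s hs => by
      rw [eq_rotation_of_hasDerivAt hnτ (hE00 τ) hEτ hs, perp_add, perp_smul, perp_smul, perp_perp,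
        smul_neg, sub_eq_add_neg]
    have := eq_zero_value_of_hasDerivAt_zero
      (f := fun s => x τ s - (C τ s • perp (n τ 0) - Z τ s • n τ 0)) (S := S') (fun s hs => by
        have d1 := hasDerivAt_integral_Ioo
          (hPτ.mul (Real.continuous_cos.comp_continuousOn hEcτ)) h0' hs
        have d2 := hasDerivAt_integral_Ioo
          (hPτ.mul (Real.continuous_sin.comp_continuousOn hEcτ)) h0' hs
        refine ((hxτ s hs).sub ((d1.smul_const (perp (n τ 0))).sub
          (d2.smul_const (n τ 0)))).congr_deriv ?_
        rw [hrot s hs]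
        simp only [Pi.mul_apply, Function.comp_apply]
        module) hs
    simp only [hC, hZ, intervalIntegral.integral_same, zero_smul, sub_zero] at this ⊢
    rw [← this]
    abel
  -- A parameter value at which the displacement determines the initial normal.
  obtain ⟨s₁, hs₁, hCs₁⟩ : ∃ s₁ ∈ Icc (-S) S, 0 < C 0 s₁ := by
    have hder := hC0s 0 h0'
    rw [hE00, Real.cos_zero] at hder
    have h1 := hder.tendsto_slope_zero_right.eventually_const_lt (zero_lt_one)
    have h2 : ∀ᶠ t in 𝓝[>] (0 : ℝ), t ∈ Ioo 0 S := Ioo_mem_nhdsGT hS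
    obtain ⟨t, ht, ht'⟩ := (h1.and h2).exists
    refine ⟨t, ⟨by linarith [ht'.1], ht'.2.le⟩, ?_⟩
    have hC00 : C 0 0 = 0 := by simp [hC]
    simp only [zero_add, hC00, sub_zero, smul_eq_mul] at ht
    exact (pos_iff_pos_of_mul_pos ht).1 (inv_pos.2 ht'.1)
  have hsolve : ∀ᶠ τ in 𝓝 (0 : ℝ), perp (n τ 0) = (C τ s₁ ^ 2 + Z τ s₁ ^ 2)⁻¹ •
      (C τ s₁ • (x τ s₁ - x τ 0) - Z τ s₁ • perp (x τ s₁ - x τ 0)) := by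
    have hne : ∀ᶠ τ in 𝓝 (0 : ℝ), 0 < C τ s₁ :=
      (hCτ s₁ hs₁).continuousAt.eventually_const_lt hCs₁
    filter_upwards [hform, hne] with τ hτ hpos
    have hd : C τ s₁ ^ 2 + Z τ s₁ ^ 2 ≠ 0 := by positivity
    rw [hτ s₁ (hsub hs₁), perp_sub, perp_smul, perp_smul, perp_perp]
    rw [eq_inv_smul_iff₀ hd]
    module
  obtain ⟨m, hm⟩ : ∃ m, HasDerivAt (fun τ => perp (n τ 0)) m 0 := by
    have hX := (hxτ s₁ hs₁).sub (hxτ 0 h0)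
    have hd : C 0 s₁ ^ 2 + Z 0 s₁ ^ 2 ≠ 0 := by positivity
    have := ((((hCτ s₁ hs₁).pow 2).add ((hZτ s₁ hs₁).pow 2)).inv hd).smul
      (((hCτ s₁ hs₁).smul hX).sub ((hZτ s₁ hs₁).smul hX.perp))
    exact ⟨_, this.congr_of_eventuallyEq hsolve⟩
  have hn00 : ‖n 0 0‖ = 1 := hunit.self_of_nhds
  obtain ⟨θ, hθ⟩ : ∃ θ : ℝ, m = θ • n 0 0 := by
    have h1 := hm.inner ℝ hm
    have h2 : (fun τ => (inner ℝ (perp (n τ 0)) (perp (n τ 0)) : ℝ)) =ᶠ[𝓝 0] fun _ => 1 := by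
      filter_upwards [hunit] with τ hτ
      rw [real_inner_self_eq_norm_sq, norm_perp, hτ, one_pow]
    have h3 := h1.unique ((hasDerivAt_const (0 : ℝ) (1 : ℝ)).congr_of_eventuallyEq h2)
    have h4 : inner ℝ (perp (n 0 0)) m = 0 := by
      rw [real_inner_comm (perp (n 0 0)) m] at h3; linarith
    refine ⟨inner ℝ (n 0 0) m, ?_⟩
    conv_lhs => rw [eq_inner_smul_add_inner_perp_smul hn00 m, h4]
    simp
  have hn0τ : HasDerivAt (fun τ => n τ 0) (-(θ • perp (n 0 0))) 0 := by
    have := hm.perp.neg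
    rw [hθ, perp_smul] at this
    refine this.congr_of_eventuallyEq (Eventually.of_forall fun τ => ?_)
    simp [perp_perp]
  -- Both ways of differentiating the displacement in `τ`.
  have hdisp : ∀ s ∈ Icc (-S) S, v s • n 0 s =
      (v 0 + C 0 s * θ - Z₁ s) • n 0 0 + (C₁ s + Z 0 s * θ) • perp (n 0 0) := by
    intro s hs
    have h1 := (hxτ s hs).sub (hxτ 0 h0)
    have h2 := ((hCτ s hs).smul hm).sub ((hZτ s hs).smul hn0τ)
    have h3 := h1.unique (h2.congr_of_eventuallyEq
      (hform.mono fun τ hτ => hτ s (hsub hs)))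
    rw [hθ] at h3
    have h4 : v s • n 0 s = v 0 • n 0 0 + (C 0 s • θ • n 0 0 + C₁ s • perp (n 0 0) -
        (Z 0 s • -(θ • perp (n 0 0)) + Z₁ s • n 0 0)) := by
      rw [← h3]; abel
    rw [h4]
    module
  have hn0s : ∀ s ∈ Icc (-S) S, n 0 s = Real.cos (E 0 s) • n 0 0
      + Real.sin (E 0 s) • perp (n 0 0) := fun s hs =>
    eq_rotation_of_hasDerivAt hn.self_of_nhds (hE00 0) hEder.self_of_nhds (hsub hs)
  have hcoord : ∀ s ∈ Icc (-S) S, v s * Real.cos (E 0 s) = v 0 + C 0 s * θ - Z₁ s ∧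
      v s * Real.sin (E 0 s) = C₁ s + Z 0 s * θ := by
    intro s hs
    have h1 := hdisp s hs
    rw [hn0s s hs] at h1
    have hself : (inner ℝ (n 0 0) (n 0 0) : ℝ) = 1 := by
      rw [real_inner_self_eq_norm_sq, hn00, one_pow]
    have hself' : (inner ℝ (perp (n 0 0)) (perp (n 0 0)) : ℝ) = 1 := by
      rw [inner_perp_perp, hself]
    constructor
    · have := congrArg (fun z => (inner ℝ (n 0 0) z : ℝ)) h1
      simpa [inner_add_right, inner_smul_right, hself, inner_self_perp, -inner_self_eq_norm_sq_to_K]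
        using this
    · have := congrArg (fun z => (inner ℝ (perp (n 0 0)) z : ℝ)) h1
      simpa [inner_add_right, inner_smul_right, hself', inner_perp_self,
        -inner_self_eq_norm_sq_to_K] using this
  refine ⟨fun s => θ - e s, fun s hs => ⟨?_, ?_⟩⟩
  · have hs' := Ioo_subset_Icc_self hs
    have hs'' := hsub hs'
    obtain ⟨hc1, hc2⟩ := hcoord s hs'
    have hder := ((hE0der s hs'').cos.mul (((hasDerivAt_const s (v 0)).add
      ((hC0s s hs'').mul_const θ)).sub (hZ₁s s hs''))).add
      ((hE0der s hs'').sin.mul ((hC₁s s hs'').add ((hZ0s s hs'').mul_const θ)))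
    refine (hder.congr_of_eventuallyEq ?_).congr_deriv ?_
    · filter_upwards [isOpen_Ioo.mem_nhds hs] with r hr
      obtain ⟨h1, h2⟩ := hcoord r (Ioo_subset_Icc_self hr)
      simp only [Pi.add_apply, Pi.mul_apply, Pi.sub_apply]
      rw [← h1, ← h2]
      linear_combination (-v r) * Real.sin_sq_add_cos_sq (E 0 r)
    · simp only [Pi.add_apply, Pi.sub_apply]
      rw [← hc1, ← hc2]
      linear_combination (θ - e s) * Real.sin_sq_add_cos_sq (E 0 s)
  · have := (heder s (hsub (Ioo_subset_Icc_self hs))).const_sub θ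
    exact this

end

/-! ### The variation of a characteristic curve -/

section

lemma max_neg_min_mem_Icc {a : ℝ} (ha : 0 ≤ a) (x : ℝ) : max (-a) (min a x) ∈ Icc (-a) a :=
  ⟨le_max_left _ _, max_le (by linarith) (min_le_left _ _)⟩

lemma max_neg_min_of_mem_Icc {a x : ℝ} (hx : x ∈ Icc (-a) a) : max (-a) (min a x) = x := by
  rw [min_eq_right hx.2, max_eq_right hx.1]

namespace IsLocalSolution

variable {q : Plane} {R : ℝ} {N : Plane → Plane} {D c H : Plane → ℝ} {m K : ℝ}

/-- The flow `W` of `N / D`, started on an integral curve `Γ` of `N^⊥`, and a continuous map `Y` on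
the whole plane of parameters that agrees with it on a box. -/
lemma exists_flow_box (h : IsLocalSolution q R N D c H m K) {T : ℝ} (hT : 0 < T)
    (hflow : ∀ x ∈ ball q (R / 2), ∃ γ : ℝ → Plane, γ 0 = x ∧ ∀ t ∈ Ioo (-T) T,
      γ t ∈ ball q R ∧ HasDerivAt γ ((D (γ t))⁻¹ • N (γ t)) t)
    {Γ : ℝ → Plane} {S : ℝ} (hS : 0 < S)
    (hΓ : ∀ s ∈ Icc (-S) S, ContinuousAt Γ s ∧ Γ s ∈ ball q (R / 4)) :
    ∃ T₁, 0 < T₁ ∧ ∃ W Y : ℝ → ℝ → Plane, Continuous (fun p : ℝ × ℝ => Y p.1 p.2) ∧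
      (∀ s t, Y s t ∈ closedBall q R) ∧
      ∀ s ∈ Icc (-S) S, W s 0 = Γ s ∧ ∀ t ∈ Icc (-T₁) T₁, Y s t = W s t ∧
        W s t ∈ ball q (R / 2) ∧ HasDerivAt (W s) ((D (W s t))⁻¹ • N (W s t)) t := by
  have hR := h.R_pos
  obtain ⟨L, hL1, hL⟩ := h.exists_bound_M
  have hL0 : 0 < L := by linarith
  obtain ⟨C, hC, hstab⟩ := h.frame.stability hL0 T
  have hMc' := h.contM.mono ball_subset_closedBall
  have hex : ∀ s ∈ Icc (-S) S, ∃ γ : ℝ → Plane, γ 0 = Γ s ∧ ∀ t ∈ Ioo (-T) T,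
      γ t ∈ ball q R ∧ HasDerivAt γ ((D (γ t))⁻¹ • N (γ t)) t := fun s hs =>
    hflow _ (ball_subset_ball (by linarith) (hΓ s hs).2)
  choose! W hW0 hW using hex
  set T₁ := min (T / 2) (R / (8 * L)) with hT₁def
  have hT₁ : 0 < T₁ := by positivity
  have hT₁T : T₁ < T := (min_le_left _ _).trans_lt (by linarith)
  have hT₁R : L * T₁ ≤ R / 8 := by
    calc L * T₁ ≤ L * (R / (8 * L)) := by gcongr; exact min_le_right _ _
      _ = R / 8 := by field_simp
  have hsub : ∀ t ∈ Icc (-T₁) T₁, t ∈ Ioo (-T) T := fun t ht =>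
    ⟨by linarith [ht.1], by linarith [ht.2]⟩
  have h0T : (0 : ℝ) ∈ Icc (-T₁) T₁ := ⟨by linarith, hT₁.le⟩
  have hWc : ∀ s ∈ Icc (-S) S, ContinuousOn (W s) (Ioo (-T) T) := fun s hs t ht =>
    (hW s hs t ht).2.continuousAt.continuousWithinAt
  have hmem : ∀ s ∈ Icc (-S) S, ∀ t ∈ Icc (-T₁) T₁, W s t ∈ ball q (R / 2) := by
    intro s hs t ht
    have hmv := (convex_Icc (-T₁) T₁).norm_image_sub_le_of_norm_hasDerivWithin_le (C := L)
      (fun r hr => (hW s hs r (hsub r hr)).2.hasDerivWithinAt)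
      (fun r hr => hL _ (ball_subset_closedBall (hW s hs r (hsub r hr)).1)) h0T ht
    rw [hW0 s hs, sub_zero] at hmv
    have ht' : ‖t‖ ≤ T₁ := abs_le.2 ht
    have h1 : ‖W s t - Γ s‖ ≤ R / 8 :=
      hmv.trans ((mul_le_mul_of_nonneg_left ht' hL0.le).trans hT₁R)
    have h2 := mem_ball.1 (hΓ s hs).2
    rw [mem_ball]
    have h3 : dist (W s t) q ≤ ‖W s t - Γ s‖ + dist (Γ s) q := by
      rw [← dist_eq_norm]; exact dist_triangle _ _ _
    linarith
  have hdist : ∀ s₀ ∈ Icc (-S) S, ∀ s ∈ Icc (-S) S, ∀ t ∈ Icc (-T₁) T₁,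
      ‖W s t - W s₀ t‖ ≤ C * ‖Γ s - Γ s₀‖ := by
    intro s₀ hs₀ s hs t ht
    have := hstab (W s₀) (W s) (fun t => (D (W s₀ t))⁻¹ • N (W s₀ t))
      (fun t => (D (W s t))⁻¹ • N (W s t)) T 0 le_rfl (fun t ht => (hW s₀ hs₀ t ht).2)
      (fun t ht => (hW s hs t ht).2)
      (hMc'.comp (hWc s₀ hs₀) fun t ht => (hW s₀ hs₀ t ht).1)
      (hMc'.comp (hWc s hs) fun t ht => (hW s hs t ht).1)
      (fun t ht => (hW s₀ hs₀ t ht).1) (fun t ht => (hW s hs t ht).1)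
      (fun t ht => hL _ (ball_subset_closedBall (hW s₀ hs₀ t ht).1))
      (fun t ht => hL _ (ball_subset_closedBall (hW s hs t ht).1))
      (fun t ht => by
        rw [h.inner_A_M (ball_subset_closedBall (hW s₀ hs₀ t ht).1),
          h.inner_A_M (ball_subset_closedBall (hW s hs t ht).1)]; simp)
      (fun t ht => by rw [inner_B_M, inner_B_M]; simp) t (hsub t ht)
    rwa [hW0 s hs, hW0 s₀ hs₀, add_zero] at this
  have hcont : ContinuousOn (fun p : ℝ × ℝ => W p.1 p.2) (Icc (-S) S ×ˢ Icc (-T₁) T₁) := by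
    rintro ⟨s₀, t₀⟩ ⟨hs₀, ht₀⟩
    have h1 : ContinuousWithinAt (fun p : ℝ × ℝ => W s₀ p.2) (Icc (-S) S ×ˢ Icc (-T₁) T₁)
        (s₀, t₀) :=
      ((hW s₀ hs₀ t₀ (hsub t₀ ht₀)).2.continuousAt.comp
        (x := (s₀, t₀)) (f := fun p : ℝ × ℝ => p.2) continuous_snd.continuousAt).continuousWithinAt
    have h2 : Tendsto (fun p : ℝ × ℝ => C * ‖Γ p.1 - Γ s₀‖)
        (𝓝[Icc (-S) S ×ˢ Icc (-T₁) T₁] (s₀, t₀)) (𝓝 0) := by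
      have h3 : ContinuousAt (fun p : ℝ × ℝ => Γ p.1) (s₀, t₀) :=
        (hΓ s₀ hs₀).1.comp (x := (s₀, t₀)) (f := fun p : ℝ × ℝ => p.1) continuous_fst.continuousAt
      have h4 : ContinuousAt (fun p : ℝ × ℝ => C * ‖Γ p.1 - Γ s₀‖) (s₀, t₀) :=
        continuousAt_const.mul (h3.sub continuousAt_const).norm
      simpa using h4.tendsto.mono_left nhdsWithin_le_nhds
    have h5 : Tendsto (fun p : ℝ × ℝ => W p.1 p.2 - W s₀ p.2)
        (𝓝[Icc (-S) S ×ˢ Icc (-T₁) T₁] (s₀, t₀)) (𝓝 0) := by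
      refine squeeze_zero_norm' ?_ h2
      filter_upwards [self_mem_nhdsWithin] with p hp
      exact hdist s₀ hs₀ p.1 hp.1 p.2 hp.2
    have := h5.add h1.tendsto
    simpa [ContinuousWithinAt] using this
  refine ⟨T₁, hT₁, W, fun s t => W (max (-S) (min S s)) (max (-T₁) (min T₁ t)), ?_, ?_, ?_⟩
  · refine hcont.comp_continuous (f := fun p : ℝ × ℝ =>
      (max (-S) (min S p.1), max (-T₁) (min T₁ p.2))) (by fun_prop) fun p => ?_
    exact ⟨max_neg_min_mem_Icc hS.le _, max_neg_min_mem_Icc hT₁.le _⟩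
  · intro s t
    exact ball_subset_closedBall (ball_subset_ball (by linarith)
      (hmem _ (max_neg_min_mem_Icc hS.le _) _ (max_neg_min_mem_Icc hT₁.le _)))
  · intro s hs
    refine ⟨hW0 s hs, fun t ht => ⟨?_, hmem s hs t ht, (hW s hs t (hsub t ht)).2⟩⟩
    simp only [max_neg_min_of_mem_Icc hs, max_neg_min_of_mem_Icc ht]

/-- The Jacobi equation along an integral curve `Γ` of `N^⊥`. The separation `v` from `Γ` of nearby
integral curves of `N^⊥` satisfies `v'' = -(N(H) + H²) v` and `(D v)' = c v`; the curves are found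
inside the flow of `N / D` started on `Γ`. -/
lemma exists_jacobi_field (h : IsLocalSolution q R N D c H m K) {T : ℝ} (hT : 0 < T)
    (hflow : ∀ x ∈ ball q (R / 2), ∃ γ : ℝ → Plane, γ 0 = x ∧ ∀ t ∈ Ioo (-T) T,
      γ t ∈ ball q R ∧ HasDerivAt γ ((D (γ t))⁻¹ • N (γ t)) t)
    {H' : Plane → ℝ} (hH'c : ContinuousOn H' (closedBall q R))
    (hH' : ∀ (γ : ℝ → Plane) (t : ℝ),
      (∀ᶠ r in 𝓝 t, γ r ∈ ball q R ∧ HasDerivAt γ ((D (γ r))⁻¹ • N (γ r)) r) →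
      HasDerivAt (fun r => H (γ r)) ((D (γ t))⁻¹ * H' (γ t)) t)
    {Γ : ℝ → Plane} {S : ℝ} (hS : 0 < S)
    (hΓ : ∀ s ∈ Ioo (-S) S, HasDerivAt Γ (perp (N (Γ s))) s)
    (hΓR : ∀ s ∈ Ioo (-S) S, Γ s ∈ ball q (R / 4)) :
    ∃ δ, 0 < δ ∧ δ ≤ S ∧ ∃ v w : ℝ → ℝ, ∀ s ∈ Ioo (-δ) δ, 0 < v s ∧ HasDerivAt v (w s) s ∧
      HasDerivAt w (-((H' (Γ s) + H (Γ s) ^ 2) * v s)) s ∧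
      HasDerivAt (fun s => D (Γ s) * v s) (c (Γ s) * v s) s := by
  have hR := h.R_pos
  obtain ⟨T₁, hT₁, W, Y, hYc, hYR, hWY⟩ := h.exists_flow_box hT hflow (S := S / 2)
    (by positivity) fun s hs =>
      have hs' : s ∈ Ioo (-S) S := ⟨by linarith [hs.1], by linarith [hs.2]⟩
      ⟨(hΓ s hs').continuousAt, hΓR s hs'⟩
  have comp : ∀ {f : Plane → ℝ}, ContinuousOn f (closedBall q R) →
      Continuous fun p : ℝ × ℝ => f (Y p.1 p.2) := fun hf =>
    hf.comp_continuous hYc fun p => hYR _ _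
  have hDne : ∀ s t, D (Y s t) ≠ 0 := fun s t => (h.D_pos _ (hYR s t)).ne'
  have hHc := comp h.contH
  have hcc := comp h.contc
  have hH'c' := comp hH'c
  have hDc : Continuous fun p : ℝ × ℝ => (D (Y p.1 p.2))⁻¹ :=
    (comp h.contD).inv₀ fun p => hDne _ _
  have hfix : ∀ {f : ℝ → ℝ → ℝ}, Continuous (fun p : ℝ × ℝ => f p.1 p.2) →
      ∀ s, Continuous (f s) := fun hf s => hf.comp (by fun_prop : Continuous fun t : ℝ => (s, t))
  have hprim : ∀ {f : ℝ → ℝ → ℝ}, Continuous (fun p : ℝ × ℝ => f p.1 p.2) →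
      Continuous fun p : ℝ × ℝ => ∫ r in (0 : ℝ)..p.2, f p.1 r := by
    intro f hf
    exact intervalIntegral.continuous_parametric_intervalIntegral_of_continuous
      (f := fun (p : ℝ × ℝ) r => f p.1 r) (s := fun p : ℝ × ℝ => p.2)
      (hf.comp (by fun_prop : Continuous fun z : (ℝ × ℝ) × ℝ => (z.1.1, z.2))) continuous_snd
  have hprim' : ∀ {f : ℝ → ℝ → ℝ}, Continuous (fun p : ℝ × ℝ => f p.1 p.2) → ∀ s t,
      HasDerivAt (fun t => ∫ r in (0 : ℝ)..t, f s r) (f s t) t := fun hf s t =>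
    ((hfix hf s).integral_hasStrictDerivAt 0 t).hasDerivAt
  -- The speed `P` of the curves, and the derivative `κ` of the time shift.
  set g : ℝ → ℝ → ℝ := fun s t => H (Y s t) * (D (Y s t))⁻¹ with hg
  have hgc : Continuous fun p : ℝ × ℝ => g p.1 p.2 := hHc.mul hDc
  set P : ℝ → ℝ → ℝ := fun s t => Real.exp (∫ r in (0 : ℝ)..t, g s r) with hP
  have hPc : Continuous fun p : ℝ × ℝ => P p.1 p.2 := Real.continuous_exp.comp (hprim hgc)
  have hPd : ∀ s t, HasDerivAt (P s) (g s t * P s t) t := fun s t =>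
    ((hprim' hgc s t).exp).congr_deriv (mul_comm _ _)
  have hP0 : ∀ s, P s 0 = 1 := fun s => by simp [hP]
  set κ : ℝ → ℝ → ℝ := fun s t => c (Y s t) * (D (Y s t))⁻¹ * P s t with hκ
  have hκc : Continuous fun p : ℝ × ℝ => κ p.1 p.2 := (hcc.mul hDc).mul hPc
  obtain ⟨S₂, hS₂, hS₂S, Θ, C, hΘ⟩ := exists_scalar_flow hκc (by positivity : 0 < S / 2) hT₁
  have hsub2 : ∀ s ∈ Ioo (-S₂) S₂, s ∈ Icc (-(S / 2)) (S / 2) := fun s hs =>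
    ⟨by linarith [hs.1], by linarith [hs.2]⟩
  have hsub3 : ∀ s ∈ Icc (-(S / 2)) (S / 2), s ∈ Ioo (-S) S := fun s hs =>
    ⟨by linarith [hs.1], by linarith [hs.2]⟩
  have hτ : ∀ᶠ τ in 𝓝 (0 : ℝ), τ ∈ Icc (-(T₁ / 4)) (T₁ / 4) :=
    Icc_mem_nhds (by linarith) (by linarith)
  have h00 : (0 : ℝ) ∈ Icc (-(T₁ / 4)) (T₁ / 4) := ⟨by linarith, by linarith⟩
  have h0T : (0 : ℝ) ∈ Icc (-T₁) T₁ := ⟨by linarith, hT₁.le⟩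
  have hΘ0 : ∀ s ∈ Ioo (-S₂) S₂, Θ 0 s = 0 := fun s hs => by
    have := ((hΘ 0 h00).2 s hs).2.2
    simpa using this
  have hΘmem : ∀ τ ∈ Icc (-(T₁ / 4)) (T₁ / 4), ∀ s ∈ Ioo (-S₂) S₂, Θ τ s ∈ Ioo (-T₁) T₁ :=
    fun τ hτ s hs => abs_lt.1 ((hΘ τ hτ).2 s hs).2.1
  have hWat : ∀ s ∈ Icc (-(S / 2)) (S / 2), ∀ t ∈ Ioo (-T₁) T₁, Y s t = W s t ∧
      W s t ∈ ball q (R / 2) ∧ HasDerivAt (W s) ((D (W s t))⁻¹ • N (W s t)) t := fun s hs t ht =>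
    (hWY s hs).2 t (Ioo_subset_Icc_self ht)
  have hY0 : ∀ s ∈ Icc (-(S / 2)) (S / 2), Y s 0 = Γ s := fun s hs => by
    rw [((hWY s hs).2 0 h0T).1, (hWY s hs).1]
  -- The integral curves of `N^⊥` through the points `W 0 τ`.
  have hx : ∀ τ ∈ Icc (-(T₁ / 4)) (T₁ / 4), ∀ s ∈ Ioo (-S₂) S₂,
      HasDerivAt (fun s => W s (Θ τ s)) (P s (Θ τ s) • perp (N (W s (Θ τ s)))) s := by
    intro τ hτ s₀ hs₀
    have hs₀' := hsub2 s₀ hs₀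
    have hbox := (hΘ τ hτ).2 s₀ hs₀
    have hmem := hΘmem τ hτ s₀ hs₀
    have hΓ0 : HasDerivAt (fun s => W s 0) (perp (N (W s₀ 0))) s₀ := by
      rw [(hWY s₀ hs₀').1]
      refine (hΓ s₀ (hsub3 s₀ hs₀')).congr_of_eventuallyEq ?_
      filter_upwards [isOpen_Ioo.mem_nhds hs₀] with s hs
      exact (hWY s (hsub2 s hs)).1
    have htr := h.hasDerivAt_transversal_flow (T := T₁) (S := S₂) (W := W) hs₀
      (fun s hs t ht => ⟨ball_subset_ball (by linarith) (hWat s (hsub2 s hs) t ht).2.1,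
        (hWat s (hsub2 s hs) t ht).2.2⟩) hΓ0 (P := P s₀)
      (ρ := fun t => -∫ r in (0 : ℝ)..t, κ s₀ r) (hP0 s₀) (fun t _ => Real.exp_pos _)
      (fun t ht => (hPd s₀ t).congr_deriv (by rw [← (hWat s₀ hs₀' t ht).1])) (by simp)
      (fun t ht => (hprim' hκc s₀ t).neg.congr_deriv (by rw [← (hWat s₀ hs₀' t ht).1])) hmem
    have hcompD := hasDerivAt_comp_diagonal (W := W)
      (M := fun s t => (D (Y s t))⁻¹ • N (Y s t)) (T := Θ τ) htr (by
        filter_upwards [(isOpen_Ioo.prod isOpen_Ioo).mem_nhds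
          (⟨hs₀, hmem⟩ : (s₀, Θ τ s₀) ∈ Ioo (-S₂) S₂ ×ˢ Ioo (-T₁) T₁)] with p hp
        have := hWat p.1 (hsub2 _ hp.1) p.2 hp.2
        rw [this.1]
        exact this.2.2)
      ((h.contM.comp_continuous hYc fun p => hYR _ _).continuousAt) hbox.1
    refine hcompD.congr_deriv ?_
    rw [(hWat s₀ hs₀' _ hmem).1]
    module
  set n : ℝ → ℝ → Plane := fun τ s => N (W s (Θ τ s)) with hn
  have hΘcont : ∀ τ ∈ Icc (-(T₁ / 4)) (T₁ / 4), ContinuousOn (Θ τ) (Ioo (-S₂) S₂) :=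
    fun τ hτ s hs => ((hΘ τ hτ).2 s hs).1.continuousAt.continuousWithinAt
  have hcompc : ∀ {f : ℝ → ℝ → ℝ}, Continuous (fun p : ℝ × ℝ => f p.1 p.2) →
      ∀ τ ∈ Icc (-(T₁ / 4)) (T₁ / 4), ContinuousOn (fun s => f s (Θ τ s)) (Ioo (-S₂) S₂) :=
    fun hf τ hτ => hf.comp_continuousOn (continuousOn_id.prodMk (hΘcont τ hτ))
  have hnder : ∀ τ ∈ Icc (-(T₁ / 4)) (T₁ / 4), ∀ s ∈ Ioo (-S₂) S₂,
      HasDerivAt (n τ) ((H (Y s (Θ τ s)) * P s (Θ τ s)) • perp (n τ s)) s := by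
    intro τ hτ s hs
    have hu := hasDerivAt_unit_along h.frame.curlB h.contB
      (show ContinuousOn (fun x => -H x) _ from h.contH.neg)
      (fun x hx => by rw [norm_perp]; exact h.unit x (ball_subset_closedBall hx))
      (hx τ hτ) (hcompc hPc τ hτ) (fun s _ => (Real.exp_pos _).le)
      (fun s hs => (hWat s (hsub2 s hs) _ (hΘmem τ hτ s hs)).2.1) hs
    have := hu.perp.neg
    refine (this.congr_deriv ?_).congr_of_eventuallyEq
      (Eventually.of_forall fun r => ?_)
    · rw [(hWat s (hsub2 s hs) _ (hΘmem τ hτ s hs)).1]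
      simp only [perp_smul, perp_perp, perp_neg, hn]
      module
    · simp [hn, perp_perp]
  -- The first-order expansion of the time shift.
  set δ := S₂ / 2 with hδ
  have hδ0 : 0 < δ := by positivity
  have hδS : δ < S₂ := by linarith
  have hδsub : ∀ s ∈ Icc (-δ) δ, s ∈ Ioo (-S₂) S₂ := fun s hs =>
    ⟨by linarith [hs.1], by linarith [hs.2]⟩
  set l : Filter (ℝ × ℝ) := 𝓝 0 ×ˢ 𝓟 (Icc (-δ) δ) with hl
  have hΘO : (fun p : ℝ × ℝ => Θ p.1 p.2) =O[l] fun p => p.1 := by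
    refine IsBigO.of_bound C ?_
    rw [hl, eventually_prod_principal_iff]
    filter_upwards [hτ] with τ hτ s hs
    exact ((hΘ τ hτ).2 s (hδsub s hs)).2.2
  set V : ℝ → ℝ := fun s => Real.exp (∫ r in (0 : ℝ)..s, κ r 0) with hV
  have hκ0 : Continuous fun r => κ r 0 := hκc.comp (by fun_prop : Continuous fun r : ℝ => (r, (0:ℝ)))
  have hVd : ∀ s, HasDerivAt V (κ s 0 * V s) s := fun s =>
    ((hκ0.integral_hasStrictDerivAt 0 s).hasDerivAt.exp).congr_deriv (mul_comm _ _)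
  have hVpos : ∀ s, 0 < V s := fun s => Real.exp_pos _
  have hVc : Continuous V := continuous_iff_continuousAt.2 fun s => (hVd s).continuousAt
  have bigO : ∀ f : ℝ → ℝ, Continuous f →
      (fun p : ℝ × ℝ => f p.2) =O[l] fun _ => (1 : ℝ) := fun f hf =>
    isBigO_one_snd isCompact_Icc hf.continuousOn
  have hΘo : (fun p : ℝ × ℝ => Θ p.1 p.2 - p.1 * V p.2) =o[l] fun p => p.1 := by
    have hexp := isLittleO_expansion (G := fun s t => ∫ r in (0 : ℝ)..t, κ s r) (G' := κ) hT₁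
      (fun s _ t _ => hprim' hκc s t) hκc hΘO
    have h1 : (fun p : ℝ × ℝ => Θ p.1 p.2 * (V p.2)⁻¹ - p.1) =o[l] fun p => p.1 := by
      refine isLittleO_of_hasDerivAt hδ0.le (f := fun τ s => Θ τ s * (V s)⁻¹ - τ)
        (f' := fun τ s => ((∫ r in (0 : ℝ)..Θ τ s, κ s r) - (∫ r in (0 : ℝ)..0, κ s r)
          - κ s 0 * Θ τ s) * (V s)⁻¹) (g := fun τ => τ) ?_ ?_ ?_
      · filter_upwards [hτ] with τ hτ s hs
        refine ((((hΘ τ hτ).2 s (hδsub s hs)).1.mul ((hVd s).inv (hVpos s).ne')).sub_const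
          _).congr_deriv ?_
        have := (hVpos s).ne'
        simp only [intervalIntegral.integral_same, sub_zero, Pi.inv_apply]
        field_simp
        ring
      · exact (hexp.mul_isBigO (bigO (fun s => (V s)⁻¹)
          (hVc.inv₀ fun s => (hVpos s).ne'))).congr_right fun p => mul_one _
      · refine (isLittleO_zero _ _).congr' ?_ EventuallyEq.rfl
        filter_upwards [hτ] with τ hτ
        simp [(hΘ τ hτ).1, hV]
    refine (h1.mul_isBigO (bigO V hVc)).congr (fun p => ?_) fun p => mul_one _
    have := (hVpos p.2).ne'
    field_simp
  have hexpand : ∀ {G G' : ℝ → ℝ → ℝ}, Continuous (fun p : ℝ × ℝ => G' p.1 p.2) →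
      (∀ s ∈ Icc (-δ) δ, ∀ t ∈ Ioo (-T₁) T₁, HasDerivAt (G s) (G' s t) t) →
      (fun p : ℝ × ℝ => G p.2 (Θ p.1 p.2) - G p.2 0 - p.1 * (G' p.2 0 * V p.2)) =o[l]
        fun p => p.1 := by
    intro G G' hG'c hG
    have h1 := isLittleO_expansion hT₁ hG hG'c hΘO
    have h2 := ((bigO (fun s => G' s 0)
      (hG'c.comp (by fun_prop : Continuous fun s : ℝ => (s, (0:ℝ))))).mul_isLittleO
      hΘo).congr_right fun p => one_mul _
    exact (h1.add h2).congr_left fun p => by ring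
  -- The separation of the curves.
  set v : ℝ → ℝ := fun s => V s * (D (Y s 0))⁻¹ with hvdef
  have hline : Continuous fun s : ℝ => (s, (0 : ℝ)) := by fun_prop
  have hvc : Continuous v := hVc.mul (hDc.comp hline)
  obtain ⟨w, hw⟩ := exists_hasDerivAt_separation hδ0 hδS (x := fun τ s => W s (Θ τ s)) (n := n)
    (P := fun τ s => P s (Θ τ s)) (Q := fun τ s => H (Y s (Θ τ s)) * P s (Θ τ s)) (v := v)
    (η := fun s => H (Y s 0)) (k := fun s => H' (Y s 0) + H (Y s 0) ^ 2)
    (hτ.mono hx) (hτ.mono hnder) (hτ.mono (hcompc hPc))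
    (hτ.mono (hcompc (f := fun s t => H (Y s t) * P s t) (hHc.mul hPc)))
    (by
      filter_upwards [hτ] with τ hτ
      have h0 : (0 : ℝ) ∈ Ioo (-S₂) S₂ := ⟨by linarith, hS₂⟩
      exact h.unit _ (ball_subset_closedBall (ball_subset_ball (by linarith)
        (hWat 0 (hsub2 0 h0) _ (hΘmem τ hτ 0 h0)).2.1)))
    (fun s hs => by simp [hΘ0 s hs, hP0]) (fun s hs => by simp [hΘ0 s hs, hP0])
    hvc.continuousOn (hHc.comp hline).continuousOn
    ((hH'c'.comp hline).add ((hHc.comp hline).pow 2)).continuousOn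
    (by
      refine (hexpand (G := P) (G' := fun s t => g s t * P s t) (hgc.mul hPc)
        fun s _ t _ => hPd s t).congr_left fun p => ?_
      simp only [hP0, hg, hvdef]
      ring)
    (by
      refine (hexpand (G := fun s t => H (Y s t) * P s t)
        (G' := fun s t => (D (Y s t))⁻¹ * H' (Y s t) * P s t + H (Y s t) * (g s t * P s t))
        (((hDc.mul hH'c').mul hPc).add (hHc.mul (hgc.mul hPc))) fun s hs t ht => ?_).congr_left
          fun p => ?_
      · have hs' := hsub2 s (hδsub s hs)
        refine HasDerivAt.mul ?_ (hPd s t)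
        have := hH' (W s) t (by
          filter_upwards [isOpen_Ioo.mem_nhds ht] with r hr
          exact ⟨ball_subset_ball (by linarith) (hWat s hs' r hr).2.1, (hWat s hs' r hr).2.2⟩)
        rw [(hWat s hs' t ht).1]
        refine this.congr_of_eventuallyEq ?_
        filter_upwards [isOpen_Ioo.mem_nhds ht] with r hr
        rw [(hWat s hs' r hr).1]
      · simp only [hP0, hg, hvdef]
        ring)
    (fun s hs => by
      have hs' := hδsub s hs
      have hs'' := hsub2 s hs'
      have h1 : HasDerivAt (fun τ => Θ τ s) (V s) 0 :=
        hasDerivAt_of_isLittleO_expansion (G₀ := fun _ => 0) (hΘo.congr_left fun p => by ring) hs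
          (hΘ0 s hs')
      have h2 := (hWat s hs'' 0 ⟨by linarith, hT₁⟩).2.2
      rw [← hΘ0 s hs'] at h2
      refine (h2.scomp 0 h1).congr_deriv ?_
      simp only [hn, hvdef, hΘ0 s hs', hY0 s hs'', (hWY s hs'').1, smul_smul])
  refine ⟨δ, hδ0, by linarith, v, w, fun s hs => ?_⟩
  have hs' := hδsub s (Ioo_subset_Icc_self hs)
  have hYs := hY0 s (hsub2 s hs')
  have hD0 := h.D_pos _ (hYR s 0)
  refine ⟨mul_pos (hVpos s) (inv_pos.2 hD0), (hw s hs).1, ?_, ?_⟩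
  · have := (hw s hs).2
    rwa [hYs] at this
  · have hVs := hVd s
    refine (hVs.congr_of_eventuallyEq ?_).congr_deriv ?_
    · filter_upwards [isOpen_Ioo.mem_nhds hs'] with r hr
      have hDr := hDne r 0
      simp only [hvdef]
      rw [← hY0 r (hsub2 r hr)]
      field_simp
    · simp only [hκ, hvdef, hP0, hYs]
      ring

end IsLocalSolution

end

/-! ### Mollification -/

section

open ContinuousLinearMap
open scoped Convolution

lemma locallyIntegrable_indicator_closedBall {E : Type*} [NormedAddCommGroup E] {g : Plane → E} {q : Plane} {R : ℝ}
    (hg : ContinuousOn g (closedBall q R)) :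
    LocallyIntegrable ((closedBall q R).indicator g) :=
  ((integrable_indicator_iff measurableSet_closedBall).2
    (hg.integrableOn_compact (isCompact_closedBall q R))).locallyIntegrable

section Mollify

variable {E : Type*} [NormedAddCommGroup E] [NormedSpace ℝ E]

/-- The mollification of `g` by the normalized bump function `φ`. -/
def mollify (φ : ContDiffBump (0 : Plane)) (g : Plane → E) (x : Plane) : E :=
  ∫ t, φ.normed volume (x - t) • g t

lemma mollify_eq_convolution (φ : ContDiffBump (0 : Plane)) (g : Plane → E) :
    mollify φ g = (φ.normed volume ⋆[lsmul ℝ ℝ, volume] g : Plane → E) := by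
  ext x
  rw [convolution_lsmul_swap]
  rfl

lemma contDiff_mollify [CompleteSpace E] (φ : ContDiffBump (0 : Plane)) {g : Plane → E}
    (hg : LocallyIntegrable g) : ContDiff ℝ 1 (mollify φ g) := by
  rw [mollify_eq_convolution]
  exact φ.hasCompactSupport_normed.contDiff_convolution_left _ (n := 1) φ.contDiff_normed hg

lemma tendstoUniformlyOn_mollify [CompleteSpace E] {φ : ℕ → ContDiffBump (0 : Plane)}
    (hφ : Tendsto (fun n => (φ n).rOut) atTop (𝓝 0)) {g : Plane → E} {q : Plane} {R R' : ℝ}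
    (hRR' : R < R') (hg : ContinuousOn g (closedBall q R')) :
    TendstoUniformlyOn (fun n => mollify (φ n) ((closedBall q R').indicator g)) g atTop
      (ball q R) := by
  rw [Metric.tendstoUniformlyOn_iff]
  intro ε hε
  obtain ⟨δ, hδ, h⟩ := Metric.uniformContinuousOn_iff.1
    ((isCompact_closedBall q R').uniformContinuousOn_of_continuous hg) (ε / 2) (half_pos hε)
  filter_upwards [hφ.eventually_lt_const (lt_min hδ (sub_pos.2 hRR'))] with n hn x hx
  have hx' : x ∈ closedBall q R' := ball_subset_closedBall (ball_subset_ball hRR'.le hx)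
  have key := (φ n).dist_normed_convolution_le (μ := volume) (x₀ := x) (ε := ε / 2)
    (g := (closedBall q R').indicator g)
    (locallyIntegrable_indicator_closedBall hg).aestronglyMeasurable (fun y hy => by
      have hyx : dist y x < min δ (R' - R) := (mem_ball.1 hy).trans hn
      have hy' : y ∈ closedBall q R' := by
        rw [mem_closedBall]
        have h1 := dist_triangle y x q
        have h2 := mem_ball.1 hx
        have h3 := hyx.trans_le (min_le_right _ _)
        linarith
      rw [indicator_of_mem hy', indicator_of_mem hx']
      exact (h y hy' x hx' (hyx.trans_le (min_le_left _ _))).le)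
  rw [indicator_of_mem hx', ← mollify_eq_convolution] at key
  rw [dist_comm]
  exact key.trans_lt (half_lt_self hε)

end Mollify

lemma exists_contDiffBump_rOut_tendsto_zero (δ : ℝ) (hδ : 0 < δ) :
    ∃ φ : ℕ → ContDiffBump (0 : Plane), (∀ n, (φ n).rOut ≤ δ) ∧
      Tendsto (fun n => (φ n).rOut) atTop (𝓝 0) := by
  refine ⟨fun n => ⟨δ / (n + 1) / 2, δ / (n + 1), by positivity, half_lt_self (by positivity)⟩,
    fun n => ?_, ?_⟩
  · exact div_le_self hδ.le (by linarith [(Nat.cast_nonneg n : (0 : ℝ) ≤ n)])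
  · exact tendsto_const_nhds.div_atTop
      (tendsto_atTop_add_const_right _ _ tendsto_natCast_atTop_atTop)

lemma fderiv_mollify_apply (φ : ContDiffBump (0 : Plane)) {g : Plane → Plane}
    (hg : LocallyIntegrable g) (x e : Plane) (i : Fin 2) :
    Integrable (fun t => fderiv ℝ (φ.normed volume) (x - t) e * g t i) ∧
    fderiv ℝ (mollify φ g) x e i = ∫ t, fderiv ℝ (φ.normed volume) (x - t) e * g t i := by
  have hφ : ContDiff ℝ 1 (φ.normed volume) := φ.contDiff_normed (n := 1)
  have hcs : HasCompactSupport (fderiv ℝ (φ.normed volume)) :=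
    φ.hasCompactSupport_normed.fderiv ℝ
  have hcs' : HasCompactSupport fun y => fderiv ℝ (φ.normed volume) y e :=
    hcs.comp_left (g := fun L : Plane →L[ℝ] ℝ => L e) rfl
  have hcont' : Continuous fun y => fderiv ℝ (φ.normed volume) y e :=
    (hφ.continuous_fderiv one_ne_zero).clm_apply continuous_const
  have hd := φ.hasCompactSupport_normed.hasFDerivAt_convolution_right (lsmul ℝ ℝ).flip hg hφ x
  have hflip : (g ⋆[(lsmul ℝ ℝ : ℝ →L[ℝ] Plane →L[ℝ] Plane).flip, volume] φ.normed volume)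
      = mollify φ g := by rw [convolution_flip, mollify_eq_convolution]
  rw [hflip] at hd
  have hint : Integrable fun t => fderiv ℝ (φ.normed volume) (x - t) e • g t :=
    hcs'.convolutionExists_right (lsmul ℝ ℝ : ℝ →L[ℝ] Plane →L[ℝ] Plane).flip hg hcont' x
  have hval : fderiv ℝ (mollify φ g) x e
      = ∫ t, fderiv ℝ (φ.normed volume) (x - t) e • g t := by
    rw [hd.fderiv, convolution_precompR_apply _ hg hcs (hφ.continuous_fderiv one_ne_zero)]
    rfl
  constructor
  · exact (EuclideanSpace.proj i : Plane →L[ℝ] ℝ).integrable_comp hint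
  · rw [hval]
    exact ((EuclideanSpace.proj i : Plane →L[ℝ] ℝ).integral_comp_comm
      hint).symm

/-- The curl of the mollification of `N^⊥`: minus the weak divergence of `N`, tested with a
translate of the mollifier. -/
lemma planarCurl_mollify_perp (φ : ContDiffBump (0 : Plane)) {N : Plane → Plane}
    (hN : LocallyIntegrable fun x => perp (N x)) (x : Plane) :
    planarCurl (mollify φ fun x => perp (N x)) x
      = -∫ t, fderiv ℝ (φ.normed volume) (x - t) (N t) := by
  have h0 := fderiv_mollify_apply φ hN x (EuclideanSpace.single 0 1) 1
  have h1 := fderiv_mollify_apply φ hN x (EuclideanSpace.single 1 1) 0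
  rw [planarCurl, h0.2, h1.2, ← integral_sub h0.1 h1.1, ← integral_neg]
  congr 1
  ext t
  have : N t = N t 0 • EuclideanSpace.single 0 1 + N t 1 • EuclideanSpace.single 1 1 := by
    apply plane_ext <;> simp
  conv_rhs => rw [this]
  rw [map_add, map_smul, map_smul]
  simp
  ring

/-! ### The weak equation near a nonsingular point -/

variable {Ω : Set Plane} {u : Plane → ℝ} {F : Plane → Plane} {H : Plane → ℝ}

lemma gradient_eq_zero_of_notMem_tsupport {φ : Plane → ℝ} {x : Plane} (hx : x ∉ tsupport φ) :
    gradient φ x = 0 := by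
  have : φ =ᶠ[𝓝 x] fun _ => 0 := notMem_tsupport_iff_eventuallyEq.1 hx
  rw [gradient, this.fderiv_eq]
  simp

/-- Away from the singular set the weak inequality, for a test function and its negative, is an
equality. -/
lemma IsWeakSolution.integral_eq_zero (h : IsWeakSolution Ω u F H) {φ : Plane → ℝ}
    (hφ : ContDiff ℝ (⊤ : ℕ∞) φ) (hc : HasCompactSupport φ)
    (hsub : tsupport φ ⊆ Ω \ singularSet Ω u F) :
    (∫ x, inner ℝ (unitNormal u F x) (gradient φ x)) + ∫ x, H x * φ x = 0 := by
  have key : ∀ ψ : Plane → ℝ, tsupport ψ ⊆ Ω \ singularSet Ω u F → ContDiff ℝ (⊤ : ℕ∞) ψ →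
      HasCompactSupport ψ →
      0 ≤ (∫ x, inner ℝ (unitNormal u F x) (gradient ψ x)) + ∫ x, H x * ψ x := by
    intro ψ hsub hψ hc
    have h1 := h ψ hψ hc (hsub.trans sdiff_subset)
    rw [setIntegral_eq_zero_of_forall_eq_zero, zero_add,
      setIntegral_eq_integral_of_forall_compl_eq_zero,
      setIntegral_eq_integral_of_forall_compl_eq_zero] at h1
    · exact h1
    · intro x hx
      rw [image_eq_zero_of_notMem_tsupport fun hx' => hx (hsub hx').1, mul_zero]
    · intro x hx
      rw [gradient_eq_zero_of_notMem_tsupport fun hx' => hx (hsub hx'), inner_zero_right]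
    · intro x hx
      rw [gradient_eq_zero_of_notMem_tsupport fun hx' => (hsub hx').2 hx, norm_zero]
  have h1 := key φ hsub hφ hc
  have h2 := key (fun x => -φ x) (by rwa [show (fun x => -φ x) = -φ from rfl, tsupport_neg]) hφ.neg
    hc.neg
  have hg : ∀ x, gradient (fun x => -φ x) x = -gradient φ x := fun x => by
    simp [gradient, fderiv_fun_neg]
  simp only [hg, inner_neg_right, mul_neg, integral_neg] at h2
  linarith

/-- `N^⊥` has curl `-H` near nonsingular points. -/
lemma hasCurlOn_unitNormalPerp (h : IsWeakSolution Ω u F H) {q : Plane} {R R' : ℝ}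
    (hRR' : R < R') (hsub : closedBall q R' ⊆ Ω \ singularSet Ω u F)
    (hN : ContinuousOn (unitNormal u F) (closedBall q R'))
    (hH : ContinuousOn H (closedBall q R')) :
    HasCurlOn (fun x => perp (unitNormal u F x)) (fun x => -H x) (ball q R) := by
  obtain ⟨φ, hφR, hφ0⟩ := exists_contDiffBump_rOut_tendsto_zero (R' - R) (sub_pos.2 hRR')
  have hB : ContinuousOn (fun x => perp (unitNormal u F x)) (closedBall q R') :=
    continuous_perp.comp_continuousOn hN
  set N' := (closedBall q R').indicator (unitNormal u F) with hN'
  have hind : ((closedBall q R').indicator fun x => perp (unitNormal u F x))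
      = fun x => perp (N' x) := by
    ext1 x
    by_cases hx : x ∈ closedBall q R'
    · simp [hN', hx]
    · simp only [hN', indicator_of_notMem hx]
      exact (map_zero perpCLM).symm
  have hli := locallyIntegrable_indicator_closedBall hB
  have hlim := tendstoUniformlyOn_mollify hφ0 hRR' hB
  rw [hind] at hli
  simp only [hind] at hlim
  have hC1 := fun n => contDiff_mollify (φ n) hli
  have hHlim := (tendstoUniformlyOn_mollify hφ0 hRR' hH.neg)
  refine hasCurlOn_of_tendstoUniformlyOn (convex_ball q R)
    (an := fun n => planarCurl (mollify (φ n) fun x => perp (N' x)))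
    (fun n => (hC1 n).continuous.continuousOn) (fun n => ?_) hlim (hHlim.congr ?_)
    fun n => hasCurlOn_of_contDiffOn isOpen_ball (convex_ball q R) (hC1 n).contDiffOn
  · refine Continuous.continuousOn ?_
    have hd := (hC1 n).continuous_fderiv one_ne_zero
    unfold planarCurl
    fun_prop
  · refine Eventually.of_forall fun n x hx => ?_
    -- the weak equation for the test function `t ↦ ρ (x - t)`
    set ρ := (φ n).normed (volume : Measure Plane) with hρ
    have hsupp : ∀ t, x - t ∈ tsupport ρ → t ∈ closedBall q R' := by
      intro t ht
      rw [hρ, (φ n).tsupport_normed_eq, mem_closedBall_zero_iff] at ht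
      have h1 := dist_triangle t x q
      rw [dist_comm t x, dist_eq_norm x t] at h1
      rw [mem_closedBall]
      linarith [mem_ball.1 hx, hφR n]
    have htest : tsupport (fun t => ρ (x - t)) ⊆ closedBall q R' := by
      have : tsupport (fun t => ρ (x - t)) ⊆ (fun t => x - t) ⁻¹' tsupport ρ :=
        tsupport_comp_subset_preimage ρ (f := fun t => x - t) (by fun_prop)
      exact fun t ht => hsupp t (this ht)
    have hρs : ContDiff ℝ (⊤ : ℕ∞) ρ := (φ n).contDiff_normed
    have hw := h.integral_eq_zero (φ := fun t => ρ (x - t))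
      (hρs.comp (contDiff_const.sub contDiff_id))
      (HasCompactSupport.of_support_subset_isCompact (isCompact_closedBall q R')
        ((subset_tsupport _).trans htest)) (htest.trans hsub)
    have hgrad : ∀ t, (inner ℝ (unitNormal u F t) (gradient (fun t => ρ (x - t)) t) : ℝ)
        = -fderiv ℝ ρ (x - t) (N' t) := by
      intro t
      by_cases ht : t ∈ closedBall q R'
      · have hd : HasFDerivAt (fun t => ρ (x - t)) (-fderiv ℝ ρ (x - t)) t := by
          have h1 : HasFDerivAt ρ (fderiv ℝ ρ (x - t)) (x - t) :=
            (hρs.differentiable (by simp)).differentiableAt.hasFDerivAt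
          refine (h1.comp t ((hasFDerivAt_id t).const_sub x)).congr_fderiv ?_
          ext; simp
        rw [real_inner_comm, gradient, hd.fderiv, InnerProductSpace.toDual_symm_apply, hN',
          indicator_of_mem ht]
        rfl
      · rw [gradient_eq_zero_of_notMem_tsupport fun h' => ht (htest h'), inner_zero_right, hN',
          indicator_of_notMem ht, map_zero, neg_zero]
    have hHint : ∀ t, H t * ρ (x - t)
        = -(ρ (x - t) • (closedBall q R').indicator (fun x => -H x) t) := by
      intro t
      by_cases ht : t ∈ closedBall q R'
      · rw [indicator_of_mem ht]; simp [mul_comm]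
      · rw [indicator_of_notMem ht,
          image_eq_zero_of_notMem_tsupport (f := ρ) fun h' => ht (hsupp t h')]
        simp
    simp only [hgrad, hHint, integral_neg] at hw
    have : planarCurl (mollify (φ n) fun x => perp (N' x)) x = -∫ t, fderiv ℝ ρ (x - t) (N' t) :=
      planarCurl_mollify_perp (φ n) hli x
    change (∫ t, ρ (x - t) • (closedBall q R').indicator (fun x => -H x) t)
      = planarCurl (mollify (φ n) fun x => perp (N' x)) x
    rw [this]
    linarith


/-! ### The local solution at a nonsingular point -/

lemma continuousOn_shiftedGradient (hΩ : IsOpen Ω) (hu : ContDiffOn ℝ 1 u Ω)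
    (hF : ContDiffOn ℝ 1 F Ω) : ContinuousOn (shiftedGradient u F) Ω :=
  ((InnerProductSpace.toDual ℝ Plane).symm.continuous.comp_continuousOn
    (hu.continuousOn_fderiv_of_isOpen hΩ le_rfl)).add hF.continuousOn

lemma isOpen_sdiff_singularSet (hΩ : IsOpen Ω) (hu : ContDiffOn ℝ 1 u Ω)
    (hF : ContDiffOn ℝ 1 F Ω) : IsOpen (Ω \ singularSet Ω u F) := by
  have : Ω \ singularSet Ω u F = Ω ∩ shiftedGradient u F ⁻¹' {0}ᶜ := by
    ext x
    exact ⟨fun h => ⟨h.1, fun h' => h.2 ⟨h.1, h'⟩⟩, fun h => ⟨h.1, fun h' => h.2 h'.2⟩⟩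
  rw [this]
  exact (continuousOn_shiftedGradient hΩ hu hF).isOpen_inter_preimage hΩ isOpen_compl_singleton

lemma shiftedGradient_ne_zero {x : Plane} (hx : x ∈ Ω \ singularSet Ω u F) :
    shiftedGradient u F x ≠ 0 := fun h => hx.2 ⟨hx.1, h⟩

lemma gradLength_pos {x : Plane} (hx : x ∈ Ω \ singularSet Ω u F) : 0 < gradLength u F x :=
  norm_pos_iff.2 (shiftedGradient_ne_zero hx)

lemma norm_unitNormal {x : Plane} (hx : x ∈ Ω \ singularSet Ω u F) : ‖unitNormal u F x‖ = 1 := by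
  rw [unitNormal, norm_smul, norm_inv, gradLength, norm_norm,
    inv_mul_cancel₀ (norm_ne_zero_iff.2 (shiftedGradient_ne_zero hx))]

lemma gradLength_smul_unitNormal (x : Plane) :
    gradLength u F x • unitNormal u F x = shiftedGradient u F x := by
  rw [unitNormal, gradLength, smul_smul]
  by_cases hx : shiftedGradient u F x = 0
  · rw [hx, smul_zero]
  · rw [mul_inv_cancel₀ (norm_ne_zero_iff.2 hx), one_smul]

lemma continuousOn_gradLength (hΩ : IsOpen Ω) (hu : ContDiffOn ℝ 1 u Ω)
    (hF : ContDiffOn ℝ 1 F Ω) : ContinuousOn (gradLength u F) Ω :=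
  (continuousOn_shiftedGradient hΩ hu hF).norm

lemma continuousOn_unitNormal (hΩ : IsOpen Ω) (hu : ContDiffOn ℝ 1 u Ω)
    (hF : ContDiffOn ℝ 1 F Ω) : ContinuousOn (unitNormal u F) (Ω \ singularSet Ω u F) :=
  (((continuousOn_gradLength hΩ hu hF).mono sdiff_subset).inv₀ fun _ hx =>
    (gradLength_pos hx).ne').smul ((continuousOn_shiftedGradient hΩ hu hF).mono sdiff_subset)

lemma continuousOn_planarCurl (hΩ : IsOpen Ω) (hF : ContDiffOn ℝ 1 F Ω) :
    ContinuousOn (planarCurl F) Ω := by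
  have hd := hF.continuousOn_fderiv_of_isOpen hΩ le_rfl
  unfold planarCurl
  fun_prop

lemma hasCurlOn_shiftedGradient {U : Set Plane} (hU : IsOpen U) (hconv : Convex ℝ U)
    (hu : ContDiffOn ℝ 1 u U) (hF : ContDiffOn ℝ 1 F U) :
    HasCurlOn (shiftedGradient u F) (planarCurl F) U := by
  have h := HasCurlOn.add hconv
    ((InnerProductSpace.toDual ℝ Plane).symm.continuous.comp_continuousOn
      (hu.continuousOn_fderiv_of_isOpen hU le_rfl)) hF.continuousOn continuousOn_const
    (continuousOn_planarCurl hU hF) (hasCurlOn_gradient hU hconv hu)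
    (hasCurlOn_of_contDiffOn hU hconv hF)
  simp only [zero_add] at h
  exact h

/-- Two one-forms that are close to constant ones, of lengths `d` and `1` and orthogonal to each
other, separate points. -/
lemma coercive_of_near_const {U : Set Plane} (hconv : Convex ℝ U) {A B : Plane → Plane}
    (hA : ContinuousOn A U) (hB : ContinuousOn B U) {n : Plane} (hn : ‖n‖ = 1) {d : ℝ} (hd : 0 < d)
    (hAn : ∀ x ∈ U, ‖A x - d • n‖ ≤ d / 4) (hBn : ∀ x ∈ U, ‖B x - perp n‖ ≤ 1 / 4)
    {x y : Plane} (hx : x ∈ U) (hy : y ∈ U) :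
    min d 1 / 2 * ‖y - x‖ ≤ |segInt A x y| + |segInt B x y| := by
  have h1 := abs_segInt_sub_inner_le hconv hA hx hy fun r hr =>
    hAn _ (add_smul_sub_mem hconv hx hy hr)
  have h2 := abs_segInt_sub_inner_le hconv hB hx hy fun r hr =>
    hBn _ (add_smul_sub_mem hconv hx hy hr)
  have h3 := norm_le_abs_inner_add_abs_inner_perp hn (y - x)
  rw [inner_smul_left] at h1
  simp only [conj_trivial] at h1
  have h4 : d * |(inner ℝ n (y - x) : ℝ)| ≤ |segInt A x y| + d / 4 * ‖y - x‖ := by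
    rw [← abs_of_pos hd, ← abs_mul, abs_of_pos hd]
    have := abs_sub_abs_le_abs_sub (d * (inner ℝ n (y - x) : ℝ)) (segInt A x y)
    rw [abs_sub_comm] at this
    linarith
  have h5 : |(inner ℝ (perp n) (y - x) : ℝ)| ≤ |segInt B x y| + 1 / 4 * ‖y - x‖ := by
    have := abs_sub_abs_le_abs_sub (inner ℝ (perp n) (y - x) : ℝ) (segInt B x y)
    rw [abs_sub_comm] at this
    linarith
  have hN := norm_nonneg (y - x)
  rcases le_total d 1 with h | h
  · rw [min_eq_left h]
    nlinarith [abs_nonneg (segInt B x y)]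
  · rw [min_eq_right h]
    nlinarith [abs_nonneg (segInt A x y), abs_nonneg (inner ℝ n (y - x) : ℝ)]

/-- Near a nonsingular point, `N` and `D` form a local solution in the sense of curls of continuous
fields, and the integral curves of `N / D` exist. -/
lemma exists_isLocalSolution (hΩ : IsOpen Ω) (hu : ContDiffOn ℝ 1 u Ω) (hF : ContDiffOn ℝ 1 F Ω)
    (hH : ContinuousOn H Ω) (hweak : IsWeakSolution Ω u F H) {q : Plane}
    (hq : q ∈ Ω \ singularSet Ω u F) :
    ∃ R m K T : ℝ, closedBall q R ⊆ Ω \ singularSet Ω u F ∧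
      IsLocalSolution q R (unitNormal u F) (gradLength u F) (planarCurl F) H m K ∧ 0 < T ∧
      ∀ x ∈ ball q (R / 2), ∃ γ : ℝ → Plane, γ 0 = x ∧ ∀ t ∈ Ioo (-T) T, γ t ∈ ball q R ∧
        HasDerivAt γ ((gradLength u F (γ t))⁻¹ • unitNormal u F (γ t)) t := by
  set Ω' := Ω \ singularSet Ω u F with hΩ'
  have hΩo : IsOpen Ω' := isOpen_sdiff_singularSet hΩ hu hF
  have hAc := continuousOn_shiftedGradient hΩ hu hF
  have hNc : ContinuousOn (unitNormal u F) Ω' := continuousOn_unitNormal hΩ hu hF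
  have hBc : ContinuousOn (unitNormalPerp u F) Ω' := continuous_perp.comp_continuousOn hNc
  have hDc := continuousOn_gradLength hΩ hu hF
  have hcc := continuousOn_planarCurl hΩ hF
  set d := gradLength u F q with hd
  have hd0 : 0 < d := gradLength_pos hq
  have hA1 : ∀ᶠ x in 𝓝 q, ‖shiftedGradient u F x - d • unitNormal u F q‖ ≤ d / 4 := by
    rw [hd, gradLength_smul_unitNormal, ← hd]
    have := Metric.continuousAt_iff'.1 (hAc.continuousAt (hΩ.mem_nhds hq.1)) (d / 4)
      (by positivity)
    filter_upwards [this] with x hx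
    rw [← dist_eq_norm]; exact hx.le
  have hB1 : ∀ᶠ x in 𝓝 q, ‖unitNormalPerp u F x - perp (unitNormal u F q)‖ ≤ 1 / 4 := by
    have := Metric.continuousAt_iff'.1 (hBc.continuousAt (hΩo.mem_nhds hq)) (1 / 4)
      (by positivity)
    filter_upwards [this] with x hx
    rw [← unitNormalPerp, ← dist_eq_norm]; exact hx.le
  obtain ⟨R', hR', hball⟩ := nhds_basis_closedBall.mem_iff.1
    (Filter.inter_mem (hΩo.mem_nhds hq) (Filter.inter_mem hA1 hB1))
  have hsub' : closedBall q R' ⊆ Ω' := fun x hx => (hball hx).1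
  set R := R' / 2 with hRdef
  have hR : 0 < R := half_pos hR'
  have hRR' : R < R' := half_lt_self hR'
  have hle : closedBall q R ⊆ closedBall q R' := closedBall_subset_closedBall hRR'.le
  have hbc : ball q R ⊆ closedBall q R := ball_subset_closedBall
  have hsub : closedBall q R ⊆ Ω' := hle.trans hsub'
  have hsubΩ : closedBall q R ⊆ Ω := hsub.trans sdiff_subset
  have hAc' := hAc.mono hsubΩ
  have hBc' := hBc.mono hsub
  have hcc' := hcc.mono hsubΩ
  have hHc' := hH.mono hsubΩ
  have hcomp := isCompact_closedBall q R
  obtain ⟨K₁, hK₁⟩ := hcomp.exists_bound_of_continuousOn hAc'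
  obtain ⟨K₂, hK₂⟩ := hcomp.exists_bound_of_continuousOn hBc'
  obtain ⟨K₃, hK₃⟩ := hcomp.exists_bound_of_continuousOn hcc'
  obtain ⟨K₄, hK₄⟩ := hcomp.exists_bound_of_continuousOn hHc'
  set K := max 1 (max (max K₁ K₂) (max K₃ K₄)) with hK
  have hle1 : K₁ ≤ K := by simp [hK]
  have hle2 : K₂ ≤ K := by simp [hK]
  have hle3 : K₃ ≤ K := by simp [hK]
  have hle4 : K₄ ≤ K := by simp [hK]
  have hADN : (fun x => gradLength u F x • unitNormal u F x) = shiftedGradient u F :=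
    funext gradLength_smul_unitNormal
  have hframe : IsCurlFrame (ball q R) (fun x => gradLength u F x • unitNormal u F x)
      (fun x => perp (unitNormal u F x)) (planarCurl F) (fun x => -H x) (min d 1 / 2) K := by
    rw [hADN]
    exact
      { convex := convex_ball q R
        curlA := hasCurlOn_shiftedGradient isOpen_ball (convex_ball q R)
          (hu.mono (hbc.trans hsubΩ)) (hF.mono (hbc.trans hsubΩ))
        curlB := hasCurlOn_unitNormalPerp hweak hRR' hsub' (hNc.mono hsub')
          (hH.mono (hsub'.trans sdiff_subset))
        m_pos := half_pos (lt_min hd0 one_pos)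
        K_pos := lt_max_of_lt_left one_pos
        boundA := fun x hx => (hK₁ x (hbc hx)).trans hle1
        boundB := fun x hx => (hK₂ x (hbc hx)).trans hle2
        bounda := fun x hx => (hK₃ x (hbc hx)).trans hle3
        boundb := fun x hx => by
          rw [abs_neg]; exact (hK₄ x (hbc hx)).trans hle4
        coercive := fun x hx y hy => coercive_of_near_const (convex_ball q R) (hAc'.mono hbc)
          (hBc'.mono hbc) (norm_unitNormal hq) hd0 (fun z hz => (hball (hle (hbc hz))).2.1)
          (fun z hz => (hball (hle (hbc hz))).2.2) hx hy }
  have hloc : IsLocalSolution q R (unitNormal u F) (gradLength u F) (planarCurl F) H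
      (min d 1 / 2) K :=
    { R_pos := hR
      contN := hNc.mono hsub
      contD := hDc.mono hsubΩ
      contc := hcc'
      contH := hHc'
      unit := fun x hx => norm_unitNormal (hsub hx)
      D_pos := fun x hx => gradLength_pos (hsub hx)
      frame := hframe }
  -- Mollification of `N / D` and the approximate curves
  set M : Plane → Plane := fun x => (gradLength u F x)⁻¹ • unitNormal u F x with hM
  have hMc : ContinuousOn M (closedBall q R') :=
    ((hDc.mono (hsub'.trans sdiff_subset)).inv₀ fun x hx => (gradLength_pos (hsub' hx)).ne').smul
      (hNc.mono hsub')
  obtain ⟨L, hL1, hL⟩ := hloc.exists_bound_M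
  obtain ⟨φ, -, hφ0⟩ := exists_contDiffBump_rOut_tendsto_zero 1 one_pos
  have hlim := tendstoUniformlyOn_mollify hφ0 hRR' hMc
  obtain ⟨n₀, hn₀⟩ := eventually_atTop.1 (Metric.tendstoUniformlyOn_iff.1 hlim 1 one_pos)
  refine ⟨R, _, K, R / (4 * (L + 1)), hsub, hloc, by positivity, fun x hx => ?_⟩
  refine hframe.exists_integralCurve hR (X := M) (L := L + 1) (α := 1) (β := 0) (by positivity)
    (fun x hx => hloc.inner_A_M (hbc hx)) (fun x _ => IsLocalSolution.inner_B_M x)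
    (Xn := fun n => mollify (φ (n + n₀)) ((closedBall q R').indicator M))
    (fun n => contDiff_mollify _ (locallyIntegrable_indicator_closedBall hMc))
    (fun n y hy => ?_) ?_ hx
  · have h1 := hn₀ (n + n₀) (Nat.le_add_left _ _) y hy
    have h2 := hL y (hbc hy)
    rw [dist_comm, dist_eq_norm] at h1
    have h3 := norm_sub_norm_le (mollify (φ (n + n₀)) ((closedBall q R').indicator M) y) (M y)
    change ‖M y‖ ≤ L at h2
    linarith
  · rw [Metric.tendstoUniformlyOn_iff] at hlim ⊢
    exact fun ε hε => (tendsto_add_atTop_nat n₀).eventually (hlim ε hε)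

end

/-! ### The singular limit of the equation for the derivative of `D` -/

section

lemma tendsto_of_eventually_le_or_ge {ι : Type*} {l : Filter ι} {p : ι → ℝ} {s : Set ℝ}
    (hs : Dense s) (h : ∀ a ∈ s, (∀ᶠ t in l, a ≤ p t) ∨ ∀ᶠ t in l, p t ≤ a)
    (hb : l.IsBoundedUnder (· ≤ ·) p) (hb' : l.IsBoundedUnder (· ≥ ·) p) :
    ∃ L, Tendsto p l (𝓝 L) := by
  refine tendsto_of_no_upcrossings hs (fun a ha b _ hab => ?_) hb hb'
  rintro ⟨h1, h2⟩
  rcases h a ha with h3 | h3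
  · exact h1 (h3.mono fun t ht => not_lt.2 ht)
  · exact h2 (h3.mono fun t ht => not_lt.2 (ht.trans hab.le))

/-- A function that increases at each of its zeros is eventually of one sign as its argument
decreases to `0`. -/
lemma eventually_nonneg_or_nonpos_of_deriv_pos {f f' : ℝ → ℝ} {b : ℝ} (hb : 0 < b)
    (hf : ∀ t ∈ Ioo 0 b, HasDerivAt f (f' t) t) (hf' : ∀ t ∈ Ioo 0 b, f t = 0 → 0 < f' t) :
    (∀ᶠ t in 𝓝[>] 0, 0 ≤ f t) ∨ ∀ᶠ t in 𝓝[>] 0, f t ≤ 0 := by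
  have hinv : ∀ y ∈ Ioo 0 b, 0 ≤ f y → ∀ x ∈ Ioo 0 b, y ≤ x → 0 ≤ f x := by
    intro y hy hfy x hx hyx
    have hsub : ∀ z ∈ Icc y x, z ∈ Ioo 0 b := fun z hz =>
      ⟨hy.1.trans_le hz.1, hz.2.trans_lt hx.2⟩
    have := image_le_of_deriv_right_lt_deriv_boundary (f := fun t => -f t) (f' := fun t => -f' t)
      (B := fun _ => 0) (B' := fun _ => 0)
      (fun z hz => (hf z (hsub z hz)).neg.continuousAt.continuousWithinAt)
      (fun z hz => (hf z (hsub z (Ico_subset_Icc_self hz))).neg.hasDerivWithinAt) (by simpa using hfy)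
      (fun z => hasDerivAt_const z 0)
      (fun z hz hz0 => by
        have := hf' z (hsub z (Ico_subset_Icc_self hz)) (by simpa using hz0)
        linarith) (x := x) ⟨hyx, le_rfl⟩
    simpa using this
  by_cases hex : ∃ y ∈ Ioo 0 b, f y < 0
  · obtain ⟨y, hy, hfy⟩ := hex
    right
    filter_upwards [Ioo_mem_nhdsGT hy.1] with t ht
    by_contra hlt
    exact absurd (hinv t ⟨ht.1, ht.2.trans hy.2⟩ (not_le.1 hlt).le y hy ht.2.le) (not_le.2 hfy)
  · left
    push Not at hex
    filter_upwards [Ioo_mem_nhdsGT hb] with t ht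
    exact hex t ht

lemma monotoneOn_Ioo_of_hasDerivAt_nonneg {f f' : ℝ → ℝ} {b : ℝ}
    (hf : ∀ t ∈ Ioo 0 b, HasDerivAt f (f' t) t) (hf' : ∀ t ∈ Ioo 0 b, 0 ≤ f' t) :
    MonotoneOn f (Ioo 0 b) := by
  refine monotoneOn_of_deriv_nonneg (convex_Ioo 0 b)
    (fun t ht => (hf t ht).continuousAt.continuousWithinAt) ?_ ?_
  · rw [interior_Ioo]
    exact fun t ht => (hf t ht).differentiableAt.differentiableWithinAt
  · rw [interior_Ioo]
    exact fun t ht => by rw [(hf t ht).deriv]; exact hf' t ht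

lemma exists_Ioo_of_eventually_nhdsGT {P : ℝ → Prop} (h : ∀ᶠ t in 𝓝[>] 0, P t) :
    ∃ b > 0, ∀ t ∈ Ioo 0 b, P t := by
  obtain ⟨b, hb, hsub⟩ := mem_nhdsGT_iff_exists_Ioo_subset.1 h
  exact ⟨b, hb, fun t ht => hsub ht⟩

/-- A bounded function `f` cannot satisfy `f' ≥ μ (log D)'` with `μ > 0` as `D` tends to `0`. -/
lemma false_of_deriv_sub_log_nonneg {f f' D D' : ℝ → ℝ} {μ C : ℝ} (hμ : 0 < μ)
    (hD : ∀ᶠ t in 𝓝[>] 0, 0 < D t ∧ HasDerivAt D (D' t) t)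
    (hD0 : Tendsto D (𝓝[>] 0) (𝓝 0))
    (hf : ∀ᶠ t in 𝓝[>] 0, HasDerivAt f (f' t) t ∧ -C ≤ f t ∧ 0 ≤ f' t - μ * (D' t / D t)) :
    False := by
  obtain ⟨b, hb, h⟩ := exists_Ioo_of_eventually_nhdsGT (hD.and hf)
  have hmono : MonotoneOn (fun t => f t - μ * Real.log (D t)) (Ioo 0 b) :=
    monotoneOn_Ioo_of_hasDerivAt_nonneg (f' := fun t => f' t - μ * (D' t / D t))
      (fun t ht => (h t ht).2.1.sub (((h t ht).1.2.log (h t ht).1.1.ne').const_mul μ))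
      fun t ht => (h t ht).2.2.2
  have hDw : Tendsto D (𝓝[>] 0) (𝓝[>] 0) :=
    tendsto_nhdsWithin_iff.2 ⟨hD0, hD.mono fun t ht => ht.1⟩
  have hlog := Real.tendsto_log_nhdsGT_zero.comp hDw
  have hb2 : b / 2 ∈ Ioo 0 b := ⟨half_pos hb, half_lt_self hb⟩
  set V := f (b / 2) - μ * Real.log (D (b / 2)) with hV
  obtain ⟨t, ht, hlt⟩ := ((hlog.eventually_lt_atBot ((-C - V) / μ)).and
    (Ioo_mem_nhdsGT (half_pos hb))).exists
  have ht' : t ∈ Ioo 0 b := ⟨hlt.1, hlt.2.trans hb2.2⟩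
  have h1 := hmono ht' hb2 hlt.2.le
  have h2 := (h t ht').2.2.1
  simp only [Function.comp] at ht
  rw [lt_div_iff₀ hμ] at ht
  simp only [← hV] at h1
  nlinarith

/-- If `D > 0` tends to `0` as the parameter decreases to `0`, then `D` cannot be decreasing. -/
lemma not_eventually_neg_of_hasDerivAt {D D' : ℝ → ℝ}
    (hD : ∀ᶠ t in 𝓝[>] 0, 0 < D t ∧ HasDerivAt D (D' t) t)
    (hD0 : Tendsto D (𝓝[>] 0) (𝓝 0)) : ¬ ∀ᶠ t in 𝓝[>] 0, D' t ≤ 0 := by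
  intro hneg
  obtain ⟨b, hb, h⟩ := exists_Ioo_of_eventually_nhdsGT (hD.and hneg)
  have hmono := monotoneOn_Ioo_of_hasDerivAt_nonneg (f := fun t => -D t) (f' := fun t => -D' t)
    (fun t ht => (h t ht).1.2.neg) fun t ht => by linarith [(h t ht).2]
  have hb2 : b / 2 ∈ Ioo 0 b := ⟨half_pos hb, half_lt_self hb⟩
  have h1 : ∀ᶠ t in 𝓝[>] 0, D (b / 2) ≤ D t := by
    filter_upwards [Ioo_mem_nhdsGT (half_pos hb)] with t ht
    have := hmono ⟨ht.1, ht.2.trans hb2.2⟩ hb2 ht.2.le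
    simpa using this
  exact absurd (ge_of_tendsto hD0 h1) (not_le.2 (h _ hb2).1.1)

/-- The singular limit of the system `D' = l p`, `p' = l ((2p - c)(p - c) / D + g)` as `D` tends to
`0`: `p` tends to a zero of `(2p - c)(p - c)`. A level that is not such a zero is crossed in one
direction only, so `p` has a limit, finite or not; at any other finite limit, `p` would grow like
a multiple of `log D`. -/
lemma tendsto_of_singular_system {D p c g l : ℝ → ℝ} {c₀ G : ℝ} (hc₀ : c₀ ≠ 0)
    (hD : ∀ᶠ t in 𝓝[>] 0, 0 < D t ∧ HasDerivAt D (l t * p t) t)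
    (hp : ∀ᶠ t in 𝓝[>] 0,
      HasDerivAt p (l t * ((2 * p t - c t) * (p t - c t) / D t + g t)) t)
    (hl : ∀ᶠ t in 𝓝[>] 0, 0 < l t) (hg : ∀ᶠ t in 𝓝[>] 0, |g t| ≤ G)
    (hD0 : Tendsto D (𝓝[>] 0) (𝓝 0)) (hc : Tendsto c (𝓝[>] 0) (𝓝 c₀)) :
    0 < c₀ ∧ (Tendsto p (𝓝[>] 0) (𝓝 (c₀ / 2)) ∨ Tendsto p (𝓝[>] 0) (𝓝 c₀)) := by
  have hpos : ¬ ∀ᶠ t in 𝓝[>] 0, p t ≤ 0 := fun h =>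
    not_eventually_neg_of_hasDerivAt hD hD0 ((h.and hl).mono fun t ht =>
      mul_nonpos_of_nonneg_of_nonpos ht.2.le ht.1)
  have hDg : Tendsto (fun t => D t * g t) (𝓝[>] 0) (𝓝 0) := by
    have : IsBoundedUnder (· ≤ ·) (𝓝[>] 0) fun t => ‖g t‖ := ⟨G, by simpa using hg⟩
    exact hD0.zero_mul_isBoundedUnder_le this
  -- every other level is crossed in one direction only
  have hlevel : ∀ a ∈ ({c₀ / 2, c₀} : Set ℝ)ᶜ,
      (∀ᶠ t in 𝓝[>] 0, a ≤ p t) ∨ ∀ᶠ t in 𝓝[>] 0, p t ≤ a := by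
    intro a ha
    simp only [mem_compl_iff, mem_insert_iff, mem_singleton_iff, not_or] at ha
    have hκ : (2 * a - c₀) * (a - c₀) ≠ 0 := mul_ne_zero
      (fun h => ha.1 (by linarith)) (sub_ne_zero.2 ha.2)
    have hlim : Tendsto (fun t => (2 * a - c t) * (a - c t) + D t * g t) (𝓝[>] 0)
        (𝓝 ((2 * a - c₀) * (a - c₀))) := by
      simpa using ((tendsto_const_nhds.sub hc).mul (tendsto_const_nhds.sub hc)).add hDg
    rcases hκ.lt_or_gt with h | h
    · obtain ⟨b, hb, hall⟩ := exists_Ioo_of_eventually_nhdsGT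
        (((hD.and hp).and hl).and (hlim.eventually_lt_const h))
      have := eventually_nonneg_or_nonpos_of_deriv_pos hb (f := fun t => a - p t)
        (fun t ht => (hall t ht).1.1.2.const_sub a) (fun t ht h0 => by
          have hpa : p t = a := by linarith
          obtain ⟨⟨⟨⟨hDt, -⟩, -⟩, hlt⟩, hlt'⟩ := hall t ht
          rw [hpa, ← mul_neg]
          refine mul_pos hlt ?_
          have e : -((2 * a - c t) * (a - c t) / D t + g t)
              = -((2 * a - c t) * (a - c t) + D t * g t) / D t := by field_simp
          rw [e]
          exact div_pos (by linarith) hDt)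
      rcases this with h' | h'
      · exact Or.inr (h'.mono fun t ht => by linarith)
      · exact Or.inl (h'.mono fun t ht => by linarith)
    · obtain ⟨b, hb, hall⟩ := exists_Ioo_of_eventually_nhdsGT
        (((hD.and hp).and hl).and (hlim.eventually_const_lt h))
      have := eventually_nonneg_or_nonpos_of_deriv_pos hb (f := fun t => p t - a)
        (fun t ht => (hall t ht).1.1.2.sub_const a) (fun t ht h0 => by
          have hpa : p t = a := by linarith
          obtain ⟨⟨⟨⟨hDt, -⟩, -⟩, hlt⟩, hlt'⟩ := hall t ht
          rw [hpa]
          refine mul_pos hlt ?_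
          have e : (2 * a - c t) * (a - c t) / D t + g t
              = ((2 * a - c t) * (a - c t) + D t * g t) / D t := by field_simp
          rw [e]
          exact div_pos hlt' hDt)
      rcases this with h' | h'
      · exact Or.inl (h'.mono fun t ht => by linarith)
      · exact Or.inr (h'.mono fun t ht => by linarith)
  have hbelow : IsBoundedUnder (· ≥ ·) (𝓝[>] 0) p := by
    have hlt : -|c₀| - 1 < 0 ∧ -|c₀| - 1 < c₀ / 2 ∧ -|c₀| - 1 < c₀ := by
      refine ⟨?_, ?_, ?_⟩ <;> linarith [neg_abs_le c₀, abs_nonneg c₀]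
    rcases hlevel (-|c₀| - 1) (by
      simp only [mem_compl_iff, mem_insert_iff, mem_singleton_iff, not_or]
      exact ⟨hlt.2.1.ne, hlt.2.2.ne⟩) with h | h
    · exact ⟨_, eventually_map.2 h⟩
    · exact absurd (h.mono fun t ht => ht.trans hlt.1.le) hpos
  have habove : IsBoundedUnder (· ≤ ·) (𝓝[>] 0) p := by
    by_contra hnb
    have hbig : ∀ a, |c₀| < a → ∀ᶠ t in 𝓝[>] 0, a ≤ p t := by
      intro a ha
      have h1 := le_abs_self c₀
      have h2 := abs_nonneg c₀
      rcases hlevel a (by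
        simp only [mem_compl_iff, mem_insert_iff, mem_singleton_iff, not_or]
        exact ⟨fun h => by linarith, fun h => by linarith⟩) with h | h
      · exact h
      · exact absurd ⟨a, by simpa using h⟩ hnb
    have hDG : ∀ᶠ t in 𝓝[>] 0, D t * G < 1 := by
      have : Tendsto (fun t => D t * G) (𝓝[>] 0) (𝓝 0) := by simpa using hD0.mul_const G
      exact this.eventually_lt_const one_pos
    have hcc : ∀ᶠ t in 𝓝[>] 0, c t < |c₀| + 1 :=
      hc.eventually_lt_const (by linarith [le_abs_self c₀])
    obtain ⟨b, hb, hall⟩ := exists_Ioo_of_eventually_nhdsGT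
      (((hD.and hp).and (hl.and hg)).and ((hbig (|c₀| + 2) (by linarith)).and (hDG.and hcc)))
    have hmono := monotoneOn_Ioo_of_hasDerivAt_nonneg (fun t ht => (hall t ht).1.1.2)
      (fun t ht => by
        obtain ⟨⟨⟨⟨hDt, -⟩, -⟩, hlt, hgt⟩, hpt, hDGt, hct⟩ := hall t ht
        refine mul_nonneg hlt.le ?_
        have h1 : 1 ≤ p t - c t := by linarith
        have h2 : 1 ≤ 2 * p t - c t := by linarith [abs_nonneg c₀]
        have h3 : 1 ≤ (2 * p t - c t) * (p t - c t) := by nlinarith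
        have h4 : G ≤ (2 * p t - c t) * (p t - c t) / D t := by
          rw [le_div_iff₀ hDt]; linarith
        linarith [neg_abs_le (g t)])
    have hb2 : b / 2 ∈ Ioo 0 b := ⟨half_pos hb, half_lt_self hb⟩
    obtain ⟨t, ht, htb⟩ := ((hbig (max (|c₀| + 1) (p (b / 2) + 1))
      (lt_max_of_lt_left (by linarith))).and (Ioo_mem_nhdsGT hb2.1)).exists
    have h1 := hmono ⟨htb.1, htb.2.trans hb2.2⟩ hb2 htb.2.le
    have h2 := (le_max_right _ _).trans ht
    linarith
  have hdense : Dense (({c₀ / 2, c₀} : Set ℝ)ᶜ) :=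
    (Set.toFinite ({c₀ / 2, c₀} : Set ℝ)).countable.dense_compl ℝ
  obtain ⟨L, hL⟩ := tendsto_of_eventually_le_or_ge hdense hlevel habove hbelow
  have hroot : (2 * L - c₀) * (L - c₀) = 0 := by
    by_contra hκ
    have hlim : Tendsto (fun t => (2 * p t - c t) * (p t - c t) + D t * g t) (𝓝[>] 0)
        (𝓝 ((2 * L - c₀) * (L - c₀))) := by
      simpa using (((hL.const_mul 2).sub hc).mul (hL.sub hc)).add hDg
    set κ := (2 * L - c₀) * (L - c₀) with hκdef
    have hpL : ∀ᶠ t in 𝓝[>] 0, |p t| < |L| + 1 :=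
      hL.abs.eventually_lt_const (by linarith)
    have hL1 : 0 < |L| + 1 := by positivity
    set μ := |κ| / 2 / (|L| + 1) with hμdef
    have hμ : 0 < μ := by positivity
    have hμp : ∀ t, |p t| < |L| + 1 → μ * p t ≤ |κ| / 2 := fun t ht => by
      calc μ * p t ≤ μ * (|L| + 1) := by gcongr; exact (le_abs_self _).trans ht.le
        _ = |κ| / 2 := by rw [hμdef]; field_simp
    rcases (show κ ≠ 0 from hκ).lt_or_gt with h | h
    · refine false_of_deriv_sub_log_nonneg (f := fun t => -p t) (C := |L| + 1)
        (f' := fun t => -(l t * ((2 * p t - c t) * (p t - c t) / D t + g t))) hμ hD hD0 ?_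
      filter_upwards [hD, hp, hl, hpL, hlim.eventually_lt_const (by linarith : κ < κ / 2)]
        with t hDt hpt hlt hpLt hlimt
      refine ⟨hpt.neg, by linarith [(abs_lt.1 hpLt).2], ?_⟩
      have hDne := hDt.1.ne'
      have e : -(l t * ((2 * p t - c t) * (p t - c t) / D t + g t)) - μ * (l t * p t / D t)
          = l t / D t * (-((2 * p t - c t) * (p t - c t) + D t * g t) - μ * p t) := by
        field_simp
      rw [e]
      have := hμp t hpLt
      rw [abs_of_neg h] at this
      exact mul_nonneg (div_pos hlt hDt.1).le (by linarith)
    · refine false_of_deriv_sub_log_nonneg (f := p) (C := |L| + 1)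
        (f' := fun t => l t * ((2 * p t - c t) * (p t - c t) / D t + g t)) hμ hD hD0 ?_
      filter_upwards [hD, hp, hl, hpL, hlim.eventually_const_lt (by linarith : κ / 2 < κ)]
        with t hDt hpt hlt hpLt hlimt
      refine ⟨hpt, by linarith [(abs_lt.1 hpLt).1], ?_⟩
      have hDne := hDt.1.ne'
      have e : l t * ((2 * p t - c t) * (p t - c t) / D t + g t) - μ * (l t * p t / D t)
          = l t / D t * (((2 * p t - c t) * (p t - c t) + D t * g t) - μ * p t) := by
        field_simp
      rw [e]
      have := hμp t hpLt
      rw [abs_of_pos h] at this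
      exact mul_nonneg (div_pos hlt hDt.1).le (by linarith)
  have hL' : L = c₀ / 2 ∨ L = c₀ := by
    rcases mul_eq_zero.1 hroot with h | h
    · left; linarith
    · right; linarith
  refine ⟨?_, ?_⟩
  · rcases hc₀.lt_or_gt with h | h
    · have hLneg : L < 0 := by rcases hL' with h' | h' <;> linarith
      exact absurd ((hL.eventually_lt_const hLneg).mono fun t ht => ht.le) hpos
    · exact h
  · rcases hL' with rfl | rfl
    · exact Or.inl hL
    · exact Or.inr hL

/-! ### Change of parameter -/

/-- The derivative along a vector field governs the derivative along any curve whose velocity is a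
nonvanishing continuous multiple of the field. -/
lemma HasDerivAlong.hasDerivAt_comp {V : Plane → Plane} {g : Plane → ℝ} {g' : ℝ} {γ : ℝ → Plane}
    {l : ℝ → ℝ} {α β t₀ : ℝ} (h : HasDerivAlong V g g' (γ t₀)) (ht₀ : t₀ ∈ Ioo α β)
    (hl : ContinuousOn l (Ioo α β)) (hl0 : l t₀ ≠ 0)
    (hγ : ∀ t ∈ Ioo α β, HasDerivAt γ (l t • V (γ t)) t) :
    HasDerivAt (fun t => g (γ t)) (l t₀ * g') t₀ := by
  set Φ : ℝ → ℝ := fun t => ∫ s in t₀..t, l s with hΦ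
  have hΦ0 : Φ t₀ = 0 := by simp [hΦ]
  have hΦd : ∀ t ∈ Ioo α β, HasDerivAt Φ (l t) t := fun t ht => hasDerivAt_integral_Ioo hl ht₀ ht
  have hnhds : Ioo α β ∈ 𝓝 t₀ := isOpen_Ioo.mem_nhds ht₀
  have hlc : ContinuousAt l t₀ := hl.continuousAt hnhds
  have hstrict : HasStrictDerivAt Φ (l t₀) t₀ :=
    hasStrictDerivAt_of_hasDerivAt_of_continuousAt (Filter.mem_of_superset hnhds hΦd) hlc
  set e := (hstrict.hasStrictFDerivAt_equiv hl0).toOpenPartialHomeomorph Φ with he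
  have hecoe : (e : ℝ → ℝ) = Φ := rfl
  have hsrc : t₀ ∈ e.source := (hstrict.hasStrictFDerivAt_equiv hl0).mem_toOpenPartialHomeomorph_source
  have htgt : (0 : ℝ) ∈ e.target := by
    rw [← hΦ0, ← hecoe]; exact e.map_source hsrc
  have hsymm0 : e.symm 0 = t₀ := by
    conv_lhs => rw [← hΦ0, ← hecoe]
    exact e.left_inv hsrc
  have hsymmc : ContinuousAt e.symm 0 := e.symm.continuousAt htgt
  have hη : IsIntegralCurveAt (fun s => γ (e.symm s)) (fun _ => V) 0 := by
    have h1 : ∀ᶠ s in 𝓝 (0 : ℝ), e.symm s ∈ Ioo α β ∧ l (e.symm s) ≠ 0 := by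
      have := (Filter.eventually_of_mem hnhds fun t ht => ht).and (hlc.eventually_ne hl0)
      rw [← hsymm0] at this
      exact hsymmc.eventually this
    filter_upwards [h1, e.open_target.mem_nhds htgt] with s hs hst
    have h2 : HasDerivAt e.symm (l (e.symm s))⁻¹ s :=
      e.hasDerivAt_symm hst hs.2 (hΦd _ hs.1)
    refine ((hγ _ hs.1).scomp s h2).congr_deriv ?_
    rw [smul_smul, inv_mul_cancel₀ hs.2, one_smul]
  have h3 := h (fun s => γ (e.symm s)) (by rw [hsymm0]) hη
  rw [← hΦ0] at h3
  have h4 := h3.comp t₀ (hΦd t₀ ht₀)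
  rw [mul_comm]
  refine h4.congr_of_eventuallyEq ?_
  filter_upwards [e.open_source.mem_nhds hsrc] with t ht
  have : e.symm (Φ t) = t := e.left_inv ht
  simp only [Function.comp, this]

end

/-! ### The derivative of `D` along `N^⊥` -/

section

variable {Ω : Set Plane} {u : Plane → ℝ} {F : Plane → Plane} {H : Plane → ℝ}

/-- Integral curves of `N^⊥` through a nonsingular point are unique, although `N^⊥` is only
continuous. -/
lemma eventuallyEq_of_isIntegralCurveAt_unitNormalPerp (hΩ : IsOpen Ω) (hu : ContDiffOn ℝ 1 u Ω)
    (hF : ContDiffOn ℝ 1 F Ω) (hH : ContinuousOn H Ω) (hweak : IsWeakSolution Ω u F H) {q : Plane}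
    (hq : q ∈ Ω \ singularSet Ω u F) {γ₁ γ₂ : ℝ → Plane} (h₁0 : γ₁ 0 = q) (h₂0 : γ₂ 0 = q)
    (h₁ : IsIntegralCurveAt γ₁ (fun _ => unitNormalPerp u F) 0)
    (h₂ : IsIntegralCurveAt γ₂ (fun _ => unitNormalPerp u F) 0) : γ₂ =ᶠ[𝓝 0] γ₁ := by
  obtain ⟨R, m, K, T, hsub, hloc, -, -⟩ := exists_isLocalSolution hΩ hu hF hH hweak hq
  have hball : ∀ γ : ℝ → Plane, γ 0 = q → IsIntegralCurveAt γ (fun _ => unitNormalPerp u F) 0 →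
      ∀ᶠ t in 𝓝 (0 : ℝ), γ t ∈ ball q R := fun γ h0 h =>
    h.self_of_nhds.continuousAt.eventually (by rw [h0]; exact ball_mem_nhds q hloc.R_pos)
  obtain ⟨S, hS, hall⟩ := Metric.eventually_nhds_iff_ball.1
    ((Filter.Eventually.and h₁ h₂).and ((hball γ₁ h₁0 h₁).and (hball γ₂ h₂0 h₂)))
  rw [Real.ball_eq_Ioo, zero_sub, zero_add] at hall
  obtain ⟨C, -, hstab⟩ := hloc.frame.stability one_pos S
  have hBc := hloc.contB.mono ball_subset_closedBall
  have hunit : ∀ x ∈ ball q R, ‖unitNormalPerp u F x‖ ≤ 1 := fun x hx => by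
    rw [unitNormalPerp, norm_perp, norm_unitNormal (hsub (ball_subset_closedBall hx))]
  have hA : ∀ x, (inner ℝ (gradLength u F x • unitNormal u F x) (unitNormalPerp u F x) : ℝ) = 0 :=
    fun x => by rw [inner_smul_left, unitNormalPerp, inner_self_perp, mul_zero]
  have hB : ∀ x ∈ ball q R,
      (inner ℝ (perp (unitNormal u F x)) (unitNormalPerp u F x) : ℝ) = 1 := fun x hx => by
    rw [unitNormalPerp, inner_perp_perp, real_inner_self_eq_norm_sq,
      norm_unitNormal (hsub (ball_subset_closedBall hx)), one_pow]
  have hcont : ∀ γ : ℝ → Plane, (∀ t ∈ Ioo (-S) S, HasDerivAt γ (unitNormalPerp u F (γ t)) t) →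
      MapsTo γ (Ioo (-S) S) (ball q R) →
      ContinuousOn (fun t => unitNormalPerp u F (γ t)) (Ioo (-S) S) := fun γ hγ hmem =>
    hBc.comp (fun t ht => (hγ t ht).continuousAt.continuousWithinAt) hmem
  have key := hstab γ₁ γ₂ (fun t => unitNormalPerp u F (γ₁ t)) (fun t => unitNormalPerp u F (γ₂ t))
    S 0 le_rfl (fun t ht => (hall t ht).1.1) (fun t ht => (hall t ht).1.2)
    (hcont γ₁ (fun t ht => (hall t ht).1.1) fun t ht => (hall t ht).2.1)
    (hcont γ₂ (fun t ht => (hall t ht).1.2) fun t ht => (hall t ht).2.2)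
    (fun t ht => (hall t ht).2.1) (fun t ht => (hall t ht).2.2)
    (fun t ht => hunit _ (hall t ht).2.1) (fun t ht => hunit _ (hall t ht).2.2)
    (fun t ht => by rw [hA, hA]; simp)
    (fun t ht => by rw [hB _ (hall t ht).2.1, hB _ (hall t ht).2.2]; simp)
  filter_upwards [isOpen_Ioo.mem_nhds (⟨by linarith, hS⟩ : (0 : ℝ) ∈ Ioo (-S) S)] with t ht
  have := key t ht
  rw [h₁0, h₂0, sub_self, norm_zero, zero_add, mul_zero, norm_le_zero_iff, sub_eq_zero] at this
  exact this

/-- The Jacobi equation along an integral curve of `N^⊥` through a nonsingular point. -/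
lemma exists_jacobi_field_unitNormalPerp (hΩ : IsOpen Ω) (hu : ContDiffOn ℝ 1 u Ω)
    (hF : ContDiffOn ℝ 1 F Ω) (hH : ContinuousOn H Ω) (hweak : IsWeakSolution Ω u F H)
    {H' : Plane → ℝ} (hH'c : ContinuousOn H' Ω)
    (hH' : ∀ q ∈ Ω \ singularSet Ω u F, HasDerivAlong (unitNormal u F) H (H' q) q) {γ : ℝ → Plane}
    (hq : γ 0 ∈ Ω \ singularSet Ω u F)
    (hγ : IsIntegralCurveAt γ (fun _ => unitNormalPerp u F) 0) :
    ∃ δ, 0 < δ ∧ ∃ v w : ℝ → ℝ, ∀ s ∈ Ioo (-δ) δ, γ s ∈ Ω \ singularSet Ω u F ∧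
      HasDerivAt γ (unitNormalPerp u F (γ s)) s ∧ 0 < v s ∧ HasDerivAt v (w s) s ∧
      HasDerivAt w (-((H' (γ s) + H (γ s) ^ 2) * v s)) s ∧
      HasDerivAt (fun s => gradLength u F (γ s) * v s) (planarCurl F (γ s) * v s) s := by
  obtain ⟨R, m, K, T, hsub, hloc, hT, hflow⟩ := exists_isLocalSolution hΩ hu hF hH hweak hq
  have hR := hloc.R_pos
  have hball : ∀ᶠ t in 𝓝 (0 : ℝ), γ t ∈ ball (γ 0) (R / 4) :=
    hγ.self_of_nhds.continuousAt.eventually (ball_mem_nhds _ (by positivity))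
  obtain ⟨S, hS, hall⟩ := Metric.eventually_nhds_iff_ball.1 (Filter.Eventually.and hγ hball)
  rw [Real.ball_eq_Ioo, zero_sub, zero_add] at hall
  obtain ⟨δ, hδ, hδS, v, w, h⟩ := hloc.exists_jacobi_field hT hflow
    (hH'c.mono (hsub.trans sdiff_subset)) (fun η t hη => by
      obtain ⟨ε, hε, hη'⟩ := Metric.eventually_nhds_iff_ball.1 hη
      rw [Real.ball_eq_Ioo] at hη'
      have ht : t ∈ Ioo (t - ε) (t + ε) := ⟨by linarith, by linarith⟩
      refine (hH' (η t) (hsub (ball_subset_closedBall (hη' t ht).1))).hasDerivAt_comp ht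
        (l := fun r => (gradLength u F (η r))⁻¹) ?_ ?_ fun r hr => (hη' r hr).2
      · refine ContinuousOn.inv₀ (hloc.contD.comp (fun r hr =>
          (hη' r hr).2.continuousAt.continuousWithinAt) fun r hr =>
          ball_subset_closedBall (hη' r hr).1) fun r hr => ?_
        exact (hloc.D_pos _ (ball_subset_closedBall (hη' r hr).1)).ne'
      · exact inv_ne_zero (hloc.D_pos _ (ball_subset_closedBall (hη' t ht).1)).ne')
    hS (fun s hs => (hall s hs).1) fun s hs => (hall s hs).2
  refine ⟨δ, hδ, v, w, fun s hs => ?_⟩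
  have hs' : s ∈ Ioo (-S) S := ⟨by linarith [hs.1], by linarith [hs.2]⟩
  exact ⟨hsub (ball_subset_closedBall (ball_subset_ball (by linarith) (hall s hs').2)),
    (hall s hs').1, h s hs⟩

/-- `D' = N^⊥(D)` exists, and is itself differentiable along `N^⊥`: this is the Codazzi-type
equation `D D'' = (2 D' - c) (D' - c) + D (N^⊥(c) + D (N(H) + H²))`. -/
lemma exists_deriv_gradLength (hΩ : IsOpen Ω) (hu : ContDiffOn ℝ 1 u Ω)
    (hF : ContDiffOn ℝ 1 F Ω) (hH : ContinuousOn H Ω) (hweak : IsWeakSolution Ω u F H)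
    {H' : Plane → ℝ} (hH'c : ContinuousOn H' Ω)
    (hH' : ∀ q ∈ Ω \ singularSet Ω u F, HasDerivAlong (unitNormal u F) H (H' q) q)
    {c' : Plane → ℝ} (hc' : ∀ q ∈ Ω \ singularSet Ω u F,
      HasDerivAlong (unitNormalPerp u F) (planarCurl F) (c' q) q) :
    ∃ D' : Plane → ℝ, ∀ q ∈ Ω \ singularSet Ω u F,
      HasDerivAlong (unitNormalPerp u F) (gradLength u F) (D' q) q ∧
      HasDerivAlong (unitNormalPerp u F) D'
        ((2 * D' q - planarCurl F q) * (D' q - planarCurl F q) / gradLength u F q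
          + (c' q + gradLength u F q * (H' q + H q ^ 2))) q := by
  have jac := fun {γ : ℝ → Plane} => exists_jacobi_field_unitNormalPerp (γ := γ) hΩ hu hF hH hweak
    hH'c hH'
  -- the value of `N^⊥(D)` in terms of the separation `v` and its derivative
  have hval : ∀ (γ : ℝ → Plane) (v w : ℝ → ℝ) (s : ℝ), γ s ∈ Ω \ singularSet Ω u F → 0 < v s →
      HasDerivAt v (w s) s →
      HasDerivAt (fun s => gradLength u F (γ s) * v s) (planarCurl F (γ s) * v s) s →
      HasDerivAt (fun s => gradLength u F (γ s))
        (planarCurl F (γ s) - gradLength u F (γ s) * w s / v s) s := by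
    intro γ v w s hs hv hvd hDv
    have hpos : ∀ᶠ r in 𝓝 s, 0 < v r := hvd.continuousAt.eventually (lt_mem_nhds hv)
    have hv0 := hv.ne'
    refine ((hDv.div hvd hv0).congr_of_eventuallyEq ?_).congr_deriv ?_
    · filter_upwards [hpos] with r hr
      have hr0 := hr.ne'
      simp only [Pi.div_apply]
      field_simp
    · field_simp
  have hex : ∀ q ∈ Ω \ singularSet Ω u F, ∃ d,
      HasDerivAlong (unitNormalPerp u F) (gradLength u F) d q := by
    intro q hq
    by_cases hγ : ∃ γ : ℝ → Plane, γ 0 = q ∧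
        IsIntegralCurveAt γ (fun _ => unitNormalPerp u F) 0
    · obtain ⟨γ, hγ0, hγ⟩ := hγ
      obtain ⟨δ, hδ, v, w, h⟩ := jac (γ := γ) (by rw [hγ0]; exact hq) hγ
      obtain ⟨h1, h2, h3, h4, h5, h6⟩ := h 0 ⟨by linarith, hδ⟩
      refine ⟨_, fun η hη0 hη => (hval γ v w 0 h1 h3 h4 h6).congr_of_eventuallyEq ?_⟩
      filter_upwards [eventuallyEq_of_isIntegralCurveAt_unitNormalPerp hΩ hu hF hH hweak hq hγ0 hη0
        hγ hη] with t ht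
      rw [ht]
    · exact ⟨0, fun η hη0 hη => absurd ⟨η, hη0, hη⟩ hγ⟩
  choose! D' hD' using hex
  refine ⟨D', fun q hq => ⟨hD' q hq, fun γ hγ0 hγ => ?_⟩⟩
  obtain ⟨δ, hδ, v, w, h⟩ := jac (γ := γ) (by rw [hγ0]; exact hq) hγ
  have h0 : (0 : ℝ) ∈ Ioo (-δ) δ := ⟨by linarith, hδ⟩
  have hD'γ : ∀ s ∈ Ioo (-δ) δ,
      D' (γ s) = planarCurl F (γ s) - gradLength u F (γ s) * w s / v s := by
    intro s hs
    obtain ⟨h1, h2, h3, h4, h5, h6⟩ := h s hs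
    have hd := (hD' (γ s) h1).hasDerivAt_comp hs (l := fun _ => 1) continuousOn_const one_ne_zero
      fun t ht => by rw [one_smul]; exact (h t ht).2.1
    rw [one_mul] at hd
    exact hd.unique (hval γ v w s h1 h3 h4 h6)
  obtain ⟨h1, h2, h3, h4, h5, h6⟩ := h 0 h0
  have hcγ : HasDerivAt (fun s => planarCurl F (γ s)) (c' q) 0 := hc' q hq γ hγ0 hγ
  have hDγ := hval γ v w 0 h1 h3 h4 h6
  have hv0 := h3.ne'
  refine ((hcγ.sub ((hDγ.mul h5).div h4 hv0)).congr_of_eventuallyEq ?_).congr_deriv ?_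
  · filter_upwards [isOpen_Ioo.mem_nhds h0] with s hs
    rw [hD'γ s hs]
    rfl
  · have hD0 := (gradLength_pos h1).ne'
    have e := hD'γ 0 h0
    rw [← hγ0, e]
    simp only [Pi.mul_apply]
    field_simp
    ring

/-! ### Characteristic curves at singular points -/

lemma forall_pos_or_forall_neg_of_continuousOn {X : Type*} [TopologicalSpace X] {l : X → ℝ}
    {s : Set X} (hs : IsPreconnected s)
    (hl : ContinuousOn l s) (h0 : ∀ t ∈ s, l t ≠ 0) :
    (∀ t ∈ s, 0 < l t) ∨ ∀ t ∈ s, l t < 0 := by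
  by_contra hcon
  push Not at hcon
  obtain ⟨⟨a, ha, hla⟩, b, hb, hlb⟩ := hcon
  obtain ⟨t, ht, ht0⟩ := hs.intermediate_value ha hb hl ⟨hla, hlb⟩
  exact h0 t ht ht0

/-- The behaviour of `D'` along a curve `Γ` with velocity `l N^⊥` that starts at a singular point;
it also determines the sign of `l`. -/
lemma tendsto_deriv_gradLength (hΩ : IsOpen Ω) (hu : ContDiffOn ℝ 1 u Ω)
    (hF : ContDiffOn ℝ 1 F Ω) (hH : ContinuousOn H Ω)
    {H' : Plane → ℝ} (hH'c : ContinuousOn H' Ω) {c' : Plane → ℝ} (hc'c : ContinuousOn c' Ω)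
    {D' : Plane → ℝ} (hD' : ∀ q ∈ Ω \ singularSet Ω u F,
      HasDerivAlong (unitNormalPerp u F) (gradLength u F) (D' q) q ∧
      HasDerivAlong (unitNormalPerp u F) D'
        ((2 * D' q - planarCurl F q) * (D' q - planarCurl F q) / gradLength u F q
          + (c' q + gradLength u F q * (H' q + H q ^ 2))) q)
    {p : Plane} (hp : p ∈ singularSet Ω u F) (hcp : planarCurl F p ≠ 0) {Γ : ℝ → Plane}
    {l : ℝ → ℝ} {r : ℝ} (hr : 0 < r) (hΓp : Tendsto Γ (𝓝[>] 0) (𝓝 p))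
    (hl : ContinuousOn l (Ioo 0 r)) (hl0 : ∀ t ∈ Ioo 0 r, l t ≠ 0)
    (hΓ : ∀ t ∈ Ioo 0 r, Γ t ∈ Ω \ singularSet Ω u F ∧
      HasDerivAt Γ (l t • unitNormalPerp u F (Γ t)) t) :
    (Tendsto (fun t => D' (Γ t)) (𝓝[>] 0) (𝓝 (planarCurl F p / 2)) ∨
      Tendsto (fun t => D' (Γ t)) (𝓝[>] 0) (𝓝 (planarCurl F p))) ∧
    ((∀ t ∈ Ioo 0 r, 0 < l t) → 0 < planarCurl F p) ∧
    ((∀ t ∈ Ioo 0 r, l t < 0) → planarCurl F p < 0) := by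
  have hlim : ∀ f : Plane → ℝ, ContinuousOn f Ω →
      Tendsto (fun t => f (Γ t)) (𝓝[>] 0) (𝓝 (f p)) := fun f hf =>
    (hf.continuousAt (hΩ.mem_nhds hp.1)).tendsto.comp hΓp
  have hev : ∀ᶠ t in 𝓝[>] (0 : ℝ), t ∈ Ioo 0 r := Ioo_mem_nhdsGT hr
  have hDc := continuousOn_gradLength hΩ hu hF
  have hD0 : Tendsto (fun t => gradLength u F (Γ t)) (𝓝[>] 0) (𝓝 0) := by
    have := hlim _ hDc
    rwa [gradLength, hp.2, norm_zero] at this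
  have hc := hlim _ (continuousOn_planarCurl hΩ hF)
  have hder : ∀ (f f' : Plane → ℝ), (∀ q ∈ Ω \ singularSet Ω u F,
      HasDerivAlong (unitNormalPerp u F) f (f' q) q) →
      ∀ t ∈ Ioo 0 r, HasDerivAt (fun t => f (Γ t)) (l t * f' (Γ t)) t := fun f f' hf t ht =>
    (hf _ (hΓ t ht).1).hasDerivAt_comp ht hl (hl0 t ht) fun s hs => (hΓ s hs).2
  have hD : ∀ᶠ t in 𝓝[>] 0, 0 < gradLength u F (Γ t) ∧
      HasDerivAt (fun t => gradLength u F (Γ t)) (l t * D' (Γ t)) t :=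
    hev.mono fun t ht => ⟨gradLength_pos (hΓ t ht).1, hder _ _ (fun q hq => (hD' q hq).1) t ht⟩
  have hD'd := hder D' _ fun q hq => (hD' q hq).2
  set g : Plane → ℝ := fun q => c' q + gradLength u F q * (H' q + H q ^ 2) with hg
  have hgc : ContinuousOn g Ω := hc'c.add (hDc.mul (hH'c.add (hH.pow 2)))
  have hgb : ∀ᶠ t in 𝓝[>] 0, |g (Γ t)| ≤ |g p| + 1 :=
    ((hlim g hgc).abs.eventually_lt_const (lt_add_one _)).mono fun t ht => ht.le
  have hpos : (∀ t ∈ Ioo 0 r, 0 < l t) → 0 < planarCurl F p ∧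
      (Tendsto (fun t => D' (Γ t)) (𝓝[>] 0) (𝓝 (planarCurl F p / 2)) ∨
      Tendsto (fun t => D' (Γ t)) (𝓝[>] 0) (𝓝 (planarCurl F p))) := fun hlpos =>
    tendsto_of_singular_system hcp hD (hev.mono hD'd) (hev.mono hlpos) hgb hD0 hc
  -- for the opposite orientation, the signs of `l`, `D'` and `c` are reversed
  have hneg : (∀ t ∈ Ioo 0 r, l t < 0) → 0 < -planarCurl F p ∧
      (Tendsto (fun t => -D' (Γ t)) (𝓝[>] 0) (𝓝 (-planarCurl F p / 2)) ∨
      Tendsto (fun t => -D' (Γ t)) (𝓝[>] 0) (𝓝 (-planarCurl F p))) := fun hlneg =>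
    tendsto_of_singular_system (l := fun t => -l t) (c := fun t => -planarCurl F (Γ t))
      (g := fun t => g (Γ t)) (neg_ne_zero.2 hcp)
      (hD.mono fun t ht => ⟨ht.1, ht.2.congr_deriv (by ring)⟩)
      (hev.mono fun t ht => (hD'd t ht).neg.congr_deriv (by simp only [hg]; ring))
      (hev.mono fun t ht => neg_pos.2 (hlneg t ht)) hgb hD0 hc.neg
  refine ⟨?_, fun h => (hpos h).1, fun h => by linarith [(hneg h).1]⟩
  rcases forall_pos_or_forall_neg_of_continuousOn isPreconnected_Ioo hl hl0 with h | h
  · exact (hpos h).2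
  · rcases (hneg h).2 with h' | h'
    · left
      have := h'.neg
      simp only [neg_neg, neg_div] at this
      exact this
    · right
      have := h'.neg
      simp only [neg_neg] at this
      exact this

/-- The velocity of a characteristic curve is a continuous multiple of `N^⊥`. -/
lemma IsCharacteristicOn.exists_continuousOn (hΩ : IsOpen Ω) (hu : ContDiffOn ℝ 1 u Ω)
    (hF : ContDiffOn ℝ 1 F Ω) {Γ : ℝ → Plane} {r : ℝ} (hΓ : ContDiffOn ℝ 1 Γ (Ioo 0 r))
    (h : IsCharacteristicOn Ω u F Γ (Ioo 0 r)) :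
    ∃ l : ℝ → ℝ, ContinuousOn l (Ioo 0 r) ∧ ∀ t ∈ Ioo 0 r, l t ≠ 0 ∧
      Γ t ∈ Ω \ singularSet Ω u F ∧ HasDerivAt Γ (l t • unitNormalPerp u F (Γ t)) t := by
  refine ⟨fun t => inner ℝ (unitNormalPerp u F (Γ t)) (deriv Γ t), ?_, fun t ht => ?_⟩
  · refine ContinuousOn.inner (𝕜 := ℝ) ?_ (hΓ.continuousOn_deriv_of_isOpen isOpen_Ioo le_rfl)
    exact continuous_perp.comp_continuousOn
      ((continuousOn_unitNormal hΩ hu hF).comp hΓ.continuousOn fun t ht => (h t ht).1)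
  · obtain ⟨hmem, c, hc, hd⟩ := h t ht
    have : (inner ℝ (unitNormalPerp u F (Γ t)) (deriv Γ t) : ℝ) = c := by
      rw [hd.deriv, inner_smul_right, real_inner_self_eq_norm_sq, unitNormalPerp, norm_perp,
        norm_unitNormal hmem]
      simp
    simp only [this]
    exact ⟨hc, hmem, hd⟩

end

end

theorem theoremB (Ω : Set Plane) (hΩ_open : IsOpen Ω) (hΩ_conn : IsConnected Ω)
    (u : Plane → ℝ) (F : Plane → Plane) (H : Plane → ℝ)
    (hu : ContDiffOn ℝ 1 u Ω) (hF : ContDiffOn ℝ 1 F Ω) (hH : ContinuousOn H Ω)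
    (hweak : IsWeakSolution Ω u F H)
    (hcurl : DerivAlongExtendsContinuously Ω u F (unitNormalPerp u F) (planarCurl F))
    (hNH : DerivAlongExtendsContinuously Ω u F (unitNormal u F) H) :
    (∀ p ∈ singularSet Ω u F, planarCurl F p ≠ 0 →
      ∀ (r : ℝ) (Γ : ℝ → Plane), 0 < r →
        ContDiffOn ℝ 1 Γ (Set.Ico 0 r) → Set.MapsTo Γ (Set.Ico 0 r) Ω → Γ 0 = p →
        IsCharacteristicOn Ω u F Γ (Set.Ioo 0 r) → (∀ ρ ∈ Set.Ioo 0 r, ‖deriv Γ ρ‖ = 1) →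
        -- (a)
        (∃ D' : Plane → ℝ,
          (∀ q ∈ Ω \ singularSet Ω u F,
            HasDerivAlong (unitNormalPerp u F) (gradLength u F) (D' q) q) ∧
          (Filter.Tendsto (fun ρ => D' (Γ ρ)) (nhdsWithin 0 (Set.Ioi 0))
              (nhds (planarCurl F p / 2)) ∨
            Filter.Tendsto (fun ρ => D' (Γ ρ)) (nhdsWithin 0 (Set.Ioi 0))
              (nhds (planarCurl F p)))) ∧
        -- (b)
        (0 < planarCurl F p →
          ∀ ρ ∈ Set.Ioo 0 r, HasDerivAt Γ (unitNormalPerp u F (Γ ρ)) ρ) ∧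
        (planarCurl F p < 0 →
          ∀ ρ ∈ Set.Ioo 0 r, HasDerivAt Γ (-unitNormalPerp u F (Γ ρ)) ρ)) ∧
    -- (c)
    ((∀ x ∈ Ω, planarCurl F x ≠ 0) →
      ∀ p ∈ singularSet Ω u F, ∀ q ∈ singularSet Ω u F, p ≠ q →
        ¬ ∃ (r : ℝ) (Γ : ℝ → Plane), 0 < r ∧
          ContDiffOn ℝ 1 Γ (Set.Icc 0 r) ∧ Set.MapsTo Γ (Set.Icc 0 r) Ω ∧
          Γ 0 = p ∧ Γ r = q ∧ IsCharacteristicOn Ω u F Γ (Set.Ioo 0 r)) := by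
  obtain ⟨c', hc'c, hc'⟩ := hcurl
  obtain ⟨H', hH'c, hH'⟩ := hNH
  obtain ⟨D', hD'⟩ := exists_deriv_gradLength hΩ_open hu hF hH hweak hH'c hH' hc'
  refine ⟨?_, ?_⟩
  · intro p hp hcp r Γ hr hΓ _ hΓ0 hchar hunit
    obtain ⟨l, hl, hΓl⟩ := hchar.exists_continuousOn hΩ_open hu hF
      (hΓ.mono Set.Ioo_subset_Ico_self)
    have hΓp : Filter.Tendsto Γ (nhdsWithin 0 (Set.Ioi 0)) (nhds p) := by
      rw [← hΓ0, ← nhdsWithin_Ioo_eq_nhdsGT hr]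
      exact (hΓ.continuousOn 0 ⟨le_rfl, hr⟩).mono_left (nhdsWithin_mono _ Set.Ioo_subset_Ico_self)
    obtain ⟨hlim, hpos, hneg⟩ := tendsto_deriv_gradLength hΩ_open hu hF hH hH'c hc'c hD' hp hcp hr
      hΓp hl (fun t ht => (hΓl t ht).1) fun t ht => (hΓl t ht).2
    have habs : ∀ t ∈ Set.Ioo 0 r, |l t| = 1 := fun t ht => by
      have := hunit t ht
      rwa [(hΓl t ht).2.2.deriv, norm_smul, unitNormalPerp, norm_perp,
        norm_unitNormal (hΓl t ht).2.1, mul_one, Real.norm_eq_abs] at this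
    have hsign := forall_pos_or_forall_neg_of_continuousOn isPreconnected_Ioo hl
      fun t ht => (hΓl t ht).1
    refine ⟨⟨D', fun q hq => (hD' q hq).1, hlim⟩, fun hc t ht => ?_, fun hc t ht => ?_⟩
    · rcases hsign with h | h
      · have h1 := habs t ht
        rw [abs_of_pos (h t ht)] at h1
        have := (hΓl t ht).2.2
        rwa [h1, one_smul] at this
      · exact absurd (hneg h) (not_lt.2 hc.le)
    · rcases hsign with h | h
      · exact absurd (hpos h) (not_lt.2 hc.le)
      · have h1 := habs t ht
        rw [abs_of_neg (h t ht), neg_eq_iff_eq_neg] at h1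
        have := (hΓl t ht).2.2
        rwa [h1, neg_smul, one_smul] at this
  · rintro hc p hp q hq - ⟨r, Γ, hr, hΓ, -, hΓ0, hΓr, hchar⟩
    obtain ⟨l, hl, hΓl⟩ := hchar.exists_continuousOn hΩ_open hu hF
      (hΓ.mono Set.Ioo_subset_Icc_self)
    have hΓp : Filter.Tendsto Γ (nhdsWithin 0 (Set.Ioi 0)) (nhds p) := by
      rw [← hΓ0, ← nhdsWithin_Ioo_eq_nhdsGT hr]
      exact (hΓ.continuousOn 0 ⟨le_rfl, hr.le⟩).mono_left
        (nhdsWithin_mono _ Set.Ioo_subset_Icc_self)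
    -- the same curve, run backwards from `q`
    have hmem : ∀ t ∈ Set.Ioo 0 r, r - t ∈ Set.Ioo 0 r := fun t ht =>
      ⟨by linarith [ht.2], by linarith [ht.1]⟩
    have hΓq : Filter.Tendsto (fun t => Γ (r - t)) (nhdsWithin 0 (Set.Ioi 0)) (nhds q) := by
      have h1 : Filter.Tendsto (fun t : ℝ => r - t) (nhdsWithin 0 (Set.Ioi 0))
          (nhdsWithin r (Set.Icc 0 r)) := by
        refine tendsto_nhdsWithin_iff.2 ⟨?_, ?_⟩
        · have : Filter.Tendsto (fun t : ℝ => r - t) (nhds 0) (nhds (r - 0)) :=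
            (continuous_const.sub continuous_id).tendsto 0
          rw [sub_zero] at this
          exact this.mono_left nhdsWithin_le_nhds
        · filter_upwards [Ioo_mem_nhdsGT hr] with t ht
          exact Set.Ioo_subset_Icc_self (hmem t ht)
      rw [← hΓr]
      exact (hΓ.continuousOn r ⟨hr.le, le_rfl⟩).tendsto.comp h1
    obtain ⟨-, hposp, hnegp⟩ := tendsto_deriv_gradLength hΩ_open hu hF hH hH'c hc'c hD' hp
      (hc p hp.1) hr hΓp hl (fun t ht => (hΓl t ht).1) fun t ht => (hΓl t ht).2
    obtain ⟨-, hposq, hnegq⟩ := tendsto_deriv_gradLength hΩ_open hu hF hH hH'c hc'c hD' hq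
      (hc q hq.1) (l := fun t => -l (r - t)) hr hΓq
      (hl.comp (by fun_prop : ContinuousOn (fun t : ℝ => r - t) (Set.Ioo 0 r)) hmem).neg
      (fun t ht => neg_ne_zero.2 (hΓl _ (hmem t ht)).1) fun t ht => by
        obtain ⟨-, h1, h2⟩ := hΓl _ (hmem t ht)
        refine ⟨h1, (h2.scomp t ((hasDerivAt_id t).const_sub r)).congr_deriv ?_⟩
        simp
    have hcsign := forall_pos_or_forall_neg_of_continuousOn hΩ_conn.isPreconnected
      (continuousOn_planarCurl hΩ_open hF) hc
    rcases forall_pos_or_forall_neg_of_continuousOn isPreconnected_Ioo hl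
      fun t ht => (hΓl t ht).1 with h | h
    · have h1 := hposp h
      have h2 := hnegq fun t ht => neg_neg_iff_pos.2 (h _ (hmem t ht))
      rcases hcsign with h3 | h3
      · exact absurd (h3 q hq.1) (not_lt.2 h2.le)
      · exact absurd (h3 p hp.1) (not_lt.2 h1.le)
    · have h1 := hnegp h
      have h2 := hposq fun t ht => neg_pos.2 (h _ (hmem t ht))
      rcases hcsign with h3 | h3
      · exact absurd (h3 p hp.1) (not_lt.2 h1.le)
      · exact absurd (h3 q hq.1) (not_lt.2 h2.le)
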